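/- Let $d\ge 1$. Let $S$ be a stationary point process on $\mathbb R^d$ of intensity $1$ (a random locally finite subset of $\mathbb R^d$) with Palm version $S^\circ$ (the process seen from a typical point, which is placed at the origin), and let $\mathcal P$ denote the law of $S$, respectively of $S^\circ$, and $\mathcal E$ the expectation. For a configuration $\mathbf s$ put $a(s,s',\mathbf s)=1$ if $s\ne s'$ are Voronoi neighbours in $\mathbf s$ (their Voronoi cells share a $(d-1)$-dimensional face) and $a(s,s',\mathbf s)=0$ otherwise, and $a(s)=\sum_{s'}a(s,s')$. Assume: (A1) the law of $S$ is mixing; (A2) for every ball $B$, $\mathcal P(|S\cap\partial B|<d+2)=1$; (A3) $\mathcal E\exp(\beta a(0,S^\circ))<\infty$ for some $\beta>0$; (A4) the $(d-1)$-dimensional measure of the boundary of the Voronoi cell of $0$ in $S^\circ$ has finite second moment; (A5) $\mathcal E\sum_{s\in S^\circ}a(0,s)|s|^{q}<\infty$ for some $q>4$; (A6) almost surely $S$ is not periodic, i.e. $S-x\neq S$ for all $x\ne 0$. A surface $\gamma$ assigns a real number $\gamma(s,\mathbf s)$ to each configuration $\mathbf s$ and each $s\in\mathbf s$ (measurably).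 Its gradient is $\nabla\gamma(s,s',\mathbf s)=a(s,s',\mathbf s)[\gamma(s',\mathbf s)-\gamma(s,\mathbf s)]$ and its Laplacian is $\Delta\gamma(s,\mathbf s)=\sum_{s'\in\mathbf s}\nabla\gamma(s,s',\mathbf s)$; it is harmonic for $\mathbf s$ if $\Delta\gamma(s,\mathbf s)=0$ for all $s\in\mathbf s$. For a field $\zeta$ let $\mathcal C(\zeta)=\frac12\,\mathcal E\sum_{s\in S^\circ}a(0,s)\zeta(0,s,S^\circ)$; if $\zeta$ is also random through the dynamics below, the expectation is taken over all the randomness. Let $\gamma$ be a surface whose gradient is covariant, i.e. $\nabla\gamma(s'-s,s''-s,\mathbf s-s)=\nabla\gamma(s',s'',\mathbf s)$ for all $s,s',s''\in\mathbf s$, and with $\mathcal C(|\nabla\gamma|^r)<\infty$ for some $r>4$. Let $T=(T_n)$ be independent Poisson processes of rate $1$ on $\mathbb R$, with law $P$, independent of $S^\circ$, attached to the points of $S^\circ$ by a measurable enumeration; let $\mathbb P=\mathcal P\times P$. Let $\eta_t=\eta_t^\gamma$, $t\ge0$, be the harness process with initial surface $\gamma$, in which at each epoch $\tau>0$ of the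 clock attached to a point the height at that point is replaced by the average of the heights at its neighbours. It is defined by the graphical construction $$\eta_t(s)=\sum_{s'\in S^\circ}p_t(s,s')\,\gamma(s'),$$ where $p_t(s,s')$ is the conditional probability, given $(S^\circ,T)$, that the walk which starts at $s$ at time $t$, runs backward in time, and at each epoch of the clock of its current location jumps to a uniformly chosen neighbour, is at $s'$ at time $0$. Then $\mathbb P$-a.s. the series defining $\eta_t(s)$ converges absolutely for all $t\ge0$ and $s\in S^\circ$, and: (a) $\mathcal C(|\nabla\eta_t|^2)$ is finite for all $t\ge 0$ and non-increasing in $t$; (b) for every $t\ge0$, $u\mapsto\mathcal C(|\nabla\eta_u|^2)$ on $[0,\infty)$ is strictly decreasing at the point $t$ (for $u\ne t$ in a neighbourhood of $t$ in $[0,\infty)$, its value at $u$ is strictly larger than its value at $t$ if $u<t$, and strictly smaller if $u>t$) if and only if it is not the case that $\mathbb P$-a.s. $\eta_t$ is harmonic for $S^\circ$; (c) $\lim_{t\to\infty}a(0)^{-1}\Delta\eta_t(0)=0$ $\mathbb P$-a.s., and, for $\mathcal P$-almost every realization of $S^\circ$, also in $L^2(P)$; (d) $\mathbb P$-a.s.,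 $\lim_{t\to\infty}\Delta\eta_t(s)=0$ for every $s\in S^\circ$. -/

import Mathlib

open MeasureTheory ProbabilityTheory Filter Topology Set
open scoped ENNReal NNReal

namespace Harness

/-! ### Locally finite configurations -/

/-- The space of locally finite point configurations of a metric space `X`. -/
def Conf (X : Type*) [PseudoMetricSpace X] : Type _ :=
  {S : Set X // ∀ B : Set X, Bornology.IsBounded B → (S ∩ B).Finite}

instance {X : Type*} [PseudoMetricSpace X] : SetLike (Conf X) X where
  coe S := S.1
  coe_injective := Subtype.val_injective

/-- The number of points of `S` in `B` (used for bounded `B` only). -/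
noncomputable def count {X : Type*} [PseudoMetricSpace X] (B : Set X) (S : Conf X) : ℕ :=
  ((S : Set X) ∩ B).ncard

/-- The σ-algebra generated by the events `{|S ∩ B| = k}`, for `B` a bounded Borel set. -/
instance {X : Type*} [PseudoMetricSpace X] [MeasurableSpace X] : MeasurableSpace (Conf X) :=
  MeasurableSpace.generateFrom {A | ∃ (B : Set X) (k : ℕ), Bornology.IsBounded B ∧
    MeasurableSet B ∧ A = {S : Conf X | count B S = k}}

/-- Euclidean space `ℝ^d`. -/
abbrev Site (d : ℕ) : Type := EuclideanSpace ℝ (Fin d)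

/-- The translate `τ_x S = {s - x : s ∈ S} = {y : y + x ∈ S}`. -/
def shift {d : ℕ} (x : Site d) (S : Conf (Site d)) : Conf (Site d) :=
  ⟨{y | y + x ∈ S}, fun B hB => by
    have h : ((S : Set (Site d)) ∩ ((fun y => y + x) '' B)).Finite := by
      refine S.2 _ ?_
      obtain ⟨R, hR⟩ := hB.subset_closedBall 0
      refine (Metric.isBounded_closedBall (x := (0 : Site d)) (r := R + ‖x‖)).subset ?_
      rintro _ ⟨y, hy, rfl⟩
      have h1 := hR hy
      simp only [mem_closedBall_zero_iff] at h1 ⊢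
      exact (norm_add_le _ _).trans (by linarith)
    refine (h.preimage (f := fun y => y + x) ?_).subset ?_
    · intro a _ b _ hab
      exact add_right_cancel hab
    · rintro y ⟨hy, hyB⟩
      exact ⟨hy, y, hyB, rfl⟩⟩

/-! ### Measurability facts needed for the Palm measure -/

theorem measurable_count {X : Type*} [PseudoMetricSpace X] [MeasurableSpace X] {B : Set X}
    (hB : Bornology.IsBounded B) (hm : MeasurableSet B) :
    Measurable (count B : Conf X → ℕ) :=
  measurable_to_countable' fun k =>
    MeasurableSpace.measurableSet_generateFrom ⟨B, k, hB, hm, rfl⟩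

/-- For a bounded Borel window `W`, the number of points `x ∈ S ∩ W` such that `(c, S, x)` lies
in a measurable set depends measurably on `(c, S)`. -/
theorem measurable_ncard_window {d : ℕ} {C : Type*} [MeasurableSpace C] {W : Set (Site d)}
    (hW : Bornology.IsBounded W) (hm : MeasurableSet W)
    {D : Set ((C × Conf (Site d)) × Site d)} (hD : MeasurableSet D) :
    Measurable fun p : C × Conf (Site d) =>
      {x : Site d | x ∈ p.2 ∧ x ∈ W ∧ (p, x) ∈ D}.ncard := by
  have hfin : ∀ S : Conf (Site d), ((S : Set (Site d)) ∩ W).Finite := fun S => S.2 W hW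
  have key : ∀ (S : Conf (Site d)) (B : Set (Site d)), MeasurableSet B →
      (Measure.count.restrict ((S : Set (Site d)) ∩ W)) B
        = (((S : Set (Site d)) ∩ (W ∩ B)).ncard : ℝ≥0∞) := by
    intro S B hB
    rw [Measure.restrict_apply hB]
    have hf : (B ∩ ((S : Set (Site d)) ∩ W)).Finite := (hfin S).subset inter_subset_right
    rw [Measure.count_apply_finite _ hf, ← Set.ncard_eq_toFinset_card _ hf]
    congr 2
    ext x; simp only [mem_inter_iff]; tauto
  let κ : Kernel (C × Conf (Site d)) (Site d) :=
    ⟨fun p => Measure.count.restrict ((p.2 : Set (Site d)) ∩ W), by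
      refine Measure.measurable_of_measurable_coe _ fun B hB => ?_
      simp_rw [key _ B hB]
      have h1 : Measurable (count (W ∩ B) : Conf (Site d) → ℕ) :=
        measurable_count (hW.subset inter_subset_left) (hm.inter hB)
      exact (measurable_from_top (f := fun n : ℕ => (n : ℝ≥0∞))).comp (h1.comp measurable_snd)⟩
  have hκ : ∀ p, IsFiniteMeasure (κ p) := fun p => by
    refine ⟨?_⟩
    change (Measure.count.restrict ((p.2 : Set (Site d)) ∩ W)) univ < ⊤
    rw [key _ _ MeasurableSet.univ]
    exact ENNReal.natCast_lt_top _
  have hmeas := Kernel.measurable_kernel_prodMk_left_of_finite hD hκ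
  have heq : (fun p : C × Conf (Site d) =>
      {x : Site d | x ∈ p.2 ∧ x ∈ W ∧ (p, x) ∈ D}.ncard)
        = fun p => (κ p (Prod.mk p ⁻¹' D)).toNNReal.toReal.toNNReal |> fun r => ⌊r⌋₊ := by
    funext p
    change _ = ⌊((Measure.count.restrict ((p.2 : Set (Site d)) ∩ W))
      (Prod.mk p ⁻¹' D)).toNNReal.toReal.toNNReal⌋₊
    rw [key _ _ (measurable_prodMk_left hD)]
    simp only [ENNReal.toNNReal_natCast, NNReal.coe_natCast, Real.toNNReal_natCast,
      Nat.floor_natCast]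
    rfl
  rw [heq]
  exact Nat.measurable_floor.comp
    (measurable_real_toNNReal.comp (measurable_coe_nnreal_real.comp hmeas.ennreal_toNNReal))

theorem measurable_shift {d : ℕ} :
    Measurable fun p : Site d × Conf (Site d) => shift p.1 p.2 := by
  refine measurable_generateFrom ?_
  rintro _ ⟨B, k, hB, hBm, rfl⟩
  have hD : MeasurableSet
      {q : (Site d × Conf (Site d)) × Site d | q.2 - q.1.1 ∈ B} :=
    (measurable_snd.sub (measurable_fst.comp measurable_fst)) hBm
  -- the counts in a growing sequence of windows stabilize
  have hn : ∀ n : ℕ, Measurable fun p : Site d × Conf (Site d) =>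
      {x : Site d | x ∈ p.2 ∧ x ∈ Metric.closedBall (0 : Site d) n ∧
        (p, x) ∈ {q : (Site d × Conf (Site d)) × Site d | q.2 - q.1.1 ∈ B}}.ncard :=
    fun n => measurable_ncard_window Metric.isBounded_closedBall
      Metric.isClosed_closedBall.measurableSet hD
  have hlim : Measurable fun p : Site d × Conf (Site d) => count B (shift p.1 p.2) := by
    refine measurable_of_tendsto_metrizable hn (tendsto_pi_nhds.2 fun p => ?_)
    obtain ⟨R, hR⟩ := hB.subset_closedBall 0
    refine tendsto_const_nhds.congr' ?_
    filter_upwards [eventually_ge_atTop ⌈R + ‖p.1‖⌉₊] with n hnR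
    have hn' : R + ‖p.1‖ ≤ n := (Nat.le_ceil _).trans (by exact_mod_cast hnR)
    refine Set.ncard_congr (fun y _ => y + p.1) ?_ ?_ ?_
    · rintro y ⟨hy, hyB⟩
      refine ⟨hy, ?_, by simpa using hyB⟩
      have h1 := hR hyB
      simp only [mem_closedBall_zero_iff] at h1 ⊢
      exact (norm_add_le _ _).trans (by linarith)
    · intro a b _ _ hab
      exact add_right_cancel hab
    · rintro x ⟨hx, _, hxB⟩
      refine ⟨x - p.1, ⟨?_, hxB⟩, sub_add_cancel _ _⟩
      change x - p.1 + p.1 ∈ p.2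
      rwa [sub_add_cancel]
  exact hlim (measurableSet_singleton k)

/-! ### The Palm measure -/

/-- The unit cube `[0,1)^d`. -/
def unitCube (d : ℕ) : Set (Site d) := {x | ∀ i, x i ∈ Ico (0 : ℝ) 1}

theorem isBounded_unitCube (d : ℕ) : Bornology.IsBounded (unitCube d) := by
  refine (Metric.isBounded_closedBall (x := (0 : Site d)) (r := √d)).subset fun x hx => ?_
  rw [mem_closedBall_zero_iff, EuclideanSpace.norm_eq]
  refine Real.sqrt_le_sqrt ?_
  calc ∑ i, ‖x i‖ ^ 2 ≤ ∑ _i : Fin d, (1 : ℝ) := by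
        refine Finset.sum_le_sum fun i _ => ?_
        have := hx i
        rw [Real.norm_eq_abs, sq_abs]
        nlinarith [this.1, this.2]
    _ = d := by simp

theorem measurableSet_unitCube (d : ℕ) : MeasurableSet (unitCube d) := by
  have : unitCube d = ⋂ i, (fun x : Site d => x i) ⁻¹' Ico (0 : ℝ) 1 := by
    ext x; simp [unitCube]
  rw [this]
  exact MeasurableSet.iInter fun i => (by fun_prop : Measurable fun x : Site d => x i)
    measurableSet_Ico

/-- The number of points `s ∈ S` in the unit cube such that `τ_s S ∈ A`. -/
noncomputable def palmCount {d : ℕ} (A : Set (Conf (Site d))) (S : Conf (Site d)) : ℕ :=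
  {s : Site d | s ∈ S ∧ s ∈ unitCube d ∧ shift s S ∈ A}.ncard

theorem measurable_palmCount {d : ℕ} {A : Set (Conf (Site d))} (hA : MeasurableSet A) :
    Measurable (palmCount A) := by
  have hD : MeasurableSet {q : (Unit × Conf (Site d)) × Site d | shift q.2 q.1.2 ∈ A} :=
    (measurable_shift.comp (measurable_snd.prodMk (measurable_snd.comp measurable_fst))) hA
  exact (measurable_ncard_window (C := Unit) (isBounded_unitCube d) (measurableSet_unitCube d)
    hD).comp (measurable_const.prodMk measurable_id : Measurable fun S => ((), S))

theorem palmCount_iUnion {d : ℕ} (f : ℕ → Set (Conf (Site d)))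
    (hf : Pairwise (Function.onFun Disjoint f)) (S : Conf (Site d)) :
    (palmCount (⋃ i, f i) S : ℝ≥0∞) = ∑' i, (palmCount (f i) S : ℝ≥0∞) := by
  have hfin : ((S : Set (Site d)) ∩ unitCube d).Finite := S.2 _ (isBounded_unitCube d)
  have key : ∀ A : Set (Conf (Site d)), (palmCount A S : ℝ≥0∞)
      = Measure.count {s : Site d | s ∈ S ∧ s ∈ unitCube d ∧ shift s S ∈ A} := by
    intro A
    have h : {s : Site d | s ∈ S ∧ s ∈ unitCube d ∧ shift s S ∈ A}.Finite :=
      hfin.subset fun s hs => ⟨hs.1, hs.2.1⟩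
    rw [Measure.count_apply_finite _ h, palmCount, Set.ncard_eq_toFinset_card _ h]
  simp_rw [key]
  rw [← measure_iUnion]
  · congr 1
    ext s; simp
  · intro i j hij
    refine Set.disjoint_left.2 fun s hs hs' => ?_
    exact Set.disjoint_left.1 (hf hij) hs.2.2 hs'.2.2
  · intro i
    exact (hfin.subset fun s hs => ⟨hs.1, hs.2.1⟩ :
      {s : Site d | s ∈ S ∧ s ∈ unitCube d ∧ shift s S ∈ f i}.Finite).measurableSet

/-- The Palm measure of a stationary law `P` of intensity one: the law of `S` seen from a typical
point, `A ↦ E #{s ∈ S ∩ [0,1)^d : τ_s S ∈ A}`. -/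
noncomputable def palm {d : ℕ} (P : Measure (Conf (Site d))) : Measure (Conf (Site d)) :=
  Measure.ofMeasurable (fun A _ => ∫⁻ S, (palmCount A S : ℝ≥0∞) ∂P)
    (by simp [palmCount])
    (by
      intro f hf hd
      simp_rw [palmCount_iUnion f hd]
      exact lintegral_tsum fun i => ((measurable_from_top (f := fun n : ℕ => (n : ℝ≥0∞))).comp
        (measurable_palmCount (hf i))).aemeasurable)

/-! ### Voronoi neighbours, surfaces, gradient, Laplacian -/

/-- The Voronoi cell of `s` in the configuration `S`. -/
def vor {d : ℕ} (S : Conf (Site d)) (s : Site d) : Set (Site d) :=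
  {x | ∀ s' ∈ S, s' ≠ s → dist x s ≤ dist x s'}

/-- `s` and `s'` are Voronoi neighbours: their cells share a face, that is, the (convex)
intersection of the cells is nonempty and of dimension `d - 1`. -/
def VorNeighbor {d : ℕ} (S : Conf (Site d)) (s s' : Site d) : Prop :=
  s ∈ S ∧ s' ∈ S ∧ s ≠ s' ∧ (vor S s ∩ vor S s').Nonempty ∧
    Module.finrank ℝ (vectorSpan ℝ (vor S s ∩ vor S s')) + 1 = d

open Classical in
/-- The conductances `a(s, s', S)`. -/
noncomputable def cond {d : ℕ} (s s' : Site d) (S : Conf (Site d)) : ℝ :=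
  if VorNeighbor S s s' then 1 else 0

/-- `a(s, S) = ∑_{s' ∈ S} a(s, s', S)`, the number of neighbours of `s`. -/
noncomputable def deg {d : ℕ} (s : Site d) (S : Conf (Site d)) : ℝ :=
  ∑' s' : S, cond s s' S

/-- Pairs `(s, S)` with `s ∈ S`. A surface is a function `η s S` of such pairs; it is written
as a function of all pairs, and only its values on `Ξ₁` are ever used. -/
def Xi₁ (d : ℕ) : Set (Site d × Conf (Site d)) := {p | p.1 ∈ p.2}

/-- Measurability of a function on `Ξ₁`. -/
def MeasurableOnXi₁ {d : ℕ} {β : Type*} [MeasurableSpace β]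
    (η : Site d → Conf (Site d) → β) : Prop :=
  Measurable fun p : Xi₁ d => η p.1.1 p.1.2

/-- The gradient field of a surface on a fixed configuration. -/
noncomputable def grad {d : ℕ} (S : Conf (Site d)) (η : Site d → ℝ) (s s' : Site d) : ℝ :=
  cond s s' S * (η s' - η s)

/-- The Laplacian of a surface on a fixed configuration. -/
noncomputable def lap {d : ℕ} (S : Conf (Site d)) (η : Site d → ℝ) (s : Site d) : ℝ :=
  ∑' s' : S, cond s s' S * (η s' - η s)

/-- A surface is harmonic for `S` if its Laplacian vanishes at every point of `S`. -/
def IsHarmonicOn {d : ℕ} (S : Conf (Site d)) (η : Site d → ℝ) : Prop :=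
  ∀ s ∈ S, lap S η s = 0

/-- Covariance of a field `ζ s s' S`. -/
def IsCovariant {d : ℕ} (ζ : Site d → Site d → Conf (Site d) → ℝ) : Prop :=
  ∀ S : Conf (Site d), ∀ s ∈ S, ∀ s' ∈ S, ∀ s'' ∈ S,
    ζ (s' - s) (s'' - s) (shift s S) = ζ s' s'' S

/-- `𝒞(ζ) = ½ E ∑_{s ∈ S} a(0, s, S) ζ(0, s, S)` for a nonnegative field `ζ`; here `P₀` is the law
of the configuration `S` seen from a typical point. -/
noncomputable def cesaro {d : ℕ} (P₀ : Measure (Conf (Site d)))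
    (ζ : Site d → Site d → Conf (Site d) → ℝ≥0∞) : ℝ≥0∞ :=
  (1 / 2) * ∫⁻ S, ∑' s : S, ENNReal.ofReal (cond 0 s S) * ζ 0 s S ∂P₀

/-- The same functional for a field `ζ` which depends on an additional random element `ω`; here
`μ` is the joint law of the configuration and of `ω`. -/
noncomputable def cesaroExt {d : ℕ} {Ω : Type*} [MeasurableSpace Ω]
    (μ : Measure (Conf (Site d) × Ω))
    (ζ : Site d → Site d → Conf (Site d) → Ω → ℝ≥0∞) : ℝ≥0∞ :=
  (1 / 2) * ∫⁻ p : Conf (Site d) × Ω,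
    (∑' s : p.1, ENNReal.ofReal (cond 0 s p.1) * ζ 0 s p.1 p.2) ∂μ

/-! ### Assumptions on the point process -/

/-- The standing assumptions on the law `P` of the point process. -/
structure Assumptions {d : ℕ} (P : Measure (Conf (Site d))) : Prop where
  prob : IsProbabilityMeasure P
  stationary : ∀ x : Site d, MeasurePreserving (shift x) P P
  intensity_one : ∫⁻ S, (count (unitCube d) S : ℝ≥0∞) ∂P = 1
  /-- The law is mixing. -/
  mixing : ∀ A B : Set (Conf (Site d)), MeasurableSet A → MeasurableSet B →
    Tendsto (fun x => P (A ∩ shift x ⁻¹' B)) (Bornology.cobounded (Site d)) (𝓝 (P A * P B))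
  /-- A given sphere almost surely contains fewer than `d + 2` points. -/
  general_position : ∀ (x : Site d) (r : ℝ), 0 < r →
    ∀ᵐ S ∂P, count (Metric.sphere x r) S < d + 2
  /-- The number of neighbours of the origin has a finite exponential moment. -/
  degree_moment : (∀ᵐ S ∂(palm P), {s | VorNeighbor S 0 s}.Finite) ∧
    ∃ β : ℝ, 0 < β ∧ ∫⁻ S, ENNReal.ofReal (Real.exp (β * deg 0 S)) ∂(palm P) < ⊤
  /-- The surface measure of the boundary of the cell of the origin has a second moment. -/
  boundary_moment :
    ∫⁻ S, (Measure.hausdorffMeasure ((d : ℝ) - 1) (frontier (vor S 0))) ^ 2 ∂(palm P) < ⊤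
  length_moment : ∃ r : ℝ, 4 < r ∧
    ∫⁻ S, ∑' s : S, ENNReal.ofReal (cond 0 s S * ‖(s : Site d)‖ ^ r) ∂(palm P) < ⊤
  aperiodic : ∀ᵐ S ∂P, ∀ x : Site d, x ≠ 0 → shift x S ≠ S

/-! ### The clocks -/

/-- `T` is a homogeneous Poisson process on `ℝ` of rate one. -/
structure IsPoissonProcess {Ω : Type*} [MeasurableSpace Ω] (T : Ω → Conf ℝ) (P : Measure Ω) :
    Prop where
  measurable : Measurable T
  law : ∀ B : Set ℝ, MeasurableSet B → Bornology.IsBounded B →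
    P.map (fun ω => count B (T ω)) = poissonMeasure (volume B).toNNReal
  indep : ∀ (k : ℕ) (B : Fin k → Set ℝ), (∀ i, MeasurableSet (B i)) →
    (∀ i, Bornology.IsBounded (B i)) → Pairwise (Function.onFun Disjoint B) →
    iIndepFun (fun i ω => count (B i) (T ω)) P

/-- A measurable enumeration of the points of configurations: distinct points `s` of `S` get
distinct indices `idx s S`. -/
structure IsEnumeration {d : ℕ} (idx : Site d → Conf (Site d) → ℕ) : Prop where
  measurable : MeasurableOnXi₁ idx
  injOn : ∀ S : Conf (Site d), InjOn (fun s => idx s S) (S : Set (Site d))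

/-! ### The harness process -/

/-- The epochs in `(0, t]` of the clock `N`. -/
def epochs (N : Conf ℝ) (t : ℝ) : Set ℝ := {τ | τ ∈ N ∧ 0 < τ ∧ τ ≤ t}

open Classical in
/-- Let the points `s` of `S` carry the clocks `N s`. The backward walk started at `s` at time `t`
waits for the last epoch `τ ∈ (0, t]` of the clock of its current location (`τ` is the supremum of
a finite set), jumps at `τ` to a uniformly chosen neighbour, and goes on from there backward in
time; it stops at time `0`. `walkProb S N k s t s'` is the probability, for given `S` and `N`, that
it makes exactly `k` jumps and ends at `s'`. (Distinct clocks almost surely have no common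
epoch.) -/
noncomputable def walkProb {d : ℕ} (S : Conf (Site d)) (N : Site d → Conf ℝ) :
    ℕ → Site d → ℝ → Site d → ℝ
  | 0, s, t, s' => if epochs (N s) t = ∅ ∧ s = s' then 1 else 0
  | k + 1, s, t, s' => if epochs (N s) t = ∅ then 0 else
      ∑' s'' : S, cond s s'' S / deg s S * walkProb S N k s'' (sSup (epochs (N s) t)) s'

/-- `p_t(s, s', S, T)`, the probability given the configuration and the clocks that the backward
walk started at `s` at time `t` is at `s'` at time `0`. -/
noncomputable def transProb {d : ℕ} (S : Conf (Site d)) (N : Site d → Conf ℝ) (t : ℝ)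
    (s s' : Site d) : ℝ :=
  ∑' k : ℕ, walkProb S N k s t s'

/-- The harness process `η_t(s) = ∑_{s'} p_t(s, s') γ(s')` with initial surface `γ`. -/
noncomputable def harness {d : ℕ} (S : Conf (Site d)) (N : Site d → Conf ℝ) (γ : Site d → ℝ)
    (t : ℝ) (s : Site d) : ℝ :=
  ∑' s' : S, transProb S N t s s' * γ s'

/-- The function `f` on `[0, ∞)` is strictly decreasing at the point `t`. -/
def StrictlyDecreasingAt (f : ℝ → ℝ≥0∞) (t : ℝ) : Prop :=
  ∃ ε : ℝ, 0 < ε ∧ ∀ u : ℝ, 0 ≤ u → |u - t| < ε →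
    (u < t → f t < f u) ∧ (t < u → f u < f t)

end Harness

open Harness

set_option linter.unusedSectionVars false

namespace Harness

/-! ### Configurations as counting measures; measurability of sums over their points -/

section ConfKernel

variable {X : Type*} [PseudoMetricSpace X] [MeasurableSpace X]

/-! Let E(t) be the Palm expectation of the sum of (η_t(x) - η_t(0))² over the neighbours x of the
origin (`energy`, twice the functional of the theorem), and let the normalized Laplacian `disc` at s
be the mean height of the neighbours of s minus the height at s. An update at s moves the height to
that mean, and the squared differences along the edges at s then drop in total by exactly deg(s)
times the square of the normalized Laplacian (`sum_sq_sub_nbMean`). An edge is affected only by the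
clocks of its two ends, each of rate one, and mass transport (`lintegral_palm_swap`) shows that both
ends contribute the same amount under the Palm measure. Hence E(b) + 2 ∫_a^b R = E(a), where R(u) is
the mean of deg(0) times the squared normalized Laplacian at the origin at time u (`dissipation`,
`Setting.energy_balance`). This gives (a).

For (b), the rate R has to be controlled in time. An update at s annihilates the normalized
Laplacian at s and changes the one at a neighbour v by 1/deg(v) times its old value at s. Summed
over neighbours and transported back to the origin, this bounds the change of R over (a, b], in both
directions, by 4 ∫_a^b R (`Setting.dissipation_le_add`). So a zero of R at t forces R to have zero
integral on a short interval after t, where E is then flat, while R(t) > 0 keeps R positive on both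
sides of t (`strictlyDecreasingAt_iff`). Finally R(t) = 0 says precisely that η_t is almost surely
harmonic (`Setting.ae_harmonic_iff`).

For (c) and (d), the balance bounds the integral of R over (0, ∞) by E(0), so for almost every
configuration the mean square of the normalized Laplacian is integrable in time at every point. A
nonnegative function that is integrable on (0, ∞), and whose increase after time n is bounded by a
quantity tending to zero, tends to zero (`tendsto_zero_of_le_add`). Applied to the mean squares this
gives convergence in L²; applied path by path, with the increase bounded by a sum over later epochs,
it gives almost sure convergence.

Three facts support the argument. The mean of a sum over the epochs of a clock of a functional of
the strict past of all clocks is the time integral of the mean of the functional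
(`lintegral_predictable_clockLaw`); it serves as the generator calculus and also bounds the mean
probability of k backward jumps by t^k/k!. The mean square increment of the initial surface along k
steps, weighted by the degree, is controlled by 4^k times the initial energy
(`Setting.lintegral_stepBoundE_le`); together with t^k/k! this is summable, so the defining series
converge and all subtractions of energies are legitimate. Lastly, only the gradient of the surface
is covariant and the enumeration need not be, but the clocks are i.i.d. and adding a function that
is constant along edges commutes with the dynamics. Hence means over the clocks are covariant
(`Model.discQ_shift`, `Model.ringQ_shift`), as mass transport requires. -/

theorem Conf.countable [Nonempty X] (S : Conf X) : (S : Set X).Countable := by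
  obtain ⟨x0⟩ := ‹Nonempty X›
  have : (S : Set X) = ⋃ n : ℕ, (S : Set X) ∩ Metric.closedBall x0 n := by
    rw [← inter_iUnion, Metric.iUnion_closedBall_nat, inter_univ]
  rw [this]
  exact countable_iUnion fun n => (S.2 _ Metric.isBounded_closedBall).countable

instance [Nonempty X] (S : Conf X) : Countable S := S.countable.to_subtype

theorem measurableSet_conf [Nonempty X] [MeasurableSingletonClass X] (S : Conf X) :
    MeasurableSet (S : Set X) := S.countable.measurableSet

/-- The counting measure on the points of a configuration. -/
noncomputable def confMeasure (S : Conf X) : Measure X := Measure.count.restrict (S : Set X)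

theorem confMeasure_apply [MeasurableSingletonClass X] (S : Conf X)
    {B : Set X} (hB : Bornology.IsBounded B) (hm : MeasurableSet B) :
    confMeasure S B = count B S := by
  have hf : ((S : Set X) ∩ B).Finite := S.2 B hB
  rw [confMeasure, Measure.restrict_apply hm, inter_comm, count,
    Set.ncard_eq_toFinset_card _ hf]
  exact Measure.count_apply_finite _ hf

theorem measurable_confMeasure_bounded [MeasurableSingletonClass X]
    {B : Set X} (hB : Bornology.IsBounded B) (hm : MeasurableSet B) :
    Measurable fun S : Conf X => confMeasure S B := by
  simp_rw [confMeasure_apply _ hB hm]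
  exact (measurable_from_top (f := fun n : ℕ => (n : ℝ≥0∞))).comp (measurable_count hB hm)

variable [Nonempty X] [OpensMeasurableSpace X] [MeasurableSingletonClass X]

/-- A partition of the space into bounded measurable shells. -/
def shell (x0 : X) (n : ℕ) : Set X := {x | ⌊dist x x0⌋₊ = n}

theorem measurableSet_shell (x0 : X) (n : ℕ) : MeasurableSet (shell x0 n) := by
  have : Measurable fun x : X => ⌊dist x x0⌋₊ :=
    Nat.measurable_floor.comp (Continuous.measurable (by fun_prop))
  exact this (measurableSet_singleton n)

theorem isBounded_shell (x0 : X) (n : ℕ) : Bornology.IsBounded (shell x0 n) := by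
  refine (Metric.isBounded_closedBall (x := x0) (r := n + 1)).subset fun x hx => ?_
  have h1 : ⌊dist x x0⌋₊ = n := hx
  have := Nat.lt_floor_add_one (dist x x0)
  rw [h1] at this
  exact this.le

theorem measurable_confMeasure : Measurable (confMeasure : Conf X → Measure X) := by
  obtain ⟨x0⟩ := ‹Nonempty X›
  refine Measure.measurable_of_measurable_coe _ fun B hB => ?_
  have : ∀ S : Conf X, confMeasure S B = ∑' n, confMeasure S (B ∩ shell x0 n) := by
    intro S
    rw [← measure_iUnion]
    · rw [← inter_iUnion]
      congr 1
      ext x; simp [shell]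
    · intro i j hij
      refine Set.disjoint_left.2 fun x hx hx' => hij ?_
      exact hx.2.symm.trans hx'.2
    · exact fun i => hB.inter (measurableSet_shell x0 i)
  simp_rw [this]
  exact Measurable.tsum fun n => measurable_confMeasure_bounded
    ((isBounded_shell x0 n).subset inter_subset_right) (hB.inter (measurableSet_shell x0 n))

/-- The counting measure on the points of a configuration, as a kernel. -/
noncomputable def confKernel (X : Type*) [PseudoMetricSpace X] [MeasurableSpace X] [Nonempty X]
    [OpensMeasurableSpace X] [MeasurableSingletonClass X] : Kernel (Conf X) X :=
  ⟨confMeasure, measurable_confMeasure⟩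

/-- The number of points in a bounded set has no uniform bound, so the kernel is cut both by the
shell and by the number of points in it; each piece then has bounded mass. -/
instance : IsSFiniteKernel (confKernel X) := by
  classical
  obtain ⟨x0⟩ := id ‹Nonempty X›
  let lev : ℕ × ℕ → Set (Conf X) := fun p => {S | count (shell x0 p.1) S = p.2}
  have hlev : ∀ p, MeasurableSet (lev p) := fun p =>
    measurable_count (isBounded_shell x0 p.1) (measurableSet_shell x0 p.1)
      (measurableSet_singleton p.2)
  let κ : ℕ × ℕ → Kernel (Conf X) X := fun p =>
    Kernel.piecewise (hlev p) ((confKernel X).restrict (measurableSet_shell x0 p.1)) 0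
  have hκ : ∀ p, IsFiniteKernel (κ p) := by
    intro p
    refine ⟨⟨p.2, ENNReal.natCast_lt_top _, fun S => ?_⟩⟩
    simp only [κ, Kernel.piecewise_apply]
    split_ifs with h
    · rw [Kernel.restrict_apply, Measure.restrict_apply MeasurableSet.univ, univ_inter]
      change confMeasure S _ ≤ _
      rw [confMeasure_apply _ (isBounded_shell x0 p.1) (measurableSet_shell x0 p.1), h]
    · simp
  have hsum : confKernel X = Kernel.sum κ := by
    ext S B hB
    rw [Kernel.sum_apply' _ _ hB, ENNReal.tsum_prod']
    have h1 : ∀ n, ∑' k, (κ (n, k)) S B = confMeasure S (B ∩ shell x0 n) := by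
      intro n
      rw [tsum_eq_single (count (shell x0 n) S)]
      · simp only [κ, Kernel.piecewise_apply]
        rw [if_pos (show S ∈ lev (n, count (shell x0 n) S) from rfl), Kernel.restrict_apply, Measure.restrict_apply hB]
        rfl
      · intro k hk
        simp only [κ, Kernel.piecewise_apply]
        rw [if_neg fun h => hk h.symm]
        simp
    simp_rw [h1]
    rw [← measure_iUnion]
    · rw [← inter_iUnion]
      change confMeasure S B = _
      congr 1
      ext x; simp [shell]
    · intro i j hij
      refine Set.disjoint_left.2 fun x hx hx' => hij ?_
      exact hx.2.symm.trans hx'.2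
    · exact fun i => hB.inter (measurableSet_shell x0 i)
  rw [hsum]
  infer_instance

theorem lintegral_confMeasure (S : Conf X) (g : X → ℝ≥0∞) :
    ∫⁻ x, g x ∂(confMeasure S) = ∑' x : S, g x := by
  rw [confMeasure, lintegral_countable _ S.countable]
  simp only [Measure.count_singleton, mul_one]
  rfl

/-- The sum is an integral against the s-finite kernel `confKernel`, so joint measurability of the
summand is enough. Most measurability statements below reduce to this one. -/
theorem measurable_tsum_conf {C : Type*} [MeasurableSpace C] {S : C → Conf X} (hS : Measurable S)
    {g : C → X → ℝ≥0∞} (hg : Measurable fun p : C × X => g p.1 p.2) :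
    Measurable fun c => ∑' x : S c, g c x := by
  simp_rw [← lintegral_confMeasure]
  have := Measurable.lintegral_kernel_prod_right
    (κ := (confKernel X).comap S hS) (f := g) (by exact hg)
  exact this

/-- A real series is the difference of its positive and its negative part, or zero. -/
theorem tsum_eq_toReal_sub {ι : Type*} (f : ι → ℝ) :
    ∑' i, f i = if ∑' i, ENNReal.ofReal |f i| = ⊤ then 0 else
      (∑' i, ENNReal.ofReal (f i)).toReal - (∑' i, ENNReal.ofReal (-f i)).toReal := by
  have hiff : Summable f ↔ ∑' i, ENNReal.ofReal |f i| ≠ ⊤ := by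
    rw [← summable_abs_iff]
    constructor
    · intro h
      rw [← ENNReal.ofReal_tsum_of_nonneg (fun i => abs_nonneg _) h]
      exact ENNReal.ofReal_ne_top
    · intro h
      have := ENNReal.summable_toReal h
      simpa using this
  split_ifs with h
  · exact tsum_eq_zero_of_not_summable fun hs => hiff.1 hs h
  · have hs := hiff.2 h
    have hp : Summable fun i => max (f i) 0 :=
      Summable.of_nonneg_of_le (fun i => le_max_right _ _)
        (fun i => max_le (le_abs_self _) (abs_nonneg _)) hs.abs
    have hn : Summable fun i => max (-f i) 0 :=
      Summable.of_nonneg_of_le (fun i => le_max_right _ _)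
        (fun i => max_le (neg_le_abs _) (abs_nonneg _)) hs.abs
    have e : ∀ x : ℝ, ENNReal.ofReal x = ENNReal.ofReal (max x 0) := by
      intro x
      rcases le_total x 0 with hx | hx
      · rw [max_eq_right hx, ENNReal.ofReal_of_nonpos hx, ENNReal.ofReal_zero]
      · rw [max_eq_left hx]
    simp_rw [e (f _), e (-f _)]
    rw [← ENNReal.ofReal_tsum_of_nonneg (fun i => le_max_right _ _) hp,
      ← ENNReal.ofReal_tsum_of_nonneg (fun i => le_max_right _ _) hn,
      ENNReal.toReal_ofReal (tsum_nonneg fun i => le_max_right _ _),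
      ENNReal.toReal_ofReal (tsum_nonneg fun i => le_max_right _ _), ← hp.tsum_sub hn]
    refine tsum_congr fun i => ?_
    rcases le_total (f i) 0 with hx | hx
    · rw [max_eq_right hx, max_eq_left (by linarith)]; ring
    · rw [max_eq_left hx, max_eq_right (by linarith)]; ring

theorem measurable_of_tsum_parts {C : Type*} [MeasurableSpace C] {a p n : C → ℝ≥0∞}
    (ha : Measurable a) (hp : Measurable p) (hn : Measurable n) :
    Measurable fun c => if a c = ⊤ then (0 : ℝ) else (p c).toReal - (n c).toReal :=
  Measurable.ite (ha (measurableSet_singleton ⊤)) measurable_const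
    (hp.ennreal_toReal.sub hn.ennreal_toReal)

theorem measurable_tsum_conf_real {C : Type*} [MeasurableSpace C] {S : C → Conf X}
    (hS : Measurable S) {g : C → X → ℝ} (hg : Measurable fun p : C × X => g p.1 p.2) :
    Measurable fun c => ∑' x : S c, g c x := by
  have h1 : Measurable fun c => ∑' x : S c, ENNReal.ofReal |g c x| :=
    measurable_tsum_conf (g := fun c x => ENNReal.ofReal |g c x|) hS
      (by exact (measurable_norm.comp hg).ennreal_ofReal)
  have h2 : Measurable fun c => ∑' x : S c, ENNReal.ofReal (g c x) :=
    measurable_tsum_conf (g := fun c x => ENNReal.ofReal (g c x)) hS hg.ennreal_ofReal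
  have h3 : Measurable fun c => ∑' x : S c, ENNReal.ofReal (-g c x) :=
    measurable_tsum_conf (g := fun c x => ENNReal.ofReal (-g c x)) hS hg.neg.ennreal_ofReal
  simp_rw [tsum_eq_toReal_sub]
  exact measurable_of_tsum_parts h1 h2 h3

theorem measurable_tsum_real {C ι : Type*} [MeasurableSpace C] [Countable ι] {g : ι → C → ℝ}
    (hg : ∀ i, Measurable (g i)) : Measurable fun c => ∑' i, g i c := by
  simp_rw [tsum_eq_toReal_sub]
  exact measurable_of_tsum_parts
    (Measurable.tsum fun i => (measurable_norm.comp (hg i)).ennreal_ofReal)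
    (Measurable.tsum fun i => (hg i).ennreal_ofReal)
    (Measurable.tsum fun i => (hg i).neg.ennreal_ofReal)

/-- Membership is detected by summing the indicator of `y = x` over the points `y` of the
configuration. -/
theorem measurableSet_mem_conf [MeasurableEq X] {C : Type*} [MeasurableSpace C] {S : C → Conf X}
    (hS : Measurable S) {x : C → X} (hx : Measurable x) : MeasurableSet {c | x c ∈ S c} := by
  classical
  have h : Measurable fun c => ∑' y : S c, (if (y : X) = x c then 1 else 0 : ℝ≥0∞) :=
    measurable_tsum_conf (g := fun c y => if y = x c then 1 else 0) hS
      (Measurable.ite (measurableSet_eq_fun measurable_snd (hx.comp measurable_fst))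
        measurable_const measurable_const)
  have he : {c | x c ∈ S c} =
      (fun c => ∑' y : S c, (if (y : X) = x c then 1 else 0 : ℝ≥0∞)) ⁻¹' {0}ᶜ := by
    ext c
    simp only [mem_ofPred_eq, mem_preimage, mem_compl_iff, mem_singleton_iff, ENNReal.tsum_eq_zero,
      ite_eq_right_iff, one_ne_zero, imp_false, not_forall, not_not]
    constructor
    · intro hc; exact ⟨⟨x c, hc⟩, rfl⟩
    · rintro ⟨y, hy⟩; rw [← hy]; exact y.2
  rw [he]
  exact h (measurableSet_singleton 0).compl

end ConfKernel

end Harness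

namespace Harness

variable {d : ℕ}

/-! ### Voronoi neighbours -/

theorem mem_conf_shift {x y : Site d} {S : Conf (Site d)} : y ∈ shift x S ↔ y + x ∈ S := Iff.rfl

theorem VorNeighbor.symm {S : Conf (Site d)} {s s' : Site d} (h : VorNeighbor S s s') :
    VorNeighbor S s' s := by
  obtain ⟨h1, h2, h3, h4, h5⟩ := h
  refine ⟨h2, h1, h3.symm, ?_, ?_⟩ <;> rwa [inter_comm]

theorem vorNeighbor_comm {S : Conf (Site d)} {s s' : Site d} :
    VorNeighbor S s s' ↔ VorNeighbor S s' s := ⟨VorNeighbor.symm, VorNeighbor.symm⟩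

/-- The quadratic terms cancel, so comparing distances to two points is an affine condition on `x`.
Convexity of cells, bisectors and faces all rest on this. -/
theorem dist_sq_sub (x s s' : Site d) :
    dist x s' ^ 2 - dist x s ^ 2 = 2 * inner ℝ (x - s) (s - s') + ‖s - s'‖ ^ 2 := by
  rw [dist_eq_norm, dist_eq_norm, show x - s' = (x - s) + (s - s') by abel,
    norm_add_sq_real (x - s) (s - s')]
  ring

/-- The points whose closest points in `S` are `s` and possibly `s'`. -/
def strictCell (S : Conf (Site d)) (s s' : Site d) : Set (Site d) :=
  {x | ∀ z ∈ S, z ≠ s → z ≠ s' → dist x s < dist x z}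

/-- Near a given `x` only finitely many points compete, so the complement is a locally finite union
of closed half-spaces. -/
theorem isOpen_strictCell (S : Conf (Site d)) (s s' : Site d) : IsOpen (strictCell S s s') := by
  let f : {z : Site d // z ∈ S ∧ z ≠ s ∧ z ≠ s'} → Set (Site d) :=
    fun z => {x | dist x z ≤ dist x s}
  have he : strictCell S s s' = (⋃ z, f z)ᶜ := by
    ext x
    simp only [strictCell, mem_ofPred_eq, mem_compl_iff, mem_iUnion, not_exists, f, not_le,
      Subtype.forall]
    constructor
    · intro h z hz; exact h z hz.1 hz.2.1 hz.2.2
    · intro h z h1 h2 h3; exact h z ⟨h1, h2, h3⟩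
  rw [he, isOpen_compl_iff]
  refine LocallyFinite.isClosed_iUnion ?_ fun z =>
    isClosed_le (by fun_prop) (by fun_prop)
  intro x
  refine ⟨Metric.ball x 1, Metric.ball_mem_nhds x one_pos, ?_⟩
  -- If `y` is within `1` of `x` and `z` is at least as close to `y` as `s` is, then `z` is within
  -- `dist y s + 1 ≤ dist x s + 2` of `x`.
  have hfin : ((S : Set (Site d)) ∩ Metric.closedBall x (2 + dist x s)).Finite :=
    S.2 _ Metric.isBounded_closedBall
  refine Set.Finite.subset (hfin.preimage (Subtype.val_injective.injOn)) ?_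
  rintro ⟨z, hz⟩ ⟨y, hy, hyx⟩
  refine ⟨hz.1, ?_⟩
  have h1 : dist y z ≤ dist y s := hy
  have h2 : dist y x < 1 := hyx
  have h3 : dist z x ≤ dist y z + dist y x := by
    rw [dist_comm y z]; exact dist_triangle z y x
  have h4 : dist y s ≤ dist y x + dist x s := dist_triangle y x s
  change dist z x ≤ _
  linarith

theorem inner_sub_eq_zero_of_equidistant {s s' y z : Site d} (hy : dist y s = dist y s')
    (hz : dist z s = dist z s') : inner ℝ (s - s') (y - z) = (0 : ℝ) := by
  have h1 := dist_sq_sub y s s'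
  have h2 := dist_sq_sub z s s'
  rw [hy, sub_self] at h1
  rw [hz, sub_self] at h2
  have h3 : inner ℝ (y - s) (s - s') - inner ℝ (z - s) (s - s') = (0 : ℝ) := by linarith
  rw [← inner_sub_left, real_inner_comm] at h3
  rwa [show y - s - (z - s) = y - z by abel] at h3

theorem equidistant_of_mem {S : Conf (Site d)} {s s' y : Site d} (hs : s ∈ S) (hs' : s' ∈ S)
    (hne : s ≠ s') (hy : y ∈ vor S s ∩ vor S s') : dist y s = dist y s' :=
  le_antisymm (hy.1 s' hs' hne.symm) (hy.2 s hs hne)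

/-- After squaring, each condition on the distances is a linear inequality, so the cell is an
intersection of half-spaces. -/
theorem convex_vor (S : Conf (Site d)) (s : Site d) : Convex ℝ (vor S s) := by
  have : vor S s = ⋂ z ∈ {z | z ∈ S ∧ z ≠ s}, {x | inner ℝ (z - s) x ≤
      inner ℝ (z - s) s + ‖s - z‖ ^ 2 / 2} := by
    ext x
    simp only [vor, mem_ofPred_eq, mem_iInter, and_imp]
    refine forall_congr' fun z => forall_congr' fun hz => forall_congr' fun hzs => ?_
    have h := dist_sq_sub x s z
    rw [real_inner_comm, ← neg_sub z s, inner_neg_left, inner_sub_right, norm_neg, norm_sub_rev z s] at h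
    rw [← abs_of_nonneg (dist_nonneg (x := x) (y := s)),
      ← abs_of_nonneg (dist_nonneg (x := x) (y := z)), ← sq_le_sq]
    constructor <;> intro h' <;> linarith
  rw [this]
  exact convex_iInter₂ fun z _ => convex_halfSpace_le
    ⟨fun a b => inner_add_right _ _ _, fun c a => inner_smul_right _ _ _⟩ _

theorem finrank_orthogonal_add_one {v : Site d} (hv : v ≠ 0) :
    Module.finrank ℝ (Submodule.span ℝ {v})ᗮ + 1 = d := by
  have h := Submodule.finrank_add_finrank_orthogonal (Submodule.span ℝ {v})
  rw [finrank_span_singleton hv, finrank_euclideanSpace_fin] at h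
  omega

/-- Points of the common face are equidistant from `s` and `s'`, so the face lies in the bisecting
hyperplane; having dimension `d - 1` will mean that it spans this hyperplane. -/
theorem vectorSpan_face_le {S : Conf (Site d)} {s s' : Site d} (hs : s ∈ S) (hs' : s' ∈ S)
    (hne : s ≠ s') :
    vectorSpan ℝ (vor S s ∩ vor S s') ≤ (Submodule.span ℝ {s - s'})ᗮ := by
  rw [vectorSpan_def, Submodule.span_le]
  rintro _ ⟨y, hy, z, hz, rfl⟩
  rw [SetLike.mem_coe, Submodule.mem_orthogonal_singleton_iff_inner_right]
  exact inner_sub_eq_zero_of_equidistant (equidistant_of_mem hs hs' hne hy)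
    (equidistant_of_mem hs hs' hne hz)

/-- The witness is the barycentre of an affine basis of the face, a relatively interior point. If a
third point `z` were equally close there, the affine function comparing `z` with `s`, nonnegative on
the face, would vanish at the barycentre, hence at the whole basis, and `s - z` would be orthogonal
to the face. -/
theorem exists_equidistant_of_vorNeighbor {S : Conf (Site d)} {s s' : Site d}
    (h : VorNeighbor S s s') : ∃ x ∈ strictCell S s s', dist x s = dist x s' := by
  classical
  obtain ⟨hs, hs', hne, hnon, hdim⟩ := h
  set F := vor S s ∩ vor S s' with hF
  have hv : s - s' ≠ 0 := sub_ne_zero.2 hne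
  have hspan : vectorSpan ℝ F = (Submodule.span ℝ {s - s'})ᗮ :=
    Submodule.eq_of_le_of_finrank_eq (vectorSpan_face_le hs hs' hne)
      (by have := finrank_orthogonal_add_one hv; omega)
  obtain ⟨t, htF, hts, hti⟩ := exists_affineIndependent ℝ (Site d) F
  have htfin : t.Finite := finite_set_of_fin_dim_affineIndependent ℝ hti
  lift t to Finset (Site d) using htfin
  have htne : t.Nonempty := by
    rw [← Finset.coe_nonempty, ← affineSpan_nonempty ℝ, hts, affineSpan_nonempty]
    exact hnon
  have hc : (0 : ℝ) < t.card := by exact_mod_cast htne.card_pos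
  set x : Site d := ∑ p ∈ t, (t.card : ℝ)⁻¹ • p with hx
  have hsum1 : ∑ p ∈ t, (t.card : ℝ)⁻¹ = 1 := by
    rw [Finset.sum_const, nsmul_eq_mul, mul_inv_cancel₀ hc.ne']
  have hxF : x ∈ F :=
    ((convex_vor S s).inter (convex_vor S s')).sum_mem (fun _ _ => by positivity) hsum1
      fun p hp => htF hp
  refine ⟨x, fun z hz hzs hzs' => lt_of_le_of_ne (hxF.1 z hz hzs) fun heq => ?_,
    equidistant_of_mem hs hs' hne hxF⟩
  -- the affine function `ψ` is nonnegative on the face and vanishes at `x`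
  let ψ : Site d → ℝ := fun y => 2 * inner ℝ (y - s) (s - z) + ‖s - z‖ ^ 2
  have hψ : ∀ y ∈ F, 0 ≤ ψ y := by
    intro y hy
    have h1 := dist_sq_sub y s z
    have h2 := hy.1 z hz hzs
    have h3 : dist y s ^ 2 ≤ dist y z ^ 2 := pow_le_pow_left₀ dist_nonneg h2 2
    change 0 ≤ 2 * inner ℝ (y - s) (s - z) + ‖s - z‖ ^ 2
    linarith
  have hψx : ψ x = 0 := by
    have h1 := dist_sq_sub x s z
    rw [heq, sub_self] at h1
    exact h1.symm
  have hψsum : ∑ p ∈ t, ψ p = 0 := by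
    have h1 : ∑ p ∈ t, (t.card : ℝ)⁻¹ * ψ p = ψ x := by
      have h2 : x - s = ∑ p ∈ t, (t.card : ℝ)⁻¹ • (p - s) := by
        simp_rw [smul_sub, Finset.sum_sub_distrib, ← Finset.sum_smul, hsum1, one_smul]
        rfl
      change _ = 2 * inner ℝ (x - s) (s - z) + ‖s - z‖ ^ 2
      rw [h2, sum_inner, Finset.mul_sum]
      conv_rhs => rw [← one_mul (‖s - z‖ ^ 2), ← hsum1, Finset.sum_mul, ← Finset.sum_add_distrib]
      refine Finset.sum_congr rfl fun p _ => ?_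
      rw [real_inner_smul_left]
      change (t.card : ℝ)⁻¹ * (2 * inner ℝ (p - s) (s - z) + ‖s - z‖ ^ 2) = _
      ring
    rw [← Finset.mul_sum, hψx] at h1
    rcases mul_eq_zero.1 h1 with h2 | h2
    · exact absurd h2 (inv_pos.2 hc).ne'
    · exact h2
  have hψ0 : ∀ p ∈ t, ψ p = 0 :=
    (Finset.sum_eq_zero_iff_of_nonneg fun p hp => hψ p (htF hp)).1 hψsum
  have horth : s - z ∈ (vectorSpan ℝ F)ᗮ := by
    have hle : vectorSpan ℝ F ≤ (Submodule.span ℝ {s - z})ᗮ := by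
      rw [← direction_affineSpan, ← hts, direction_affineSpan, vectorSpan_def, Submodule.span_le]
      rintro _ ⟨y, hy, w, hw, rfl⟩
      rw [SetLike.mem_coe, Submodule.mem_orthogonal_singleton_iff_inner_right]
      have h1 : 2 * inner ℝ (y - s) (s - z) + ‖s - z‖ ^ 2 = 0 := hψ0 y hy
      have h2 : 2 * inner ℝ (w - s) (s - z) + ‖s - z‖ ^ 2 = 0 := hψ0 w hw
      have h3 : inner ℝ (y - s) (s - z) - inner ℝ (w - s) (s - z) = (0 : ℝ) := by linarith
      rw [← inner_sub_left, real_inner_comm] at h3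
      rwa [show y - s - (w - s) = y - w by abel] at h3
    exact Submodule.orthogonal_le hle
      (Submodule.le_orthogonal_orthogonal _ (Submodule.mem_span_singleton_self _))
  -- The orthogonal complement of the face is the line of `s - s'`, so `s - z = c • (s - s')`. A
  -- point equidistant from three collinear points forces `c * (c - 1) = 0`, that is, `z = s` or `z
  -- = s'`.
  rw [hspan, Submodule.orthogonal_orthogonal, Submodule.mem_span_singleton] at horth
  obtain ⟨c, hcz⟩ := horth
  have e1 := dist_sq_sub x s s'
  rw [equidistant_of_mem hs hs' hne hxF, sub_self] at e1
  have e2 := dist_sq_sub x s z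
  rw [heq, sub_self, ← hcz, inner_smul_right, norm_smul, mul_pow, Real.norm_eq_abs, sq_abs] at e2
  have hn : (0 : ℝ) < ‖s - s'‖ ^ 2 := by positivity
  have hcc : c * (c - 1) * ‖s - s'‖ ^ 2 = 0 := by
    linear_combination c * e1 - e2
  rcases mul_eq_zero.1 hcc with h | h
  · rcases mul_eq_zero.1 h with h | h
    · rw [h, zero_smul] at hcz
      exact hzs (sub_eq_zero.1 hcz.symm).symm
    · rw [sub_eq_zero.1 h, one_smul] at hcz
      exact hzs' (sub_right_injective hcz).symm
  · exact hn.ne' h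

/-- Since `strictCell` is open, `x` can be moved a little in every direction of the bisector without
leaving the face, so the face has full dimension `d - 1`. -/
theorem vorNeighbor_of_equidistant {S : Conf (Site d)} {s s' x : Site d} (hs : s ∈ S)
    (hs' : s' ∈ S) (hne : s ≠ s') (hx : x ∈ strictCell S s s') (hxe : dist x s = dist x s') :
    VorNeighbor S s s' := by
  have hv : s - s' ≠ 0 := sub_ne_zero.2 hne
  have hmem : ∀ y ∈ strictCell S s s', dist y s = dist y s' → y ∈ vor S s ∩ vor S s' := by
    intro y hy hye
    constructor
    · intro z hz hzs
      by_cases hzs' : z = s'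
      · rw [hzs', hye]
      · exact (hy z hz hzs hzs').le
    · intro z hz hzs'
      by_cases hzs : z = s
      · rw [hzs, hye]
      · rw [← hye]; exact (hy z hz hzs hzs').le
  refine ⟨hs, hs', hne, ⟨x, hmem x hx hxe⟩, ?_⟩
  have hspan : vectorSpan ℝ (vor S s ∩ vor S s') = (Submodule.span ℝ {s - s'})ᗮ := by
    refine le_antisymm (vectorSpan_face_le hs hs' hne) fun w hw => ?_
    rw [Submodule.mem_orthogonal_singleton_iff_inner_right] at hw
    have hcont : Tendsto (fun ε : ℝ => x + ε • w) (𝓝[>] 0) (𝓝 x) := by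
      have : Continuous fun ε : ℝ => x + ε • w := by fun_prop
      have h := this.tendsto 0
      rw [zero_smul, add_zero] at h
      exact h.mono_left nhdsWithin_le_nhds
    obtain ⟨ε, hε, hε0⟩ := ((hcont.eventually ((isOpen_strictCell S s s').mem_nhds hx)).and
      self_mem_nhdsWithin).exists
    have hε0' : (0 : ℝ) < ε := hε0
    have heq : dist (x + ε • w) s = dist (x + ε • w) s' := by
      have h1 := dist_sq_sub (x + ε • w) s s'
      have h2 := dist_sq_sub x s s'
      rw [hxe, sub_self] at h2
      rw [show x + ε • w - s = (x - s) + ε • w by abel, inner_add_left, real_inner_smul_left,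
        real_inner_comm (s - s') w, hw] at h1
      have h3 : dist (x + ε • w) s ^ 2 = dist (x + ε • w) s' ^ 2 := by linarith
      exact (pow_left_inj₀ dist_nonneg dist_nonneg two_ne_zero).1 h3
    have h1 := vsub_mem_vectorSpan ℝ (hmem _ hε heq) (hmem x hx hxe)
    rw [vsub_eq_sub, add_sub_cancel_left] at h1
    have h2 := Submodule.smul_mem _ ε⁻¹ h1
    rwa [smul_smul, inv_mul_cancel₀ hε0'.ne', one_smul] at h2
  rw [hspan]
  exact finrank_orthogonal_add_one hv

/-- This trades the dimension count for an open condition on one point, which is easy to translate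
and to test on a countable set. -/
theorem vorNeighbor_iff {S : Conf (Site d)} {s s' : Site d} : VorNeighbor S s s' ↔
    s ∈ S ∧ s' ∈ S ∧ s ≠ s' ∧ ∃ x ∈ strictCell S s s', dist x s = dist x s' :=
  ⟨fun h => ⟨h.1, h.2.1, h.2.2.1, exists_equidistant_of_vorNeighbor h⟩,
    fun ⟨hs, hs', hne, _, hx, hxe⟩ => vorNeighbor_of_equidistant hs hs' hne hx hxe⟩

theorem vorNeighbor_shift {S : Conf (Site d)} (x s s' : Site d) :
    VorNeighbor (shift x S) (s - x) (s' - x) ↔ VorNeighbor S s s' := by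
  simp only [vorNeighbor_iff, mem_conf_shift, sub_add_cancel, ne_eq, sub_left_inj]
  refine and_congr_right fun _ => and_congr_right fun _ => and_congr_right fun _ => ?_
  constructor
  · rintro ⟨y, hy, hye⟩
    refine ⟨y + x, fun z hz h1 h2 => ?_, ?_⟩
    · have := hy (z - x) (by rwa [mem_conf_shift, sub_add_cancel])
        (fun h => h1 (sub_left_injective h)) (fun h => h2 (sub_left_injective h))
      rwa [← dist_add_right y (s - x) x, ← dist_add_right y (z - x) x, sub_add_cancel,
        sub_add_cancel] at this
    · rwa [← dist_add_right y (s - x) x, ← dist_add_right y (s' - x) x, sub_add_cancel,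
        sub_add_cancel] at hye
  · rintro ⟨y, hy, hye⟩
    refine ⟨y - x, fun z hz h1 h2 => ?_, ?_⟩
    · have := hy (z + x) hz (fun h => h1 (by rw [← h, add_sub_cancel_right]))
        (fun h => h2 (by rw [← h, add_sub_cancel_right]))
      rw [dist_sub_right]
      calc _ < _ := this
        _ = _ := by rw [← dist_sub_right y (z + x) x, add_sub_cancel_right]
    · rwa [dist_sub_right, dist_sub_right]

/-- The orthogonal projection of `q` to the bisector of `s` and `s'`. -/
noncomputable def bisectorProj (q s s' : Site d) : Site d :=
  q - ((dist q s' ^ 2 - dist q s ^ 2) / (2 * ‖s - s'‖ ^ 2)) • (s - s')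

theorem dist_bisectorProj {q s s' : Site d} (hne : s ≠ s') :
    dist (bisectorProj q s s') s = dist (bisectorProj q s s') s' := by
  have hn : ‖s - s'‖ ^ 2 ≠ 0 := by
    have := sub_ne_zero.2 hne
    positivity
  have h1 := dist_sq_sub (bisectorProj q s s') s s'
  have h2 := dist_sq_sub q s s'
  set e := dist q s' ^ 2 - dist q s ^ 2
  have h3 : bisectorProj q s s' - s = (q - s) - (e / (2 * ‖s - s'‖ ^ 2)) • (s - s') := by
    simp only [bisectorProj]; abel
  rw [h3, inner_sub_left, real_inner_smul_left, real_inner_self_eq_norm_sq] at h1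
  have h4 : e / (2 * ‖s - s'‖ ^ 2) * ‖s - s'‖ ^ 2 = e / 2 := by
    rw [div_mul_eq_mul_div, mul_div_mul_right _ _ hn]
  rw [h4] at h1
  have h5 : dist (bisectorProj q s s') s ^ 2 = dist (bisectorProj q s s') s' ^ 2 := by linarith
  exact (pow_left_inj₀ dist_nonneg dist_nonneg two_ne_zero).1 h5

/-- The projection to the bisector is continuous and fixes the bisector, so the preimage of the open
strict cell is a nonempty open set as soon as a witness exists, and a dense sequence meets it. -/
theorem vorNeighbor_iff_denseSeq {S : Conf (Site d)} {s s' : Site d} : VorNeighbor S s s' ↔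
    s ∈ S ∧ s' ∈ S ∧ s ≠ s' ∧
      ∃ n : ℕ, bisectorProj (TopologicalSpace.denseSeq (Site d) n) s s' ∈ strictCell S s s' := by
  rw [vorNeighbor_iff]
  refine and_congr_right fun _ => and_congr_right fun _ => and_congr_right fun hne => ?_
  constructor
  · rintro ⟨x, hx, hxe⟩
    have hcont : Continuous fun q : Site d => bisectorProj q s s' := by
      unfold bisectorProj; fun_prop
    have hxx : bisectorProj x s s' = x := by simp [bisectorProj, hxe]
    have hopen := (isOpen_strictCell S s s').preimage hcont
    obtain ⟨_, ⟨n, rfl⟩, hn⟩ := (TopologicalSpace.denseRange_denseSeq (Site d)).inter_open_nonempty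
      _ hopen ⟨x, by rw [mem_preimage, hxx]; exact hx⟩ |>.imp fun _ h => h.symm
    exact ⟨n, hn⟩
  · rintro ⟨n, hn⟩
    exact ⟨_, hn, dist_bisectorProj hne⟩

/-- For a fixed point of the dense sequence, the strict cell condition says that no point of the
configuration violates it, that is, a sum of indicators over the configuration vanishes. -/
theorem measurableSet_vorNeighbor :
    MeasurableSet {p : Conf (Site d) × Site d × Site d | VorNeighbor p.1 p.2.1 p.2.2} := by
  have hS : Measurable fun p : Conf (Site d) × Site d × Site d => p.1 := measurable_fst
  have h1 : Measurable fun p : Conf (Site d) × Site d × Site d => p.2.1 := by fun_prop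
  have h2 : Measurable fun p : Conf (Site d) × Site d × Site d => p.2.2 := by fun_prop
  have hcell : ∀ q : Site d, MeasurableSet {p : Conf (Site d) × Site d × Site d |
      bisectorProj q p.2.1 p.2.2 ∈ strictCell p.1 p.2.1 p.2.2} := by
    intro q
    classical
    let B : (Conf (Site d) × Site d × Site d) × Site d → Prop := fun p =>
      p.2 ≠ p.1.2.1 ∧ p.2 ≠ p.1.2.2 ∧
      dist (bisectorProj q p.1.2.1 p.1.2.2) p.2 ≤ dist (bisectorProj q p.1.2.1 p.1.2.2) p.1.2.1
    have hproj : Measurable fun p : (Conf (Site d) × Site d × Site d) × Site d =>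
        bisectorProj q p.1.2.1 p.1.2.2 := by
      unfold bisectorProj; fun_prop
    have hB : MeasurableSet {p | B p} := by
      refine MeasurableSet.inter (measurableSet_eq_fun (by fun_prop) (by fun_prop)).compl
        (MeasurableSet.inter (measurableSet_eq_fun (by fun_prop) (by fun_prop)).compl ?_)
      exact measurableSet_le (hproj.dist (by fun_prop)) (hproj.dist (by fun_prop))
    have h : Measurable fun p : Conf (Site d) × Site d × Site d =>
        ∑' z : p.1, (if B (p, z) then 1 else 0 : ℝ≥0∞) :=
      measurable_tsum_conf (g := fun p z => if B (p, z) then 1 else 0) hS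
        (Measurable.ite hB measurable_const measurable_const)
    have he : {p : Conf (Site d) × Site d × Site d |
        bisectorProj q p.2.1 p.2.2 ∈ strictCell p.1 p.2.1 p.2.2} =
        (fun p : Conf (Site d) × Site d × Site d =>
          ∑' z : p.1, (if B (p, z) then 1 else 0 : ℝ≥0∞)) ⁻¹' {0} := by
      ext p
      simp only [mem_ofPred_eq, mem_preimage, mem_singleton_iff, ENNReal.tsum_eq_zero,
        ite_eq_right_iff, one_ne_zero, imp_false, strictCell, B, not_and, not_le, Subtype.forall]
    rw [he]
    exact h (measurableSet_singleton 0)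
  simp_rw [vorNeighbor_iff_denseSeq]
  refine (measurableSet_mem_conf hS h1).inter ((measurableSet_mem_conf hS h2).inter
    ((measurableSet_eq_fun h1 h2).compl.inter ?_))
  have he : {p : Conf (Site d) × Site d × Site d | ∃ n : ℕ, bisectorProj
      (TopologicalSpace.denseSeq (Site d) n) p.2.1 p.2.2 ∈ strictCell p.1 p.2.1 p.2.2} =
      ⋃ n : ℕ, {p | bisectorProj (TopologicalSpace.denseSeq (Site d) n) p.2.1 p.2.2 ∈
        strictCell p.1 p.2.1 p.2.2} := by ext; simp
  change MeasurableSet {p : Conf (Site d) × Site d × Site d | ∃ n : ℕ, bisectorProj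
      (TopologicalSpace.denseSeq (Site d) n) p.2.1 p.2.2 ∈ strictCell p.1 p.2.1 p.2.2}
  rw [he]
  exact MeasurableSet.iUnion fun n => hcell _

theorem measurable_cond {C : Type*} [MeasurableSpace C] {S : C → Conf (Site d)}
    (hS : Measurable S) {s s' : C → Site d} (hs : Measurable s) (hs' : Measurable s') :
    Measurable fun c => cond (s c) (s' c) (S c) := by
  classical
  have : Measurable fun p : Conf (Site d) × Site d × Site d => cond p.2.1 p.2.2 p.1 :=
    Measurable.ite measurableSet_vorNeighbor measurable_const measurable_const
  exact this.comp (hS.prodMk (hs.prodMk hs'))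

theorem measurable_deg {C : Type*} [MeasurableSpace C] {S : C → Conf (Site d)}
    (hS : Measurable S) {s : C → Site d} (hs : Measurable s) :
    Measurable fun c => deg (s c) (S c) :=
  measurable_tsum_conf_real (g := fun c s' => cond (s c) s' (S c)) hS
    (measurable_cond (hS.comp measurable_fst) (hs.comp measurable_fst) measurable_snd)

theorem cond_symm (s s' : Site d) (S : Conf (Site d)) : cond s s' S = cond s' s S := by
  classical
  exact if_congr vorNeighbor_comm rfl rfl

theorem cond_shift (x s s' : Site d) (S : Conf (Site d)) :
    cond (s - x) (s' - x) (shift x S) = cond s s' S := by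
  classical
  exact if_congr (vorNeighbor_shift x s s') rfl rfl

/-- The points of `S` and of its translate. -/
def shiftEquiv (x : Site d) (S : Conf (Site d)) : S ≃ shift x S where
  toFun s := ⟨s - x, by rw [mem_conf_shift, sub_add_cancel]; exact s.2⟩
  invFun y := ⟨y + x, y.2⟩
  left_inv s := by simp
  right_inv y := by simp

theorem deg_shift (x s : Site d) (S : Conf (Site d)) : deg (s - x) (shift x S) = deg s S := by
  rw [deg, deg, ← (shiftEquiv x S).tsum_eq]
  exact tsum_congr fun s' => cond_shift x s s' S

end Harness

namespace Harness

variable {d : ℕ}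

/-! ### Palm calculus -/

theorem shift_shift (x y : Site d) (S : Conf (Site d)) :
    shift y (shift x S) = shift (x + y) S := by
  apply SetLike.coe_injective
  ext z
  change z + y + x ∈ S ↔ z + (x + y) ∈ S
  rw [add_assoc, add_comm y x]

theorem palm_apply {P : Measure (Conf (Site d))} {A : Set (Conf (Site d))}
    (hA : MeasurableSet A) : palm P A = ∫⁻ S, (palmCount A S : ℝ≥0∞) ∂P :=
  Measure.ofMeasurable_apply A hA

theorem tsum_conf_shift (x : Site d) (S : Conf (Site d)) (g : Site d → ℝ≥0∞) :
    ∑' y : shift x S, g y = ∑' y : S, g (y - x) :=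
  ((shiftEquiv x S).tsum_eq fun y : shift x S => g y).symm

open Classical in
/-- The refined Campbell formula. -/
theorem lintegral_palm {P : Measure (Conf (Site d))} [SFinite P]
    {g : Conf (Site d) → ℝ≥0∞} (hg : Measurable g) :
    ∫⁻ S, g S ∂(palm P) =
      ∫⁻ S, ∑' x : S, (if (x : Site d) ∈ unitCube d then g (shift x S) else 0) ∂P := by
  have hU := measurableSet_unitCube d
  -- `M` is the joint law of `S` and the counting measure on its points in the unit cube. The Palm
  -- measure is its image under recentring, so the formula for functions becomes a change of
  -- variables.
  let M : Measure (Conf (Site d) × Site d) :=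
    (P ⊗ₘ confKernel (Site d)).restrict (Prod.snd ⁻¹' unitCube d)
  have hφ : Measurable fun p : Conf (Site d) × Site d => shift p.2 p.1 :=
    measurable_shift.comp measurable_swap
  have hM : ∀ h : Conf (Site d) → ℝ≥0∞, Measurable h →
      ∫⁻ S, h S ∂(M.map fun p => shift p.2 p.1) =
      ∫⁻ S, ∑' x : S, (if (x : Site d) ∈ unitCube d then h (shift x S) else 0) ∂P := by
    intro h hh
    rw [lintegral_map hh hφ, ← lintegral_indicator (measurable_snd hU), Measure.lintegral_compProd]
    · refine lintegral_congr fun S => ?_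
      rw [← lintegral_confMeasure S fun x => if x ∈ unitCube d then h (shift x S) else 0]
      rfl
    · exact (hh.comp hφ).indicator (measurable_snd hU)
  have : palm P = M.map fun p => shift p.2 p.1 := by
    ext A hA
    rw [palm_apply hA, ← lintegral_indicator_one hA, hM _ (measurable_one.indicator hA)]
    refine lintegral_congr fun S => ?_
    have hf : {s : Site d | s ∈ S ∧ s ∈ unitCube d ∧ shift s S ∈ A}.Finite :=
      (S.2 _ (isBounded_unitCube d)).subset fun s hs => ⟨hs.1, hs.2.1⟩
    rw [← lintegral_confMeasure S fun x => if x ∈ unitCube d then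
      A.indicator 1 (shift x S) else 0, palmCount, Set.ncard_eq_toFinset_card _ hf,
      ← Measure.count_apply_finite _ hf]
    have hm : MeasurableSet {s : Site d | s ∈ unitCube d ∧ shift s S ∈ A} :=
      hU.inter ((measurable_shift.comp (measurable_id.prodMk measurable_const)) hA)
    have he : {s : Site d | s ∈ S ∧ s ∈ unitCube d ∧ shift s S ∈ A} =
        {s : Site d | s ∈ unitCube d ∧ shift s S ∈ A} ∩ S := by
      ext s; simp only [mem_ofPred_eq, mem_inter_iff, SetLike.mem_coe]; tauto
    rw [he, ← Measure.restrict_apply hm, ← lintegral_indicator_one hm]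
    refine lintegral_congr fun x => ?_
    by_cases h1 : x ∈ unitCube d <;> by_cases h2 : shift x S ∈ A <;> simp [indicator, h1, h2]
  rw [this, hM g hg]

/-- The integer translates of the half-open cube tile the space; the tile containing `x` has the
integer parts of the coordinates as its corner. -/
theorem sum_indicator_unitCube_translates (x : Site d) :
    ∑' z : Fin d → ℤ, (unitCube d).indicator (1 : Site d → ℝ≥0∞)
      (x - WithLp.toLp 2 fun i => (z i : ℝ)) = 1 := by
  rw [tsum_eq_single fun i => ⌊x i⌋]
  · rw [indicator_of_mem]
    · rfl
    · intro i
      simp only [PiLp.sub_apply]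
      exact ⟨Int.fract_nonneg (x i), Int.fract_lt_one (x i)⟩
  · intro z hz
    rw [indicator_of_notMem]
    intro h
    refine hz (funext fun i => ?_)
    have := h i
    simp only [PiLp.sub_apply, mem_Ico, sub_nonneg] at this
    exact (Int.floor_eq_iff.2 ⟨this.1, by linarith [this.2]⟩).symm

open Classical in
/-- The mass transport principle for stationary processes. -/
theorem lintegral_mass_transport {P : Measure (Conf (Site d))}
    (hP : ∀ x : Site d, MeasurePreserving (shift x) P P)
    {F : Site d → Site d → Conf (Site d) → ℝ≥0∞}
    (hF : Measurable fun p : Site d × Site d × Conf (Site d) => F p.1 p.2.1 p.2.2)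
    (hcov : ∀ z x y S, F (x - z) (y - z) (shift z S) = F x y S) :
    ∫⁻ S, ∑' x : S, ∑' y : S, (if (x : Site d) ∈ unitCube d then F x y S else 0) ∂P =
    ∫⁻ S, ∑' x : S, ∑' y : S, (if (y : Site d) ∈ unitCube d then F x y S else 0) ∂P := by
  have hU := measurableSet_unitCube d
  let t : (Fin d → ℤ) → Site d := fun z => WithLp.toLp 2 fun i => (z i : ℝ)
  let I : Site d → ℝ≥0∞ := (unitCube d).indicator 1
  have hI : Measurable I := measurable_one.indicator hU
  -- `G a b` is the mass sent from the cube at `a` to the cube at `b`; its mean is invariant under a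
  -- common translation of the two cubes.
  let G : Site d → Site d → Conf (Site d) → ℝ≥0∞ := fun a b S =>
    ∑' x : S, ∑' y : S, I (x - a) * I (y - b) * F x y S
  have hGm : ∀ a b, Measurable (G a b) := by
    intro a b
    refine measurable_tsum_conf (g := fun S x => ∑' y : S, I (x - a) * I (y - b) * F x y S)
      measurable_id ?_
    refine measurable_tsum_conf (C := Conf (Site d) × Site d)
      (g := fun p y => I (p.2 - a) * I (y - b) * F p.2 y p.1) measurable_fst ?_
    refine Measurable.mul (Measurable.mul (hI.comp (by fun_prop)) (hI.comp (by fun_prop))) ?_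
    exact hF.comp (by fun_prop : Measurable fun q : (Conf (Site d) × Site d) × Site d =>
      (q.1.2, q.2, q.1.1))
  have hGshift : ∀ a b c S, G a b (shift c S) = G (a + c) (b + c) S := by
    intro a b c S
    change ∑' x : shift c S, ∑' y : shift c S, I (x - a) * I (y - b) * F x y (shift c S) = _
    rw [tsum_conf_shift c S fun x => ∑' y : shift c S, I (x - a) * I (y - b) * F x y (shift c S)]
    refine tsum_congr fun x => ?_
    rw [tsum_conf_shift c S fun y => I (x - c - a) * I (y - b) * F (x - c) y (shift c S)]
    refine tsum_congr fun y => ?_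
    rw [hcov, sub_sub, sub_sub, add_comm a, add_comm b]
  have hGint : ∀ a b c, ∫⁻ S, G (a + c) (b + c) S ∂P = ∫⁻ S, G a b S ∂P := by
    intro a b c
    rw [← (hP c).lintegral_comp (hGm a b)]
    exact lintegral_congr fun S => (hGshift a b c S).symm
  have hleft : ∀ S : Conf (Site d), ∑' x : S, ∑' y : S, (if (x : Site d) ∈ unitCube d then F x y S else 0) =
      ∑' z, G 0 (t z) S := by
    intro S
    change _ = ∑' z, ∑' x : S, ∑' y : S, I (x - 0) * I (y - t z) * F x y S
    refine Eq.trans ?_ ENNReal.tsum_comm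
    refine tsum_congr fun x => ?_
    refine Eq.trans ?_ ENNReal.tsum_comm
    refine tsum_congr fun y => ?_
    simp_rw [mul_assoc, mul_comm (I (y - _)), ← mul_assoc]
    rw [ENNReal.tsum_mul_left, sum_indicator_unitCube_translates, mul_one, sub_zero]
    by_cases h : (x : Site d) ∈ unitCube d <;> simp [I, h]
  have hright : ∀ S : Conf (Site d), ∑' x : S, ∑' y : S, (if (y : Site d) ∈ unitCube d then F x y S else 0) =
      ∑' z, G (t z) 0 S := by
    intro S
    change _ = ∑' z, ∑' x : S, ∑' y : S, I (x - t z) * I (y - 0) * F x y S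
    refine Eq.trans ?_ ENNReal.tsum_comm
    refine tsum_congr fun x => ?_
    refine Eq.trans ?_ ENNReal.tsum_comm
    refine tsum_congr fun y => ?_
    simp_rw [mul_assoc]
    rw [ENNReal.tsum_mul_right, sum_indicator_unitCube_translates, one_mul, sub_zero]
    by_cases h : (y : Site d) ∈ unitCube d <;> simp [I, h]
  simp_rw [hleft, hright]
  -- Translating the cubes at `0` and `-z` by `z` turns the mass that the unit cube sends into the
  -- mass that it receives.
  rw [lintegral_tsum fun z => (hGm _ _).aemeasurable,
    lintegral_tsum fun z => (hGm _ _).aemeasurable, ← (Equiv.neg (Fin d → ℤ)).tsum_eq]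
  refine tsum_congr fun z => ?_
  rw [← hGint _ _ (t z)]
  have : t (Equiv.neg (Fin d → ℤ) z) + t z = 0 := by
    ext i; simp [t]
  rw [this, zero_add]

/-- The mass transport principle under the Palm measure. -/
theorem lintegral_palm_swap {P : Measure (Conf (Site d))} [SFinite P]
    (hP : ∀ x : Site d, MeasurePreserving (shift x) P P)
    {H : Site d → Conf (Site d) → ℝ≥0∞}
    (hH : Measurable fun p : Site d × Conf (Site d) => H p.1 p.2) :
    ∫⁻ S, ∑' x : S, H x S ∂(palm P) = ∫⁻ S, ∑' x : S, H (-x) (shift x S) ∂(palm P) := by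
  classical
  have hH' : Measurable fun p : Site d × Conf (Site d) => H (-p.1) (shift p.1 p.2) :=
    hH.comp (measurable_fst.neg.prodMk measurable_shift)
  rw [lintegral_palm, lintegral_palm]
  rotate_left
  · exact measurable_tsum_conf (g := fun S x => H (-x) (shift x S)) measurable_id
      (hH'.comp measurable_swap)
  · exact measurable_tsum_conf (g := fun S x => H x S) measurable_id (hH.comp measurable_swap)
  -- The mass sent from `x` to `y` is `H` evaluated as seen from `x`, which is invariant under
  -- common translations.
  let F : Site d → Site d → Conf (Site d) → ℝ≥0∞ := fun x y S => H (y - x) (shift x S)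
  have hF : Measurable fun p : Site d × Site d × Conf (Site d) => F p.1 p.2.1 p.2.2 :=
    hH.comp ((by fun_prop : Measurable fun p : Site d × Site d × Conf (Site d) =>
      p.2.1 - p.1).prodMk (measurable_shift.comp (by fun_prop :
      Measurable fun p : Site d × Site d × Conf (Site d) => (p.1, p.2.2))))
  have h := lintegral_mass_transport hP hF fun z x y S => by
    change H (y - z - (x - z)) (shift (x - z) (shift z S)) = H (y - x) (shift x S)
    rw [shift_shift, sub_sub_sub_cancel_right, add_sub_cancel]
  convert h using 1
  · refine lintegral_congr fun S => tsum_congr fun x => ?_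
    split_ifs
    · exact tsum_conf_shift x S fun y => H y (shift x S)
    · simp
  · refine lintegral_congr fun S => ?_
    rw [ENNReal.tsum_comm]
    refine tsum_congr fun y => ?_
    split_ifs
    · rw [tsum_conf_shift y S fun x => H (-x) (shift x (shift (y : Site d) S))]
      refine tsum_congr fun x => ?_
      change _ = H (y - x) (shift x S)
      rw [shift_shift, neg_sub, add_sub_cancel]
    · simp

/-- A property which the typical point has almost surely is shared by all points. -/
theorem ae_palm_forall {P : Measure (Conf (Site d))} [SFinite P]
    (hP : ∀ x : Site d, MeasurePreserving (shift x) P P)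
    {p : Conf (Site d) → Prop} (hp : MeasurableSet {S | p S}) (h : ∀ᵐ S ∂(palm P), p S) :
    ∀ᵐ S ∂(palm P), ∀ x ∈ S, p (shift x S) := by
  classical
  let J : Conf (Site d) → ℝ≥0∞ := {S | p S}ᶜ.indicator 1
  have hJ : Measurable J := measurable_one.indicator hp.compl
  -- If the property fails at the origin, let the origin send unit mass to every point. The mass
  -- received by the origin is then the number of points at which the property fails.
  have h0 : ∫⁻ S, ∑' x : S, J S ∂(palm P) = 0 := by
    rw [lintegral_eq_zero_iff]
    · filter_upwards [h] with S hS
      simp [J, hS]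
    · exact measurable_tsum_conf (g := fun S _ => J S) measurable_id (hJ.comp measurable_fst)
  rw [lintegral_palm_swap hP (H := fun _ S => J S) (hJ.comp measurable_snd),
    lintegral_eq_zero_iff] at h0
  · filter_upwards [h0] with S hS x hx
    have := (ENNReal.tsum_eq_zero.1 hS) ⟨x, hx⟩
    by_contra hn
    simp [J, hn] at this
  · exact measurable_tsum_conf (g := fun S x => J (shift x S)) measurable_id
      ((hJ.comp measurable_shift).comp measurable_swap)

theorem Assumptions.isProbabilityMeasure_palm {P : Measure (Conf (Site d))}
    (hP : Assumptions P) : IsProbabilityMeasure (palm P) := by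
  refine ⟨?_⟩
  rw [palm_apply MeasurableSet.univ, ← hP.intensity_one]
  refine lintegral_congr fun S => ?_
  simp only [palmCount, count, mem_univ, and_true]
  rfl

end Harness

namespace Harness

/-! ### Poisson processes -/

theorem lintegral_natCast_poissonMeasure (r : ℝ≥0) :
    ∫⁻ n : ℕ, (n : ℝ≥0∞) ∂(poissonMeasure r) = r := by
  rw [lintegral_countable']
  simp_rw [poissonMeasure_singleton]
  rw [tsum_eq_zero_add' ENNReal.summable]
  have h : ∀ n : ℕ, ((n + 1 : ℕ) : ℝ≥0∞) *
      ENNReal.ofReal (Real.exp (-r) * r ^ (n + 1) / (n + 1).factorial) =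
      r * ENNReal.ofReal (Real.exp (-r) * r ^ n / n.factorial) := by
    intro n
    rw [← ENNReal.ofReal_natCast, ← ENNReal.ofReal_mul (by positivity),
      ← ENNReal.ofReal_coe_nnreal, ← ENNReal.ofReal_mul (by positivity)]
    congr 1
    rw [Nat.factorial_succ]
    push_cast
    field_simp
    ring
  simp_rw [h]
  have h1 := hasSum_one_poissonMeasure r
  rw [ENNReal.tsum_mul_left, ← ENNReal.ofReal_tsum_of_nonneg (fun n => by positivity)
    h1.summable, h1.tsum_eq]
  simp

theorem measurable_confMeasure_apply {C : Type*} [MeasurableSpace C] {N : C → Conf ℝ}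
    (hN : Measurable N) {D : Set (C × ℝ)} (hD : MeasurableSet D) :
    Measurable fun c => confMeasure (N c) (Prod.mk c ⁻¹' D) :=
  Kernel.measurable_kernel_prodMk_left (κ := (confKernel ℝ).comap N hN) hD

theorem epochs_finite (N : Conf ℝ) (t : ℝ) : (epochs N t).Finite :=
  (N.2 _ (Metric.isBounded_Ioc 0 t)).subset fun _ h => ⟨h.1, h.2⟩

theorem confMeasure_eq_zero_iff {N : Conf ℝ} {B : Set ℝ} (hB : MeasurableSet B) :
    confMeasure N B = 0 ↔ ∀ x ∈ N, x ∉ B := by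
  rw [confMeasure, Measure.restrict_apply hB, Measure.count_eq_zero_iff, eq_empty_iff_forall_notMem]
  constructor
  · intro h x hx hxB; exact h x ⟨hxB, hx⟩
  · intro h x hx; exact h x hx.2 hx.1

theorem measurableSet_epochs_eq_empty {C : Type*} [MeasurableSpace C] {N : C → Conf ℝ}
    (hN : Measurable N) {t : C → ℝ} (ht : Measurable t) :
    MeasurableSet {c | epochs (N c) (t c) = ∅} := by
  have hD : MeasurableSet {p : C × ℝ | 0 < p.2 ∧ p.2 ≤ t p.1} :=
    (measurableSet_lt measurable_const measurable_snd).inter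
      (measurableSet_le measurable_snd (ht.comp measurable_fst))
  convert (measurable_confMeasure_apply hN hD) (measurableSet_singleton 0) using 1
  ext c
  rw [mem_preimage, mem_singleton_iff,
    confMeasure_eq_zero_iff (measurable_prodMk_left hD), mem_ofPred_eq,
    eq_empty_iff_forall_notMem]
  simp only [epochs, mem_ofPred_eq, mem_preimage]
  exact forall_congr' fun x => by tauto

/-- For `b ≥ 0` the supremum is at most `b` exactly when the clock has no point in `(b, t]`; the
value `0` for the empty set is consistent with this. -/
theorem measurable_sSup_epochs {C : Type*} [MeasurableSpace C] {N : C → Conf ℝ}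
    (hN : Measurable N) {t : C → ℝ} (ht : Measurable t) :
    Measurable fun c => sSup (epochs (N c) (t c)) := by
  refine measurable_of_Iic fun b => ?_
  by_cases hb : 0 ≤ b
  · have hD : MeasurableSet {p : C × ℝ | b < p.2 ∧ p.2 ≤ t p.1} :=
      (measurableSet_lt measurable_const measurable_snd).inter
        (measurableSet_le measurable_snd (ht.comp measurable_fst))
    convert (measurable_confMeasure_apply hN hD) (measurableSet_singleton 0) using 1
    ext c
    rw [mem_preimage, mem_preimage, mem_singleton_iff,
      confMeasure_eq_zero_iff (measurable_prodMk_left hD), mem_Iic]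
    constructor
    · intro h x hx hxD
      have : x ∈ epochs (N c) (t c) := ⟨hx, hb.trans_lt hxD.1, hxD.2⟩
      exact absurd (le_csSup (epochs_finite _ _).bddAbove this) (not_le.2 (h.trans_lt hxD.1))
    · intro h
      refine Real.sSup_le (fun x hx => ?_) hb
      by_contra hxb
      exact h x hx.1 ⟨not_le.1 hxb, hx.2.2⟩
  · convert MeasurableSet.empty
    ext c
    simp only [mem_preimage, mem_Iic, mem_empty_iff_false, iff_false, not_le]
    exact (not_le.1 hb).trans_le (Real.sSup_nonneg fun x hx => hx.2.1.le)

/-- The points of a configuration which precede `u`. -/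
def cut (u : ℝ) (N : Conf ℝ) : Conf ℝ :=
  ⟨{x | x ∈ N ∧ x < u}, fun B hB => (N.2 B hB).subset fun _ h => ⟨h.1.1, h.2⟩⟩

theorem mem_cut {u x : ℝ} {N : Conf ℝ} : x ∈ cut u N ↔ x ∈ N ∧ x < u := Iff.rfl

theorem count_cut (u : ℝ) (N : Conf ℝ) (B : Set ℝ) : count B (cut u N) = count (B ∩ Iio u) N := by
  unfold count
  congr 1
  ext x
  simp only [mem_inter_iff, SetLike.mem_coe, mem_cut, mem_Iio]
  tauto

theorem measurable_cut {C : Type*} [MeasurableSpace C] {N : C → Conf ℝ} (hN : Measurable N)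
    {u : C → ℝ} (hu : Measurable u) : Measurable fun c => cut (u c) (N c) := by
  refine measurable_generateFrom ?_
  rintro _ ⟨B, k, hB, hBm, rfl⟩
  have hD : MeasurableSet {p : C × ℝ | p.2 ∈ B ∧ p.2 < u p.1} :=
    (measurable_snd hBm).inter (measurableSet_lt measurable_snd (hu.comp measurable_fst))
  convert (measurable_confMeasure_apply hN hD) (measurableSet_singleton (k : ℝ≥0∞)) using 1
  ext c
  have : Prod.mk c ⁻¹' {p : C × ℝ | p.2 ∈ B ∧ p.2 < u p.1} = B ∩ Iio (u c) := by
    ext; simp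
  rw [mem_preimage, mem_preimage, mem_singleton_iff, this,
    confMeasure_apply _ (hB.subset inter_subset_left) (hBm.inter measurableSet_Iio),
    Nat.cast_inj, ← count_cut]
  rfl

/-! ### Decomposition of finite families of sets into disjoint atoms -/

section Atoms

/-- The atom of the algebra generated by the family `F` which consists of the points that belong
exactly to the members of `J`. -/
def familyAtom (F J : Finset (Set ℝ)) : Set ℝ := {x | (∃ B ∈ F, x ∈ B) ∧ ∀ B ∈ F, x ∈ B ↔ B ∈ J}

theorem familyAtom_subset {F J : Finset (Set ℝ)} : familyAtom F J ⊆ ⋃ B ∈ F, B := by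
  rintro x ⟨⟨B, hB, hx⟩, -⟩
  exact mem_biUnion hB hx

theorem isBounded_familyAtom {F : Finset (Set ℝ)} (hF : ∀ B ∈ F, Bornology.IsBounded B)
    (J : Finset (Set ℝ)) : Bornology.IsBounded (familyAtom F J) :=
  ((Bornology.isBounded_biUnion_finset F).2 hF).subset familyAtom_subset

theorem measurableSet_familyAtom {F : Finset (Set ℝ)} (hF : ∀ B ∈ F, MeasurableSet B)
    (J : Finset (Set ℝ)) : MeasurableSet (familyAtom F J) := by
  classical
  have : familyAtom F J = (⋃ B ∈ F, B) ∩ ⋂ B ∈ F, (if B ∈ J then B else Bᶜ) := by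
    ext x
    simp only [familyAtom, mem_ofPred_eq, mem_inter_iff, mem_iUnion, mem_iInter, exists_prop]
    refine and_congr_right fun _ => forall_congr' fun B => forall_congr' fun _ => ?_
    split_ifs with h <;> simp [h]
  rw [this]
  refine (F.measurableSet_biUnion fun B hB => hF B hB).inter
    (F.measurableSet_biInter fun B hB => ?_)
  split_ifs
  · exact hF B hB
  · exact (hF B hB).compl

theorem disjoint_familyAtom {F J J' : Finset (Set ℝ)} (hJ : J ⊆ F) (hJ' : J' ⊆ F)
    (h : J ≠ J') : Disjoint (familyAtom F J) (familyAtom F J') := by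
  refine Set.disjoint_left.2 fun x hx hx' => h ?_
  ext B
  constructor
  · intro hB; exact (hx'.2 B (hJ hB)).1 ((hx.2 B (hJ hB)).2 hB)
  · intro hB; exact (hx.2 B (hJ' hB)).1 ((hx'.2 B (hJ' hB)).2 hB)

-- Counts in overlapping sets become sums of counts in disjoint atoms, to which the independence of
-- a Poisson process applies.
open Classical in
theorem count_eq_sum_familyAtom {F : Finset (Set ℝ)} (hFb : ∀ B ∈ F, Bornology.IsBounded B)
    (hFm : ∀ B ∈ F, MeasurableSet B) {B : Set ℝ} (hB : B ∈ F) (N : Conf ℝ) :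
    count B N = ∑ J ∈ F.powerset with B ∈ J, count (familyAtom F J) N := by
  have hU : B = ⋃ J ∈ F.powerset.filter (B ∈ ·), familyAtom F J := by
    ext x
    simp only [Finset.mem_filter, Finset.mem_powerset, mem_iUnion, exists_prop]
    constructor
    · intro hx
      refine ⟨F.filter (x ∈ ·), ⟨Finset.filter_subset _ _, Finset.mem_filter.2 ⟨hB, hx⟩⟩,
        ⟨B, hB, hx⟩, fun A hA => ?_⟩
      simp [hA]
    · rintro ⟨J, ⟨-, hBJ⟩, hx⟩
      exact (hx.2 B hB).2 hBJ
  have h : (count B N : ℝ≥0∞) = ∑ J ∈ F.powerset with B ∈ J, (count (familyAtom F J) N : ℝ≥0∞) := by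
    rw [← confMeasure_apply N (hFb B hB) (hFm B hB)]
    conv_lhs => rw [hU]
    rw [measure_biUnion_finset]
    · exact Finset.sum_congr rfl fun J _ => confMeasure_apply N (isBounded_familyAtom hFb J)
        (measurableSet_familyAtom hFm J)
    · intro J hJ J' hJ' hne
      simp only [Finset.coe_filter, Finset.mem_powerset, mem_ofPred_eq] at hJ hJ'
      exact disjoint_familyAtom hJ.1 hJ'.1 hne
    · exact fun J _ => measurableSet_familyAtom hFm J
  exact_mod_cast h

end Atoms

/-! ### Uniqueness of the Poisson law and the formula for predictable sums -/

section Poisson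

variable {Ω : Type*} [MeasurableSpace Ω] {Q : Measure Ω} {T : Ω → Conf ℝ}

theorem IsPoissonProcess.iIndepFun_count (hT : IsPoissonProcess T Q)
    {ι : Type*} [Finite ι] (B : ι → Set ℝ) (hm : ∀ i, MeasurableSet (B i))
    (hb : ∀ i, Bornology.IsBounded (B i)) (hd : Pairwise (Function.onFun Disjoint B)) :
    iIndepFun (fun i ω => count (B i) (T ω)) Q := by
  obtain ⟨n, ⟨e⟩⟩ := Finite.exists_equiv_fin ι
  have h := hT.indep n (fun i => B (e.symm i)) (fun i => hm _) (fun i => hb _)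
    fun i j hij => hd (e.symm.injective.ne hij)
  have h' := h.precomp e.injective
  simpa only [Equiv.symm_apply_apply] using h'

theorem IsPoissonProcess.measurable_count_comp (hT : IsPoissonProcess T Q) {B : Set ℝ}
    (hb : Bornology.IsBounded B) (hm : MeasurableSet B) :
    Measurable fun ω => count B (T ω) := (measurable_count hb hm).comp hT.measurable

theorem IsPoissonProcess.lintegral_confMeasure (hT : IsPoissonProcess T Q) {B : Set ℝ}
    (hb : Bornology.IsBounded B) (hm : MeasurableSet B) :
    ∫⁻ ω, confMeasure (T ω) B ∂Q = volume B := by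
  simp_rw [confMeasure_apply _ hb hm]
  have := lintegral_natCast_poissonMeasure (volume B).toNNReal
  rw [← hT.law B hm hb, lintegral_map measurable_from_top (hT.measurable_count_comp hb hm),
    ENNReal.coe_toNNReal hb.measure_lt_top.ne] at this
  exact this

/-- The event that a configuration has the same number of points as `N₀` in all members of `F`. -/
def countEvent (F : Finset (Set ℝ)) (N₀ : Conf ℝ) : Set (Conf ℝ) :=
  {N | ∀ B ∈ F, count B N = count B N₀}

theorem measurableSet_countEvent {F : Finset (Set ℝ)} (hFb : ∀ B ∈ F, Bornology.IsBounded B)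
    (hFm : ∀ B ∈ F, MeasurableSet B) (N₀ : Conf ℝ) : MeasurableSet (countEvent F N₀) := by
  have : countEvent F N₀ = ⋂ B ∈ F, {N | count B N = count B N₀} := by
    ext; simp [countEvent]
  rw [this]
  exact F.measurableSet_biInter fun B hB =>
    (measurable_count (hFb B hB) (hFm B hB)) (measurableSet_singleton _)

/-- A common element `N₁` can serve as reference configuration for both events, so the events
`countEvent` form a π-system. -/
theorem countEvent_inter [DecidableEq (Set ℝ)] {F F' : Finset (Set ℝ)} {N₀ N₀' N₁ : Conf ℝ}
    (h : N₁ ∈ countEvent F N₀ ∩ countEvent F' N₀') :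
    countEvent F N₀ ∩ countEvent F' N₀' = countEvent (F ∪ F') N₁ := by
  ext N
  simp only [countEvent, mem_inter_iff, mem_ofPred_eq, Finset.mem_union] at h ⊢
  constructor
  · rintro ⟨h1, h2⟩ B (hB | hB)
    · rw [h1 B hB, h.1 B hB]
    · rw [h2 B hB, h.2 B hB]
  · intro hN
    exact ⟨fun B hB => by rw [hN B (Or.inl hB), h.1 B hB],
      fun B hB => by rw [hN B (Or.inr hB), h.2 B hB]⟩

/-- The event depends only on the counts in the atoms of `F`, whose joint law is a product of
Poisson laws determined by Lebesgue measure. -/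
theorem IsPoissonProcess.map_countEvent {Ω' : Type*} [MeasurableSpace Ω'] {Q' : Measure Ω'}
    {T' : Ω' → Conf ℝ} [IsProbabilityMeasure Q] [IsProbabilityMeasure Q']
    (hT : IsPoissonProcess T Q) (hT' : IsPoissonProcess T' Q')
    {F : Finset (Set ℝ)} (hFb : ∀ B ∈ F, Bornology.IsBounded B)
    (hFm : ∀ B ∈ F, MeasurableSet B) (N₀ : Conf ℝ) :
    Q.map T (countEvent F N₀) = Q'.map T' (countEvent F N₀) := by
  classical
  let ι := {J // J ∈ F.powerset}
  let A : ι → Set ℝ := fun J => familyAtom F J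
  have hm : ∀ J, MeasurableSet (A J) := fun J => measurableSet_familyAtom hFm _
  have hb : ∀ J, Bornology.IsBounded (A J) := fun J => isBounded_familyAtom hFb _
  have hd : Pairwise (Function.onFun Disjoint A) := fun J J' hne =>
    disjoint_familyAtom (Finset.mem_powerset.1 J.2) (Finset.mem_powerset.1 J'.2)
      fun h => hne (Subtype.ext h)
  have hlaw : Q.map (fun ω J => count (A J) (T ω)) = Q'.map (fun ω J => count (A J) (T' ω)) := by
    rw [(iIndepFun_iff_map_fun_eq_pi_map fun J =>
        (hT.measurable_count_comp (hb J) (hm J)).aemeasurable).1 (hT.iIndepFun_count A hm hb hd),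
      (iIndepFun_iff_map_fun_eq_pi_map fun J =>
        (hT'.measurable_count_comp (hb J) (hm J)).aemeasurable).1 (hT'.iIndepFun_count A hm hb hd)]
    simp_rw [hT.law _ (hm _) (hb _), hT'.law _ (hm _) (hb _)]
  let E : Set (ι → ℕ) := {c | ∀ B ∈ F, ∑ J : ι with B ∈ J.1, c J = count B N₀}
  have hE : ∀ N : Conf ℝ, N ∈ countEvent F N₀ ↔ (fun J => count (A J) N) ∈ E := by
    intro N
    refine forall_congr' fun B => forall_congr' fun hB => ?_
    rw [count_eq_sum_familyAtom hFb hFm hB N, Finset.sum_filter, Finset.sum_filter,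
      ← Finset.sum_coe_sort F.powerset fun J => if B ∈ J then count (familyAtom F J) N else 0]
  have hEm : MeasurableSet E := MeasurableSet.of_discrete
  have hcm := measurableSet_countEvent hFb hFm N₀
  rw [Measure.map_apply hT.measurable hcm, Measure.map_apply hT'.measurable hcm]
  have h : Q.map (fun ω J => count (A J) (T ω)) E = Q'.map (fun ω J => count (A J) (T' ω)) E := by
    rw [hlaw]
  rw [Measure.map_apply (measurable_pi_iff.2 fun J => hT.measurable_count_comp (hb J) (hm J)) hEm,
    Measure.map_apply (measurable_pi_iff.2 fun J => hT'.measurable_count_comp (hb J) (hm J)) hEm]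
    at h
  convert h using 2
  · ext ω; exact hE (T ω)
  · ext ω; exact hE (T' ω)

theorem conf_eq_generateFrom_countEvent : (inferInstance : MeasurableSpace (Conf ℝ)) =
    MeasurableSpace.generateFrom {A | ∃ (F : Finset (Set ℝ)) (N₀ : Conf ℝ),
      (∀ B ∈ F, Bornology.IsBounded B) ∧ (∀ B ∈ F, MeasurableSet B) ∧ A = countEvent F N₀} := by
  refine le_antisymm (MeasurableSpace.generateFrom_le ?_) (MeasurableSpace.generateFrom_le ?_)
  · rintro _ ⟨B, k, hb, hm, rfl⟩
    -- Not every value is attained (a one-point set never contains two points), and `countEvent`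
    -- needs a reference configuration; for an unattained `k` the event is empty.
    by_cases h : ∃ N₀ : Conf ℝ, count B N₀ = k
    · obtain ⟨N₀, hN₀⟩ := h
      refine MeasurableSpace.measurableSet_generateFrom ⟨{B}, N₀, by simpa, by simpa, ?_⟩
      ext N; simp [countEvent, hN₀]
    · convert MeasurableSet.empty
      ext N
      simp only [mem_ofPred_eq, mem_empty_iff_false, iff_false]
      exact fun hN => h ⟨N, hN⟩
  · rintro _ ⟨F, N₀, hFb, hFm, rfl⟩
    exact measurableSet_countEvent hFb hFm N₀

/-- The law of a Poisson process of rate one is unique. -/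
theorem IsPoissonProcess.map_eq {Ω' : Type*} [MeasurableSpace Ω'] {Q' : Measure Ω'}
    {T' : Ω' → Conf ℝ} [IsProbabilityMeasure Q] [IsProbabilityMeasure Q']
    (hT : IsPoissonProcess T Q) (hT' : IsPoissonProcess T' Q') : Q.map T = Q'.map T' := by
  classical
  have := Measure.isProbabilityMeasure_map (μ := Q) hT.measurable.aemeasurable
  have := Measure.isProbabilityMeasure_map (μ := Q') hT'.measurable.aemeasurable
  refine ext_of_generate_finite _ conf_eq_generateFrom_countEvent ?_ ?_ (by simp)
  · rintro _ ⟨F, N₀, hFb, hFm, rfl⟩ _ ⟨F', N₀', hFb', hFm', rfl⟩ ⟨N₁, h⟩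
    refine ⟨F ∪ F', N₁, fun B hB => ?_, fun B hB => ?_, countEvent_inter h⟩
    · exact (Finset.mem_union.1 hB).elim (hFb B) (hFb' B)
    · exact (Finset.mem_union.1 hB).elim (hFm B) (hFm' B)
  · rintro _ ⟨F, N₀, hFb, hFm, rfl⟩
    exact hT.map_countEvent hT' hFb hFm N₀

theorem IsPoissonProcess.id_map [IsProbabilityMeasure Q] (hT : IsPoissonProcess T Q) :
    IsPoissonProcess id (Q.map T) := by
  have := Measure.isProbabilityMeasure_map (μ := Q) hT.measurable.aemeasurable
  refine ⟨measurable_id, fun B hm hb => ?_, fun k B hm hb hd => ?_⟩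
  · rw [← hT.law B hm hb]
    exact Measure.map_map (measurable_count hb hm) hT.measurable
  · have hc : ∀ i, Measurable (count (B i) : Conf ℝ → ℕ) := fun i => measurable_count (hb i) (hm i)
    have h := (iIndepFun_iff_map_fun_eq_pi_map fun i =>
      (hT.measurable_count_comp (hb i) (hm i)).aemeasurable).1 (hT.indep k B hm hb hd)
    refine (iIndepFun_iff_map_fun_eq_pi_map fun i => (hc i).aemeasurable).2 ?_
    rw [Measure.map_map (measurable_pi_iff.2 fun i => hc i) hT.measurable]
    refine h.trans (congrArg _ (funext fun i => ?_))
    exact (Measure.map_map (hc i) hT.measurable).symm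

/-- The number of points in a set is independent of the numbers of points in sets disjoint
from it. -/
theorem IsPoissonProcess.lintegral_confMeasure_mul_countEvent [IsProbabilityMeasure Q]
    (hT : IsPoissonProcess T Q)
    {F : Finset (Set ℝ)} (hFb : ∀ B ∈ F, Bornology.IsBounded B)
    (hFm : ∀ B ∈ F, MeasurableSet B) (N₀ : Conf ℝ) {I : Set ℝ} (hIb : Bornology.IsBounded I)
    (hIm : MeasurableSet I) (hI : ∀ B ∈ F, Disjoint I B) :
    ∫⁻ ω, (T ⁻¹' countEvent F N₀).indicator (fun ω => confMeasure (T ω) I) ω ∂Q =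
      volume I * Q (T ⁻¹' countEvent F N₀) := by
  classical
  let F' := insert I F
  have hFb' : ∀ B ∈ F', Bornology.IsBounded B := by
    intro B hB
    rcases Finset.mem_insert.1 hB with rfl | hB
    · exact hIb
    · exact hFb B hB
  have hFm' : ∀ B ∈ F', MeasurableSet B := by
    intro B hB
    rcases Finset.mem_insert.1 hB with rfl | hB
    · exact hIm
    · exact hFm B hB
  let ι := {J // J ∈ F'.powerset}
  let A : ι → Set ℝ := fun J => familyAtom F' J
  have hm : ∀ J, MeasurableSet (A J) := fun J => measurableSet_familyAtom hFm' _
  have hb : ∀ J, Bornology.IsBounded (A J) := fun J => isBounded_familyAtom hFb' _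
  have hd : Pairwise (Function.onFun Disjoint A) := fun J J' hne =>
    disjoint_familyAtom (Finset.mem_powerset.1 J.2) (Finset.mem_powerset.1 J'.2)
      fun h => hne (Subtype.ext h)
  -- Atoms inside `I` determine the count of `I`. The counts of members of `F` use only atoms
  -- outside `I`, as an atom in both is empty by disjointness. The two blocks of counts are
  -- independent.
  let S₁ : Finset ι := Finset.univ.filter fun J => I ∈ J.1
  let S₂ : Finset ι := Finset.univ.filter fun J => I ∉ J.1
  have hind := (hT.iIndepFun_count A hm hb hd).indepFun_finset S₁ S₂
    (Finset.disjoint_filter_filter_not _ _ _) fun J => hT.measurable_count_comp (hb J) (hm J)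
  have hsum : ∀ B ∈ F', ∀ N : Conf ℝ, count B N = ∑ J : ι with B ∈ J.1, count (A J) N := by
    intro B hB N
    rw [count_eq_sum_familyAtom hFb' hFm' hB N, Finset.sum_filter, Finset.sum_filter,
      ← Finset.sum_coe_sort F'.powerset fun J => if B ∈ J then count (familyAtom F' J) N else 0]
  let f₁ : (S₁ → ℕ) → ℝ≥0∞ := fun c => ((∑ J, c J : ℕ) : ℝ≥0∞)
  let f₂ : (S₂ → ℕ) → ℝ≥0∞ := fun c =>
    if ∀ B ∈ F, ∑ J : S₂ with B ∈ J.1.1, c J = count B N₀ then 1 else 0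
  have h1 : ∀ ω, confMeasure (T ω) I = f₁ fun J => count (A J) (T ω) := by
    intro ω
    rw [confMeasure_apply _ hIb hIm, hsum I (Finset.mem_insert_self _ _) (T ω)]
    simp only [f₁]
    rw [Finset.sum_coe_sort S₁ fun J => count (A J) (T ω)]
  have h2 : ∀ ω, (T ⁻¹' countEvent F N₀).indicator 1 ω = f₂ fun J => count (A J) (T ω) := by
    intro ω
    have hiff : T ω ∈ countEvent F N₀ ↔
        ∀ B ∈ F, ∑ J : S₂ with B ∈ J.1.1, count (A J) (T ω) = count B N₀ := by
      refine forall_congr' fun B => forall_congr' fun hB => ?_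
      rw [hsum B (Finset.mem_insert_of_mem hB) (T ω)]
      have h3 : ∑ J : ι with B ∈ J.1, count (A J) (T ω) =
          ∑ J : S₂ with B ∈ J.1.1, count (A J) (T ω) := by
        rw [Finset.sum_filter, Finset.sum_filter, Finset.sum_coe_sort S₂ fun J : ι =>
          if B ∈ J.1 then count (A J) (T ω) else 0]
        refine (Finset.sum_subset (Finset.subset_univ _) fun J _ hJ => ?_).symm
        split_ifs with hBJ
        · have hIJ : I ∈ J.1 := by simpa [S₂] using hJ
          have : A J = ∅ := by
            refine eq_empty_iff_forall_notMem.2 fun x hx => ?_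
            exact Set.disjoint_left.1 (hI B hB)
              ((hx.2 I (Finset.mem_insert_self _ _)).2 hIJ)
              ((hx.2 B (Finset.mem_insert_of_mem hB)).2 hBJ)
          rw [this]; simp [count]
        · rfl
      rw [h3]
    by_cases h : T ω ∈ countEvent F N₀
    · rw [indicator_of_mem (show ω ∈ T ⁻¹' countEvent F N₀ from h)]
      simp only [f₂]
      rw [if_pos (hiff.1 h)]; rfl
    · rw [indicator_of_notMem (show ω ∉ T ⁻¹' countEvent F N₀ from h)]
      simp only [f₂]
      rw [if_neg fun h' => h (hiff.2 h')]
  have hcm := measurableSet_countEvent hFb hFm N₀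
  have h3 : ∀ ω, (T ⁻¹' countEvent F N₀).indicator (fun ω => confMeasure (T ω) I) ω =
      (f₁ fun J => count (A J) (T ω)) * (f₂ fun J => count (A J) (T ω)) := by
    intro ω
    rw [← h1, ← h2]
    by_cases h : ω ∈ T ⁻¹' countEvent F N₀ <;> simp [h]
  simp_rw [h3]
  have hcomp := hind.comp (φ := f₁) (ψ := f₂) (Measurable.of_discrete) (Measurable.of_discrete)
  have hm1 : Measurable fun ω => f₁ fun J => count (A J) (T ω) :=
    (Measurable.of_discrete (f := f₁)).comp (measurable_pi_iff.2 fun J : S₁ =>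
      hT.measurable_count_comp (hb J) (hm J))
  have hm2 : Measurable fun ω => f₂ fun J => count (A J) (T ω) :=
    (Measurable.of_discrete (f := f₂)).comp (measurable_pi_iff.2 fun J : S₂ =>
      hT.measurable_count_comp (hb J) (hm J))
  have h4 := lintegral_mul_eq_lintegral_mul_lintegral_of_indepFun hm1 hm2 hcomp
  simp only [Pi.mul_apply] at h4
  rw [h4]
  simp_rw [← h1, ← h2]
  rw [hT.lintegral_confMeasure hIb hIm, lintegral_indicator_one (hT.measurable hcm)]

/-- The mean of a sum over the epochs of a Poisson process of a functional of the past. -/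
theorem IsPoissonProcess.lintegral_predictable [IsProbabilityMeasure Q]
    (hT : IsPoissonProcess T Q) {G : ℝ → Conf ℝ → ℝ≥0∞}
    (hG : Measurable fun p : ℝ × Conf ℝ => G p.1 p.2) (a b : ℝ) :
    ∫⁻ ω, ∫⁻ τ in Ioc a b, G τ (cut τ (T ω)) ∂(confMeasure (T ω)) ∂Q =
      ∫⁻ u in Ioc a b, ∫⁻ ω, G u (cut u (T ω)) ∂Q := by
  classical
  let π := Q.map T
  have : IsProbabilityMeasure π := Measure.isProbabilityMeasure_map hT.measurable.aemeasurable
  -- `M₁` selects an epoch of the process, `M₂` an independent uniform time. They differ in general,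
  -- but they agree on sets that look at the configuration only before the selected time.
  let M₁ : Measure (ℝ × Conf ℝ) :=
    ((π ⊗ₘ confKernel ℝ).restrict (Prod.snd ⁻¹' Ioc a b)).map Prod.swap
  let M₂ : Measure (ℝ × Conf ℝ) := (volume.restrict (Ioc a b)).prod π
  have hM₁ : ∀ E : Set (ℝ × Conf ℝ), MeasurableSet E → M₁ E =
      ∫⁻ ω, confMeasure (T ω) ({τ | (τ, T ω) ∈ E} ∩ Ioc a b) ∂Q := by
    intro E hE
    have hE' := measurable_swap hE
    rw [Measure.map_apply measurable_swap hE, Measure.restrict_apply hE',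
      Measure.compProd_apply (hE'.inter (measurable_snd measurableSet_Ioc)),
      lintegral_map (Kernel.measurable_kernel_prodMk_left
        (hE'.inter (measurable_snd measurableSet_Ioc))) hT.measurable]
    rfl
  have hM₂ : ∀ E : Set (ℝ × Conf ℝ), MeasurableSet E → M₂ E =
      ∫⁻ u in Ioc a b, Q {ω | (u, T ω) ∈ E} := by
    intro E hE
    rw [Measure.prod_apply hE]
    refine lintegral_congr fun u => ?_
    rw [Measure.map_apply hT.measurable (measurable_prodMk_left hE)]
    rfl
  -- Predictable rectangles: the time lies in `(c, e]` and the event concerns the configuration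
  -- before `c` only. Here independence of disjoint sets applies.
  let rects : Set (Set (ℝ × Conf ℝ)) := {E | ∃ (c e : ℝ) (F : Finset (Set ℝ)) (N₀ : Conf ℝ),
    (∀ B ∈ F, Bornology.IsBounded B) ∧ (∀ B ∈ F, MeasurableSet B) ∧ (∀ B ∈ F, B ⊆ Iio c) ∧
    E = Ioc c e ×ˢ countEvent F N₀}
  have hrectsm : ∀ E ∈ rects, MeasurableSet E := by
    rintro _ ⟨c, e, F, N₀, hb, hm, -, rfl⟩
    exact measurableSet_Ioc.prod (measurableSet_countEvent hb hm N₀)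
  have hrectsπ : IsPiSystem rects := by
    rintro _ ⟨c, e, F, N₀, hb, hm, hc, rfl⟩ _ ⟨c', e', F', N₀', hb', hm', hc', rfl⟩ ⟨⟨u, N₁⟩, h⟩
    refine ⟨c ⊔ c', e ⊓ e', F ∪ F', N₁, fun B hB => ?_, fun B hB => ?_, fun B hB => ?_, ?_⟩
    · exact (Finset.mem_union.1 hB).elim (hb B) (hb' B)
    · exact (Finset.mem_union.1 hB).elim (hm B) (hm' B)
    · rcases Finset.mem_union.1 hB with hB | hB
      · exact (hc B hB).trans (Iio_subset_Iio le_sup_left)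
      · exact (hc' B hB).trans (Iio_subset_Iio le_sup_right)
    · rw [prod_inter_prod, Ioc_inter_Ioc, countEvent_inter ⟨h.1.2, h.2.2⟩]
  have hrectseq : ∀ E ∈ rects, M₁ E = M₂ E := by
    intro E hE
    have hEm := hrectsm E hE
    obtain ⟨c, e, F, N₀, hb, hm, hc, rfl⟩ := hE
    rw [hM₁ _ hEm, hM₂ _ hEm]
    have hI := hT.lintegral_confMeasure_mul_countEvent hb hm N₀ (I := Ioc c e ∩ Ioc a b)
      ((Metric.isBounded_Ioc a b).subset inter_subset_right)
      (measurableSet_Ioc.inter measurableSet_Ioc)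
      fun B hB => Set.disjoint_left.2 fun x hx hxB =>
        absurd (hc B hB hxB : x < c) (not_lt.2 hx.1.1.le)
    calc _ = _ := ?_
      _ = _ := hI
      _ = _ := ?_
    · refine lintegral_congr fun ω => ?_
      by_cases h : T ω ∈ countEvent F N₀
      · rw [indicator_of_mem (show ω ∈ T ⁻¹' countEvent F N₀ from h)]
        congr 1
        ext τ; simp [h]
      · rw [indicator_of_notMem (show ω ∉ T ⁻¹' countEvent F N₀ from h)]
        convert measure_empty (μ := confMeasure (T ω))
        ext τ; simp [h]
    · have : ∀ u, Q {ω | (u, T ω) ∈ Ioc c e ×ˢ countEvent F N₀} =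
          (Ioc c e).indicator (fun _ => Q (T ⁻¹' countEvent F N₀)) u := by
        intro u
        by_cases h : u ∈ Ioc c e
        · rw [indicator_of_mem h]
          congr 1
          ext ω
          exact ⟨fun hω => hω.2, fun hω => ⟨h, hω⟩⟩
        · rw [indicator_of_notMem h]
          convert measure_empty (μ := Q)
          exact eq_empty_iff_forall_notMem.2 fun ω hω => h hω.1
      simp_rw [this]
      rw [lintegral_indicator measurableSet_Ioc, lintegral_const, Measure.restrict_apply_univ,
        Measure.restrict_apply measurableSet_Ioc, mul_comm]
  have huniv : M₁ univ = M₂ univ := by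
    rw [hM₁ _ MeasurableSet.univ, hM₂ _ MeasurableSet.univ]
    simp only [mem_univ, ofPred_true, univ_inter, measure_univ, lintegral_one,
      Measure.restrict_apply_univ]
    exact hT.lintegral_confMeasure (Metric.isBounded_Ioc a b) measurableSet_Ioc
  have : IsFiniteMeasure M₁ := by
    refine ⟨?_⟩
    rw [huniv, hM₂ _ MeasurableSet.univ]
    simp
  let φ : ℝ × Conf ℝ → ℝ × Conf ℝ := fun p => (p.1, cut p.1 p.2)
  have hφ : Measurable φ := measurable_fst.prodMk (measurable_cut measurable_snd measurable_fst)
  -- The pair of the time and the strict past is measurable for the σ-algebra of the rectangles, so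
  -- agreement on rectangles yields equality of the images of `M₁` and `M₂` under `φ`.
  have hφrects : Measurable[MeasurableSpace.generateFrom rects] φ := by
    have hempty : ∀ N₀ : Conf ℝ, countEvent ∅ N₀ = univ := fun N₀ => by
      ext; simp [countEvent]
    have hfst : Measurable[MeasurableSpace.generateFrom rects] fun p : ℝ × Conf ℝ => p.1 := by
      have hb : (inferInstance : MeasurableSpace ℝ) =
          MeasurableSpace.generateFrom {S : Set ℝ | ∃ l u : ℝ, l < u ∧ Ioc l u = S} :=
        (BorelSpace.measurable_eq (α := ℝ)).trans (borel_eq_generateFrom_Ioc ℝ)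
      change @Measurable _ _ (MeasurableSpace.generateFrom rects) (inferInstance : MeasurableSpace ℝ) _
      rw [hb]
      refine @measurable_generateFrom _ _ (MeasurableSpace.generateFrom rects) _ _ ?_
      rintro _ ⟨l, u, -, rfl⟩
      obtain ⟨N₀⟩ : Nonempty (Conf ℝ) := ⟨⟨∅, fun B _ => by simp⟩⟩
      refine MeasurableSpace.measurableSet_generateFrom
        ⟨l, u, ∅, N₀, by simp, by simp, by simp, ?_⟩
      ext p; simp [hempty]
    have hsnd : Measurable[MeasurableSpace.generateFrom rects]
        fun p : ℝ × Conf ℝ => cut p.1 p.2 := by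
      refine @measurable_generateFrom _ _ (MeasurableSpace.generateFrom rects) _ _ ?_
      rintro _ ⟨B, k, hB, hBm, rfl⟩
      -- `l n u` is the largest multiple of `1 / (n + 1)` strictly below `u`. It is constant on
      -- half-open grid intervals, so counting before `l n u` uses rectangles only; as `n` grows, no
      -- point of `B` before `u` is missed.
      let l : ℕ → ℝ → ℝ := fun n u => (⌈(n + 1) * u⌉ - 1) / (n + 1)
      have hl : ∀ n u, l n u < u := by
        intro n u
        have := Int.ceil_lt_add_one ((n + 1 : ℝ) * u)
        rw [div_lt_iff₀ (by positivity)]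
        linarith
      have hl' : ∀ n u, u - 1 / (n + 1) ≤ l n u := by
        intro n u
        have := Int.le_ceil ((n + 1 : ℝ) * u)
        have hn : (0 : ℝ) < n + 1 := by positivity
        rw [le_div_iff₀ hn, sub_mul, div_mul_cancel₀ _ hn.ne']
        linarith
      have hn : ∀ n : ℕ, Measurable[MeasurableSpace.generateFrom rects]
          fun p : ℝ × Conf ℝ => count (B ∩ Iio (l n p.1)) p.2 := by
        intro n
        refine @measurable_to_countable' _ _ _ _ (MeasurableSpace.generateFrom rects) _ fun k => ?_
        have hn : (0 : ℝ) < n + 1 := by positivity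
        have he : (fun p : ℝ × Conf ℝ => count (B ∩ Iio (l n p.1)) p.2) ⁻¹' {k} =
            ⋃ j : ℤ, Ioc ((j : ℝ) / (n + 1)) ((j + 1) / (n + 1)) ×ˢ
              {N : Conf ℝ | count (B ∩ Iio ((j : ℝ) / (n + 1))) N = k} := by
          ext ⟨u, N⟩
          simp only [mem_preimage, mem_singleton_iff, mem_iUnion, mem_prod, mem_ofPred_eq]
          have hj : ∀ j : ℤ, u ∈ Ioc ((j : ℝ) / (n + 1)) ((j + 1) / (n + 1)) ↔
              ⌈(n + 1 : ℝ) * u⌉ = j + 1 := by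
            intro j
            rw [Int.ceil_eq_iff, mem_Ioc, div_lt_iff₀ hn, le_div_iff₀ hn, mul_comm u]
            push_cast
            rw [add_sub_cancel_right]
          simp only [hj]
          constructor
          · intro h
            refine ⟨⌈(n + 1 : ℝ) * u⌉ - 1, by ring, ?_⟩
            push_cast
            exact h
          · rintro ⟨j, hj1, hj2⟩
            simp only [l, hj1]
            push_cast
            rwa [add_sub_cancel_right]
        rw [he]
        refine @MeasurableSet.iUnion _ _ (MeasurableSpace.generateFrom rects) _ _ fun j => ?_
        by_cases h : ∃ N₀ : Conf ℝ, count (B ∩ Iio ((j : ℝ) / (n + 1))) N₀ = k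
        · obtain ⟨N₀, hN₀⟩ := h
          refine MeasurableSpace.measurableSet_generateFrom ⟨(j : ℝ) / (n + 1), (j + 1) / (n + 1),
            {B ∩ Iio ((j : ℝ) / (n + 1))}, N₀, ?_, ?_, ?_, ?_⟩
          · simpa using hB.subset inter_subset_left
          · simpa using hBm.inter measurableSet_Iio
          · simp
          · congr 1
            ext N; simp [countEvent, hN₀]
        · convert @MeasurableSet.empty _ (MeasurableSpace.generateFrom rects)
          ext ⟨u, N⟩
          simp only [mem_prod, mem_ofPred_eq, mem_empty_iff_false, iff_false, not_and]
          exact fun _ hN => h ⟨N, hN⟩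
      have hlim : Measurable[MeasurableSpace.generateFrom rects]
          fun p : ℝ × Conf ℝ => count B (cut p.1 p.2) := by
        refine @measurable_of_tendsto_metrizable _ _ (MeasurableSpace.generateFrom rects) _ _ _ _
          _ _ hn (tendsto_pi_nhds.2 fun p => ?_)
        have hfin := p.2.2 B hB
        have hev : ∀ᶠ n : ℕ in atTop, ∀ x ∈ hfin.toFinset, x < p.1 → x < l n p.1 := by
          rw [Finset.eventually_all]
          intro x _
          by_cases hx : x < p.1
          · have h1 : Tendsto (fun n : ℕ => p.1 - 1 / ((n : ℝ) + 1)) atTop (𝓝 p.1) := by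
              simpa using (tendsto_const_nhds (x := p.1)).sub
                tendsto_one_div_add_atTop_nhds_zero_nat
            filter_upwards [h1.eventually (lt_mem_nhds hx)] with n hn _
            exact hn.trans_le (hl' n p.1)
          · exact Eventually.of_forall fun n h => absurd h hx
        refine tendsto_const_nhds.congr' ?_
        filter_upwards [hev] with n hn
        rw [count_cut]
        unfold count
        congr 1
        ext x
        simp only [mem_inter_iff, mem_Iio]
        constructor
        · rintro ⟨hx, hxB, hxu⟩
          exact ⟨hx, hxB, hn x (by simpa using ⟨hx, hxB⟩) hxu⟩
        · rintro ⟨hx, hxB, hxu⟩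
          exact ⟨hx, hxB, hxu.trans (hl n p.1)⟩
      exact hlim (measurableSet_singleton k)
    exact @Measurable.prodMk (ℝ × Conf ℝ) (MeasurableSpace.generateFrom rects) _ _ _ _ _ _ hfst hsnd
  have hmap : M₁.map φ = M₂.map φ := by
    ext E hE
    rw [Measure.map_apply hφ hE, Measure.map_apply hφ hE]
    exact ext_on_measurableSpace_of_generate_finite _ rects hrectseq
      (MeasurableSpace.generateFrom_le hrectsm) rfl hrectsπ huniv (hφrects hE)
  have h1 : ∫⁻ p, G p.1 p.2 ∂(M₁.map φ) =
      ∫⁻ ω, ∫⁻ τ in Ioc a b, G τ (cut τ (T ω)) ∂(confMeasure (T ω)) ∂Q := by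
    have hGφ : Measurable fun p : ℝ × Conf ℝ => G p.1 (cut p.1 p.2) := hG.comp hφ
    rw [lintegral_map hG hφ]
    change ∫⁻ p, G p.1 (cut p.1 p.2) ∂M₁ = _
    have hGs : Measurable fun p : Conf ℝ × ℝ => G p.2 (cut p.2 p.1) := hGφ.comp measurable_swap
    rw [lintegral_map hGφ measurable_swap]
    change ∫⁻ p, (fun p : Conf ℝ × ℝ => G p.2 (cut p.2 p.1)) p ∂_ = _
    rw [← lintegral_indicator (measurable_snd measurableSet_Ioc), Measure.lintegral_compProd
      (hGs.indicator (measurable_snd measurableSet_Ioc)), lintegral_map _ hT.measurable]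
    · refine lintegral_congr fun ω => ?_
      rw [← lintegral_indicator measurableSet_Ioc]
      rfl
    · exact (hGs.indicator (measurable_snd measurableSet_Ioc)).lintegral_kernel_prod_right'
  have h2 : ∫⁻ p, G p.1 p.2 ∂(M₂.map φ) =
      ∫⁻ u in Ioc a b, ∫⁻ ω, G u (cut u (T ω)) ∂Q := by
    have hGφ : Measurable fun p : ℝ × Conf ℝ => G p.1 (cut p.1 p.2) := hG.comp hφ
    rw [lintegral_map hG hφ]
    change ∫⁻ p, G p.1 (cut p.1 p.2) ∂M₂ = _
    rw [lintegral_prod _ hGφ.aemeasurable]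
    refine lintegral_congr fun u => ?_
    exact lintegral_map (hGφ.comp measurable_prodMk_left) hT.measurable
  rw [← h1, ← h2, hmap]

end Poisson

end Harness

namespace Harness

/-! ### The backward walk on a locally finite graph -/

/-- Clocks are locally finite, so none rings immediately after `t`. This later replaces arbitrary
times by rational ones. -/
theorem eventually_epochs_eq (N : Conf ℝ) (t : ℝ) :
    ∀ᶠ q in 𝓝[>] t, epochs N q = epochs N t := by
  have hfin : ((N : Set ℝ) ∩ Ioc t (t + 1)).Finite := N.2 _ (Metric.isBounded_Ioc t (t + 1))
  have h1 : ∀ᶠ q in 𝓝[>] t, ∀ x ∈ hfin.toFinset, q < x := by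
    rw [Finset.eventually_all]
    intro x hx
    have hx' : t < x := by
      have := (hfin.mem_toFinset.1 hx).2.1
      exact this
    exact mem_nhdsWithin_of_mem_nhds (gt_mem_nhds hx')
  have h2 : ∀ᶠ q in 𝓝[>] t, q < t + 1 :=
    mem_nhdsWithin_of_mem_nhds (gt_mem_nhds (lt_add_one t))
  filter_upwards [h1, h2, self_mem_nhdsWithin] with q hq1 hq2 hq3
  ext x
  constructor
  · rintro ⟨hx, hx0, hxq⟩
    refine ⟨hx, hx0, ?_⟩
    by_contra hxt
    exact absurd (hq1 x (by simpa using ⟨hx, not_le.1 hxt, hxq.trans hq2.le⟩)) (not_lt.2 hxq)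
  · rintro ⟨hx, hx0, hxt⟩
    exact ⟨hx, hx0, hxt.trans (le_of_lt hq3)⟩

theorem exists_rat_of_eventually_nhdsGT {p : ℝ → Prop} {t : ℝ} (h : ∀ᶠ q in 𝓝[>] t, p q) :
    ∃ q : ℚ, t < q ∧ p q := by
  obtain ⟨e, he, hsub⟩ := mem_nhdsGT_iff_exists_Ioo_subset.1 h
  obtain ⟨q, hq1, hq2⟩ := exists_rat_btwn (show t < e from he)
  exact ⟨q, hq1, hsub ⟨hq1, hq2⟩⟩

/-- The epoch at which the backward walk makes its first jump. -/
theorem sSup_epochs_mem {N : Conf ℝ} {t : ℝ} (h : epochs N t ≠ ∅) :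
    sSup (epochs N t) ∈ epochs N t :=
  (nonempty_iff_ne_empty.2 h).csSup_mem (epochs_finite N t)

theorem epochs_nonpos (N : Conf ℝ) {t : ℝ} (ht : t ≤ 0) : epochs N t = ∅ := by
  rw [eq_empty_iff_forall_notMem]
  rintro x ⟨-, h1, h2⟩
  exact absurd (h1.trans_le h2) (not_lt.2 ht)

section Graph

variable {V : Type*} (nb : V → Finset V)

/-- The average over the neighbours of a nonnegative function. -/
noncomputable def nbAvg (φ : V → ℝ≥0∞) (s : V) : ℝ≥0∞ :=
  ((nb s).card : ℝ≥0∞)⁻¹ * ∑ s' ∈ nb s, φ s'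

theorem nbAvg_mono {φ ψ : V → ℝ≥0∞} {s : V} (h : ∀ s' ∈ nb s, φ s' ≤ ψ s') :
    nbAvg nb φ s ≤ nbAvg nb ψ s := by
  unfold nbAvg
  gcongr with s' hs'
  exact h s' hs'

theorem nbAvg_congr {φ ψ : V → ℝ≥0∞} {s : V} (h : ∀ s' ∈ nb s, φ s' = ψ s') :
    nbAvg nb φ s = nbAvg nb ψ s := by
  unfold nbAvg
  rw [Finset.sum_congr rfl h]

theorem nbAvg_add (φ ψ : V → ℝ≥0∞) (s : V) :
    nbAvg nb (fun x => φ x + ψ x) s = nbAvg nb φ s + nbAvg nb ψ s := by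
  simp only [nbAvg, Finset.sum_add_distrib, mul_add]

theorem nbAvg_const_mul (c : ℝ≥0∞) (φ : V → ℝ≥0∞) (s : V) :
    nbAvg nb (fun x => c * φ x) s = c * nbAvg nb φ s := by
  simp only [nbAvg, ← Finset.mul_sum]
  ring

theorem nbAvg_tsum {ι : Type*} (φ : ι → V → ℝ≥0∞) (s : V) :
    nbAvg nb (fun x => ∑' i, φ i x) s = ∑' i, nbAvg nb (φ i) s := by
  simp only [nbAvg, ENNReal.tsum_mul_left]
  rw [Summable.tsum_finsetSum fun _ _ => ENNReal.summable]

theorem nbAvg_sum {ι : Type*} (F : Finset ι) (φ : ι → V → ℝ≥0∞) (s : V) :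
    nbAvg nb (fun x => ∑ i ∈ F, φ i x) s = ∑ i ∈ F, nbAvg nb (φ i) s := by
  simp only [nbAvg, ← Finset.mul_sum]
  rw [Finset.sum_comm]

/-- Only an inequality: at a point without neighbours the average is `⊤ * 0 = 0`, and the walk loses
its mass there. -/
theorem nbAvg_one_le (s : V) : nbAvg nb (fun _ => 1) s ≤ 1 := by
  simp only [nbAvg, Finset.sum_const, nsmul_eq_mul, mul_one]
  exact ENNReal.inv_mul_le_one _

theorem nbAvg_one {s : V} (hs : (nb s).Nonempty) : nbAvg nb (fun _ => 1) s = 1 := by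
  simp only [nbAvg, Finset.sum_const, nsmul_eq_mul, mul_one]
  exact ENNReal.inv_mul_cancel (by simpa using hs.ne_empty) (ENNReal.natCast_ne_top _)

theorem lintegral_nbAvg {α : Type*} [MeasurableSpace α] {μ : Measure α} {φ : V → α → ℝ≥0∞}
    (hφ : ∀ s, Measurable (φ s)) (s : V) :
    ∫⁻ a, nbAvg nb (fun x => φ x a) s ∂μ = nbAvg nb (fun x => ∫⁻ a, φ x a ∂μ) s := by
  simp only [nbAvg]
  rw [lintegral_const_mul _ (Finset.measurable_fun_sum _ fun i _ => hφ i),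
    lintegral_finsetSum _ fun i _ => hφ i]

theorem measurable_nbAvg {α : Type*} [MeasurableSpace α] {φ : V → α → ℝ≥0∞}
    (hφ : ∀ s, Measurable (φ s)) (s : V) : Measurable fun a => nbAvg nb (fun x => φ x a) s := by
  simp only [nbAvg]
  exact (Finset.measurable_fun_sum _ fun i _ => hφ i).const_mul _

open Classical in
/-- The probability that the backward walk makes `k` jumps and ends at `s'`. -/
noncomputable def graphWalk (N : V → Conf ℝ) : ℕ → V → ℝ → V → ℝ≥0∞
  | 0, s, t, s' => if epochs (N s) t = ∅ ∧ s = s' then 1 else 0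
  | k + 1, s, t, s' => if epochs (N s) t = ∅ then 0 else
      nbAvg nb (fun s'' => graphWalk N k s'' (sSup (epochs (N s) t)) s') s

/-- The transition probabilities of the backward walk. -/
noncomputable def graphTrans (N : V → Conf ℝ) (t : ℝ) (s s' : V) : ℝ≥0∞ :=
  ∑' k, graphWalk nb N k s t s'

/-- The harness process on the graph. -/
noncomputable def graphHarness (N : V → Conf ℝ) (γ : V → ℝ) (t : ℝ) (s : V) : ℝ :=
  ∑' s', (graphTrans nb N t s s').toReal * γ s'

variable {nb} {N : V → Conf ℝ}

theorem graphWalk_succ_of_eq_empty {s : V} {t : ℝ} (h : epochs (N s) t = ∅) (k : ℕ) (s' : V) :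
    graphWalk nb N (k + 1) s t s' = 0 := by
  rw [graphWalk, if_pos h]

theorem graphWalk_succ_of_ne_empty {s : V} {t : ℝ} (h : epochs (N s) t ≠ ∅) (k : ℕ) (s' : V) :
    graphWalk nb N (k + 1) s t s' =
      nbAvg nb (fun s'' => graphWalk nb N k s'' (sSup (epochs (N s) t)) s') s := by
  rw [graphWalk, if_neg h]

theorem graphWalk_zero_of_ne_empty {s : V} {t : ℝ} (h : epochs (N s) t ≠ ∅) (s' : V) :
    graphWalk nb N 0 s t s' = 0 := by
  rw [graphWalk, if_neg fun h' => h h'.1]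

open Classical in
theorem graphWalk_zero_of_eq_empty {s : V} {t : ℝ} (h : epochs (N s) t = ∅) (s' : V) :
    graphWalk nb N 0 s t s' = if s = s' then 1 else 0 := by
  rw [graphWalk]; simp [h]

open Classical in
theorem graphTrans_of_eq_empty {s : V} {t : ℝ} (h : epochs (N s) t = ∅) (s' : V) :
    graphTrans nb N t s s' = if s = s' then 1 else 0 := by
  rw [graphTrans, tsum_eq_zero_add' ENNReal.summable, graphWalk_zero_of_eq_empty h]
  simp [graphWalk_succ_of_eq_empty h]

theorem graphTrans_of_ne_empty {s : V} {t : ℝ} (h : epochs (N s) t ≠ ∅) (s' : V) :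
    graphTrans nb N t s s' =
      nbAvg nb (fun s'' => graphTrans nb N (sSup (epochs (N s) t)) s'' s') s := by
  rw [graphTrans, tsum_eq_zero_add' ENNReal.summable, graphWalk_zero_of_ne_empty h, zero_add]
  simp_rw [graphWalk_succ_of_ne_empty h, ← nbAvg_tsum]
  rfl

/-- The starting time enters only through the clock of the starting point, so heights are constant
between epochs of their own clock. -/
theorem graphWalk_congr_epochs {s : V} {t u : ℝ} (h : epochs (N s) t = epochs (N s) u) (k : ℕ)
    (s' : V) : graphWalk nb N k s t s' = graphWalk nb N k s u s' := by
  classical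
  cases k with
  | zero => exact if_congr (by rw [h]) rfl rfl
  | succ k =>
    by_cases he : epochs (N s) u = ∅
    · rw [graphWalk_succ_of_eq_empty he, graphWalk_succ_of_eq_empty (h.trans he)]
    · rw [graphWalk_succ_of_ne_empty he, graphWalk_succ_of_ne_empty (by rwa [h]), h]

theorem graphTrans_congr_epochs {s : V} {t u : ℝ} (h : epochs (N s) t = epochs (N s) u) (s' : V) :
    graphTrans nb N t s s' = graphTrans nb N u s s' :=
  tsum_congr fun k => graphWalk_congr_epochs h k s'

theorem graphHarness_congr_epochs {γ : V → ℝ} {s : V} {t u : ℝ}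
    (h : epochs (N s) t = epochs (N s) u) :
    graphHarness nb N γ t s = graphHarness nb N γ u s :=
  tsum_congr fun s' => by rw [graphTrans_congr_epochs h]

/-- The mass of the walk after exactly `k` jumps, weighted by `φ`. -/
noncomputable def walkMean (nb : V → Finset V) (N : V → Conf ℝ) (φ : V → ℝ≥0∞) (k : ℕ) (s : V)
    (t : ℝ) : ℝ≥0∞ := ∑' s', graphWalk nb N k s t s' * φ s'

theorem walkMean_succ_of_eq_empty {φ : V → ℝ≥0∞} {s : V} {t : ℝ} (h : epochs (N s) t = ∅)
    (k : ℕ) : walkMean nb N φ (k + 1) s t = 0 := by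
  simp [walkMean, graphWalk_succ_of_eq_empty h]

theorem walkMean_succ_of_ne_empty {φ : V → ℝ≥0∞} {s : V} {t : ℝ} (h : epochs (N s) t ≠ ∅)
    (k : ℕ) : walkMean nb N φ (k + 1) s t =
      nbAvg nb (fun s'' => walkMean nb N φ k s'' (sSup (epochs (N s) t))) s := by
  simp only [walkMean]
  rw [nbAvg_tsum]
  refine tsum_congr fun s' => ?_
  rw [graphWalk_succ_of_ne_empty h, mul_comm, ← nbAvg_const_mul]
  simp_rw [mul_comm]

theorem walkMean_zero_of_eq_empty {φ : V → ℝ≥0∞} {s : V} {t : ℝ} (h : epochs (N s) t = ∅) :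
    walkMean nb N φ 0 s t = φ s := by
  classical
  simp only [walkMean, graphWalk_zero_of_eq_empty h]
  rw [tsum_eq_single s]
  · simp
  · intro s' hs'
    rw [if_neg fun h => hs' h.symm, zero_mul]

theorem walkMean_zero_of_ne_empty {φ : V → ℝ≥0∞} {s : V} {t : ℝ} (h : epochs (N s) t ≠ ∅) :
    walkMean nb N φ 0 s t = 0 := by
  simp [walkMean, graphWalk_zero_of_ne_empty h]

theorem tsum_graphTrans_mul (φ : V → ℝ≥0∞) (s : V) (t : ℝ) :
    ∑' s', graphTrans nb N t s s' * φ s' = ∑' k, walkMean nb N φ k s t := by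
  simp only [graphTrans, walkMean, ← ENNReal.tsum_mul_right]
  exact ENNReal.tsum_comm

/-- Truncating the number of jumps permits an induction over the first jump, without knowing that
the walk terminates. -/
theorem sum_walkMean_one_le (K : ℕ) (s : V) (t : ℝ) :
    ∑ k ∈ Finset.range K, walkMean nb N (fun _ => 1) k s t ≤ 1 := by
  induction K generalizing s t with
  | zero => simp
  | succ K ih =>
    rw [Finset.sum_range_succ']
    by_cases h : epochs (N s) t = ∅
    · simp [walkMean_succ_of_eq_empty h, walkMean_zero_of_eq_empty h]
    · simp_rw [walkMean_succ_of_ne_empty h, walkMean_zero_of_ne_empty h, add_zero, ← nbAvg_sum]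
      exact (nbAvg_mono nb fun s' _ => ih s' _).trans (nbAvg_one_le nb s)

theorem tsum_walkMean_one_le (s : V) (t : ℝ) : ∑' k, walkMean nb N (fun _ => 1) k s t ≤ 1 := by
  rw [ENNReal.tsum_eq_iSup_nat]
  exact iSup_le fun K => sum_walkMean_one_le K s t

theorem tsum_graphTrans_le_one (s : V) (t : ℝ) : ∑' s', graphTrans nb N t s s' ≤ 1 := by
  have := tsum_graphTrans_mul (nb := nb) (N := N) (fun _ => 1) s t
  simp only [mul_one] at this
  rw [this]
  exact tsum_walkMean_one_le s t

theorem graphTrans_le_one (s s' : V) (t : ℝ) : graphTrans nb N t s s' ≤ 1 :=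
  (ENNReal.le_tsum s').trans (tsum_graphTrans_le_one s t)

theorem graphTrans_ne_top (s s' : V) (t : ℝ) : graphTrans nb N t s s' ≠ ⊤ :=
  ((graphTrans_le_one s s' t).trans_lt ENNReal.one_lt_top).ne

/-- The probability that the backward walk makes at least `K` jumps. -/
noncomputable def walkTail (nb : V → Finset V) (N : V → Conf ℝ) : ℕ → V → ℝ → ℝ≥0∞
  | 0, _, _ => 1
  | K + 1, s, t => (epochs (N s) t).indicator
      (fun τ => nbAvg nb (fun s'' => walkTail nb N K s'' τ) s) (sSup (epochs (N s) t))

theorem walkTail_succ_of_ne_empty {s : V} {t : ℝ} (h : epochs (N s) t ≠ ∅) (K : ℕ) :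
    walkTail nb N (K + 1) s t =
      nbAvg nb (fun s'' => walkTail nb N K s'' (sSup (epochs (N s) t))) s := by
  rw [walkTail, indicator_of_mem (sSup_epochs_mem h)]

theorem walkTail_succ_of_eq_empty {s : V} {t : ℝ} (h : epochs (N s) t = ∅) (K : ℕ) :
    walkTail nb N (K + 1) s t = 0 := by
  rw [walkTail, h, indicator_empty]

/-- By symmetry every point reached by a jump has a neighbour, so no mass is lost and only the walks
with at least `K` jumps are missing. -/
theorem sum_walkMean_add_walkTail (hsymm : ∀ s, ∀ s' ∈ nb s, s ∈ nb s') (K : ℕ) (s : V) (t : ℝ)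
    (hs : (nb s).Nonempty) :
    ∑ k ∈ Finset.range K, walkMean nb N (fun _ => 1) k s t + walkTail nb N K s t = 1 := by
  induction K generalizing s t with
  | zero => simp [walkTail]
  | succ K ih =>
    rw [Finset.sum_range_succ']
    by_cases h : epochs (N s) t = ∅
    · simp [walkMean_succ_of_eq_empty h, walkMean_zero_of_eq_empty h, walkTail_succ_of_eq_empty h]
    · simp_rw [walkMean_succ_of_ne_empty h, walkMean_zero_of_ne_empty h, add_zero, ← nbAvg_sum]
      rw [walkTail_succ_of_ne_empty h, ← nbAvg_add]
      refine Eq.trans ?_ (nbAvg_one nb hs)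
      exact nbAvg_congr nb fun s' hs' => ih s' _ ⟨s, hsymm s s' hs'⟩

/-! #### Dependence on the past -/

/-- The clocks up to, but not including, time `u`. -/
def cutAll (u : ℝ) (N : V → Conf ℝ) : V → Conf ℝ := fun s => cut u (N s)

theorem epochs_cut_of_lt {N : Conf ℝ} {u v : ℝ} (h : v < u) : epochs (cut u N) v = epochs N v := by
  ext x
  simp only [epochs, mem_ofPred_eq, mem_cut]
  constructor
  · rintro ⟨⟨h1, -⟩, h2⟩; exact ⟨h1, h2⟩
  · rintro ⟨h1, h2, h3⟩; exact ⟨⟨h1, h3.trans_lt h⟩, h2, h3⟩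

theorem epochs_cut_of_notMem {N : Conf ℝ} {u : ℝ} (h : u ∉ N) :
    epochs (cut u N) u = epochs N u := by
  ext x
  simp only [epochs, mem_ofPred_eq, mem_cut]
  constructor
  · rintro ⟨⟨h1, -⟩, h2⟩; exact ⟨h1, h2⟩
  · rintro ⟨h1, h2, h3⟩
    exact ⟨⟨h1, lt_of_le_of_ne h3 fun h' => h (h' ▸ h1)⟩, h2, h3⟩

theorem graphWalk_cutAll_of_lt {u v : ℝ} (h : v < u) (k : ℕ) (s s' : V) :
    graphWalk nb (cutAll u N) k s v s' = graphWalk nb N k s v s' := by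
  induction k generalizing s v with
  | zero =>
    classical
    exact if_congr (by rw [cutAll, epochs_cut_of_lt h]) rfl rfl
  | succ k ih =>
    by_cases he : epochs (N s) v = ∅
    · rw [graphWalk_succ_of_eq_empty he,
        graphWalk_succ_of_eq_empty (by rw [cutAll, epochs_cut_of_lt h, he])]
    · rw [graphWalk_succ_of_ne_empty he,
        graphWalk_succ_of_ne_empty (by rw [cutAll, epochs_cut_of_lt h]; exact he)]
      rw [cutAll, epochs_cut_of_lt h]
      exact nbAvg_congr nb fun s'' _ => ih ((sSup_epochs_mem he).2.2.trans_lt h) s''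

/-- The hypothesis concerns only the clock of the starting point. Taking `v < u` with no epoch in
between identifies the height just before `u` with the height at `v`. -/
theorem graphWalk_cutAll {u v : ℝ} {s : V} (h : epochs (cut u (N s)) u = epochs (N s) v) (k : ℕ)
    (s' : V) : graphWalk nb (cutAll u N) k s u s' = graphWalk nb N k s v s' := by
  cases k with
  | zero =>
    classical
    exact if_congr (by rw [cutAll, h]) rfl rfl
  | succ k =>
    by_cases he : epochs (N s) v = ∅
    · rw [graphWalk_succ_of_eq_empty he, graphWalk_succ_of_eq_empty (by rw [cutAll, h, he])]
    · rw [graphWalk_succ_of_ne_empty he,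
        graphWalk_succ_of_ne_empty (by rw [cutAll, h]; exact he)]
      have hlt : sSup (epochs (N s) v) < u := by
        have := sSup_epochs_mem he
        rw [← h] at this ⊢
        exact this.1.2
      rw [cutAll, h]
      exact nbAvg_congr nb fun s'' _ => graphWalk_cutAll_of_lt hlt k s'' s'

theorem graphWalk_cutAll_of_notMem {u : ℝ} {s : V} (h : u ∉ N s) (k : ℕ) (s' : V) :
    graphWalk nb (cutAll u N) k s u s' = graphWalk nb N k s u s' :=
  graphWalk_cutAll (epochs_cut_of_notMem h) k s'

theorem graphHarness_cutAll {γ : V → ℝ} {u v : ℝ} {s : V}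
    (h : epochs (cut u (N s)) u = epochs (N s) v) :
    graphHarness nb (cutAll u N) γ u s = graphHarness nb N γ v s :=
  tsum_congr fun s' => by
    simp only [graphTrans, graphWalk_cutAll h]

theorem graphHarness_cutAll_of_notMem {γ : V → ℝ} {u : ℝ} {s : V} (h : u ∉ N s) :
    graphHarness nb (cutAll u N) γ u s = graphHarness nb N γ u s :=
  graphHarness_cutAll (epochs_cut_of_notMem h)

theorem walkMean_cutAll_of_notMem {φ : V → ℝ≥0∞} {u : ℝ} {s : V} (h : u ∉ N s) (k : ℕ) :
    walkMean nb (cutAll u N) φ k s u = walkMean nb N φ k s u :=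
  tsum_congr fun s' => by rw [graphWalk_cutAll_of_notMem h]

theorem walkTail_cutAll_of_lt {u v : ℝ} (h : v < u) (K : ℕ) (s : V) :
    walkTail nb (cutAll u N) K s v = walkTail nb N K s v := by
  induction K generalizing s v with
  | zero => rfl
  | succ K ih =>
    by_cases he : epochs (N s) v = ∅
    · rw [walkTail_succ_of_eq_empty he,
        walkTail_succ_of_eq_empty (by rw [cutAll, epochs_cut_of_lt h, he])]
    · rw [walkTail_succ_of_ne_empty he,
        walkTail_succ_of_ne_empty (by rw [cutAll, epochs_cut_of_lt h]; exact he)]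
      rw [cutAll, epochs_cut_of_lt h]
      exact nbAvg_congr nb fun s'' _ => ih ((sSup_epochs_mem he).2.2.trans_lt h) s''

theorem walkTail_cutAll_of_notMem {u : ℝ} {s : V} (h : u ∉ N s) (K : ℕ) :
    walkTail nb (cutAll u N) K s u = walkTail nb N K s u := by
  cases K with
  | zero => rfl
  | succ K =>
    have hc := epochs_cut_of_notMem h
    by_cases he : epochs (N s) u = ∅
    · rw [walkTail_succ_of_eq_empty he, walkTail_succ_of_eq_empty (by rw [cutAll, hc, he])]
    · rw [walkTail_succ_of_ne_empty he,
        walkTail_succ_of_ne_empty (by rw [cutAll, hc]; exact he)]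
      have hlt : sSup (epochs (N s) u) < u := by
        have := sSup_epochs_mem he
        exact lt_of_le_of_ne this.2.2 fun h' => h (h' ▸ this.1)
      rw [cutAll, hc]
      exact nbAvg_congr nb fun s'' _ => walkTail_cutAll_of_lt hlt K s''

end Graph

end Harness

namespace Harness

/-! ### Independent clocks -/

section Clocks

variable {V : Type*} {π : Measure (Conf ℝ)} [IsProbabilityMeasure π]

/-- The law of a family of independent clocks with law `π`. -/
noncomputable def clockLaw (V : Type*) (π : Measure (Conf ℝ)) [IsProbabilityMeasure π] :
    Measure (V → Conf ℝ) := Measure.infinitePi fun _ => π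

instance : IsProbabilityMeasure (clockLaw V π) := by unfold clockLaw; infer_instance

/-- Resampling one clock independently does not change the product law; this is the form in which
one conditions on all the other clocks. -/
theorem clockLaw_map_update [DecidableEq V] (s : V) :
    ((clockLaw V π).prod π).map (fun p => Function.update p.1 s p.2) = clockLaw V π := by
  refine Measure.eq_infinitePi (fun _ => π) fun F t ht => ?_
  rw [Measure.map_apply measurable_update' (.pi F.countable_toSet fun i _ => ht i)]
  have hU : (fun p : (V → Conf ℝ) × Conf ℝ => Function.update p.1 s p.2) ⁻¹' (F : Set V).pi t =
      ((F.erase s : Finset V) : Set V).pi t ×ˢ (if s ∈ F then t s else univ) := by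
    ext ⟨N, C⟩
    simp only [mem_preimage, Set.mem_pi, Finset.mem_coe, mem_prod, Finset.mem_erase]
    constructor
    · intro h
      refine ⟨fun i hi => ?_, ?_⟩
      · have := h i hi.2
        rwa [Function.update_of_ne hi.1] at this
      · split_ifs with hs
        · have := h s hs
          rwa [Function.update_self] at this
        · trivial
    · rintro ⟨h1, h2⟩ i hi
      by_cases his : i = s
      · subst his
        rw [if_pos hi] at h2
        rwa [Function.update_self]
      · rw [Function.update_of_ne his]
        exact h1 i ⟨his, hi⟩
  rw [hU, Measure.prod_prod, clockLaw, Measure.infinitePi_pi _ fun i _ => ht i]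
  split_ifs with hs
  · exact Finset.prod_erase_mul F (fun i => π (t i)) hs
  · rw [measure_univ, mul_one, Finset.erase_eq_of_notMem hs]

theorem lintegral_clockLaw_update [DecidableEq V] (s : V) {f : (V → Conf ℝ) → ℝ≥0∞}
    (hf : Measurable f) :
    ∫⁻ N, f N ∂(clockLaw V π) =
      ∫⁻ N, ∫⁻ C, f (Function.update N s C) ∂π ∂(clockLaw V π) := by
  conv_lhs => rw [← clockLaw_map_update s]
  rw [lintegral_map hf measurable_update']
  exact lintegral_prod (fun p : (V → Conf ℝ) × Conf ℝ => f (Function.update p.1 s p.2))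
    (hf.comp measurable_update').aemeasurable

theorem measurable_cutAll {C : Type*} [MeasurableSpace C] {N : C → V → Conf ℝ}
    (hN : Measurable N) {u : C → ℝ} (hu : Measurable u) :
    Measurable fun c => cutAll (u c) (N c) :=
  measurable_pi_iff.2 fun s => measurable_cut ((measurable_pi_apply s).comp hN) hu

theorem cutAll_update [DecidableEq V] (u : ℝ) (N : V → Conf ℝ) (s : V) (C : Conf ℝ) :
    cutAll u (Function.update N s C) = Function.update (cutAll u N) s (cut u C) := by
  funext x
  by_cases h : x = s
  · subst h; simp [cutAll]
  · simp [cutAll, h]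

theorem measurable_lintegral_confMeasure {C : Type*} [MeasurableSpace C] {N : C → Conf ℝ}
    (hN : Measurable N) {g : C → ℝ → ℝ≥0∞} (hg : Measurable fun p : C × ℝ => g p.1 p.2)
    {B : Set ℝ} (hB : MeasurableSet B) :
    Measurable fun c => ∫⁻ τ in B, g c τ ∂(confMeasure (N c)) := by
  simp_rw [← lintegral_indicator hB]
  exact Measurable.lintegral_kernel_prod_right (κ := (confKernel ℝ).comap N hN)
    (f := fun c => B.indicator (g c)) (by
      have := hg.indicator (measurable_snd hB : MeasurableSet (Prod.snd ⁻¹' B : Set (C × ℝ)))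
      exact this)

/-- The mean of a sum over the epochs of a clock of a functional of the past of all clocks. -/
theorem lintegral_predictable_clockLaw (hπ : IsPoissonProcess id π) (s : V)
    {G : ℝ → (V → Conf ℝ) → ℝ≥0∞} (hG : Measurable fun p : ℝ × (V → Conf ℝ) => G p.1 p.2)
    (a b : ℝ) :
    ∫⁻ N, ∫⁻ τ in Ioc a b, G τ (cutAll τ N) ∂(confMeasure (N s)) ∂(clockLaw V π) =
      ∫⁻ u in Ioc a b, ∫⁻ N, G u (cutAll u N) ∂(clockLaw V π) := by
  classical
  have hGc : Measurable fun p : (V → Conf ℝ) × ℝ => G p.2 (cutAll p.2 p.1) :=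
    hG.comp (measurable_snd.prodMk (measurable_cutAll measurable_fst measurable_snd))
  have hGc' : ∀ u, Measurable fun N : V → Conf ℝ => G u (cutAll u N) := fun u =>
    hGc.comp measurable_prodMk_right
  -- With the clock of `s` resampled and the others frozen, the integrand is a functional of the
  -- time and of the past of a single Poisson process.
  rw [lintegral_clockLaw_update s
    (measurable_lintegral_confMeasure (measurable_pi_apply s) hGc measurableSet_Ioc)]
  have h1 : ∀ N : V → Conf ℝ,
      ∫⁻ C, ∫⁻ τ in Ioc a b, G τ (cutAll τ (Function.update N s C))
        ∂(confMeasure (Function.update N s C s)) ∂π =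
      ∫⁻ u in Ioc a b, ∫⁻ C, G u (cutAll u (Function.update N s C)) ∂π := by
    intro N
    have hG' : Measurable fun p : ℝ × Conf ℝ => G p.1 (Function.update (cutAll p.1 N) s p.2) :=
      hG.comp (measurable_fst.prodMk (measurable_update'.comp
        ((measurable_cutAll measurable_const measurable_fst).prodMk measurable_snd)))
    have := hπ.lintegral_predictable
      (G := fun u C => G u (Function.update (cutAll u N) s C)) hG' a b
    simp only [id] at this
    simp only [Function.update_self, cutAll_update]
    exact this
  simp_rw [h1]
  rw [lintegral_lintegral_swap]
  · refine lintegral_congr fun u => ?_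
    exact (lintegral_clockLaw_update s (hGc' u)).symm
  · have hm : Measurable fun p : ((V → Conf ℝ) × ℝ) × Conf ℝ =>
        G p.1.2 (cutAll p.1.2 (Function.update p.1.1 s p.2)) :=
      hGc.comp ((measurable_update'.comp ((measurable_fst.comp measurable_fst).prodMk
        measurable_snd)).prodMk (measurable_snd.comp measurable_fst))
    exact hm.lintegral_prod_right'.aemeasurable

theorem ae_notMem_clock (hπ : IsPoissonProcess id π) (s : V) (u : ℝ) :
    ∀ᵐ N ∂(clockLaw V π), u ∉ N s := by
  classical
  have hm : Measurable fun N : V → Conf ℝ => confMeasure (N s) {u} :=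
    (measurable_confMeasure_bounded Bornology.isBounded_singleton
      (measurableSet_singleton u)).comp (measurable_pi_apply s)
  have h : ∫⁻ N, confMeasure (N s) {u} ∂(clockLaw V π) = 0 := by
    rw [lintegral_clockLaw_update s hm]
    simp only [Function.update_self]
    have := hπ.lintegral_confMeasure (B := {u}) Bornology.isBounded_singleton
      (measurableSet_singleton u)
    simp only [id, Real.volume_singleton] at this
    simp [this]
  rw [lintegral_eq_zero_iff hm] at h
  filter_upwards [h] with N hN hu
  exact (confMeasure_eq_zero_iff (measurableSet_singleton u)).1 hN u hu rfl

/-- Given the clock of `s'`, its points form a Lebesgue null set, which an independent clock misses.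
The windows `(-m, m]` keep the sets bounded. -/
theorem ae_disjoint_clocks [Countable V] (hπ : IsPoissonProcess id π) :
    ∀ᵐ N ∂(clockLaw V π), ∀ s s', s ≠ s' → ∀ τ, τ ∈ N s → τ ∉ N s' := by
  classical
  rw [ae_all_iff]; intro s
  rw [ae_all_iff]; intro s'
  by_cases hne : s = s'
  · simp [hne]
  have h : ∀ m : ℕ, ∀ᵐ N ∂(clockLaw V π), ∀ τ, τ ∈ N s → τ ∉ (N s' : Set ℝ) ∩ Ioc (-m : ℝ) m := by
    intro m
    have hD : MeasurableSet {p : (V → Conf ℝ) × ℝ | p.2 ∈ p.1 s' ∧ p.2 ∈ Ioc (-m : ℝ) m} :=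
      (measurableSet_mem_conf ((measurable_pi_apply s').comp measurable_fst)
        measurable_snd).inter (measurable_snd measurableSet_Ioc)
    have hm := measurable_confMeasure_apply (N := fun N : V → Conf ℝ => N s)
      (measurable_pi_apply s) hD
    have h0 : ∫⁻ N, confMeasure (N s) (Prod.mk N ⁻¹'
        {p : (V → Conf ℝ) × ℝ | p.2 ∈ p.1 s' ∧ p.2 ∈ Ioc (-m : ℝ) m}) ∂(clockLaw V π) = 0 := by
      rw [lintegral_clockLaw_update s hm]
      have : ∀ N : V → Conf ℝ, ∫⁻ C, confMeasure (Function.update N s C s)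
          (Prod.mk (Function.update N s C) ⁻¹'
          {p : (V → Conf ℝ) × ℝ | p.2 ∈ p.1 s' ∧ p.2 ∈ Ioc (-m : ℝ) m}) ∂π = 0 := by
        intro N
        have h2 := hπ.lintegral_confMeasure (B := (N s' : Set ℝ) ∩ Ioc (-m : ℝ) m)
          ((Metric.isBounded_Ioc _ _).subset inter_subset_right)
          ((measurableSet_conf _).inter measurableSet_Ioc)
        rw [((N s').countable.mono inter_subset_left).measure_zero] at h2
        rw [← h2]
        refine lintegral_congr fun C => ?_
        rw [Function.update_self]
        congr 1
        ext τ
        simp only [mem_preimage, mem_ofPred_eq, mem_inter_iff, SetLike.mem_coe,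
          Function.update_of_ne (Ne.symm hne)]
      rw [lintegral_congr this, lintegral_zero]
    rw [lintegral_eq_zero_iff hm] at h0
    filter_upwards [h0] with N hN τ hτ hτ'
    exact (confMeasure_eq_zero_iff (measurable_prodMk_left hD)).1 hN τ hτ hτ'
  filter_upwards [ae_all_iff.2 h] with N hN _ τ hτ hτ'
  obtain ⟨m, hm⟩ := exists_nat_gt |τ|
  exact hN m τ hτ ⟨hτ', (abs_lt.1 hm).1, (abs_lt.1 hm).2.le⟩

end Clocks

/-! ### Measurability of the walk and of the harness process in the clocks and the time -/

section Measurability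

variable {V : Type*} (nb : V → Finset V)

theorem measurable_graphWalk {C : Type*} [MeasurableSpace C] {N : C → V → Conf ℝ}
    (hN : Measurable N) {t : C → ℝ} (ht : Measurable t) (k : ℕ) (s s' : V) :
    Measurable fun c => graphWalk nb (N c) k s (t c) s' := by
  classical
  induction k generalizing s t with
  | zero =>
    have h1 := measurableSet_epochs_eq_empty ((measurable_pi_apply s).comp hN) ht
    have h2 : MeasurableSet {c | epochs (N c s) (t c) = ∅ ∧ s = s'} :=
      h1.inter (MeasurableSet.const _)
    convert Measurable.ite h2 (measurable_const (a := (1 : ℝ≥0∞))) measurable_const using 2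
    rw [graphWalk]
  | succ k ih =>
    have h1 := measurableSet_epochs_eq_empty ((measurable_pi_apply s).comp hN) ht
    have h2 := measurable_sSup_epochs ((measurable_pi_apply s).comp hN) ht
    exact Measurable.ite h1 measurable_const (measurable_nbAvg nb (fun s'' => ih h2 s'') s)

theorem measurable_graphTrans {C : Type*} [MeasurableSpace C] {N : C → V → Conf ℝ}
    (hN : Measurable N) {t : C → ℝ} (ht : Measurable t) (s s' : V) :
    Measurable fun c => graphTrans nb (N c) (t c) s s' :=
  Measurable.tsum fun k => measurable_graphWalk nb hN ht k s s'

theorem measurable_walkMean [Countable V] {C : Type*} [MeasurableSpace C] {N : C → V → Conf ℝ}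
    (hN : Measurable N) {t : C → ℝ} (ht : Measurable t) (φ : V → ℝ≥0∞) (k : ℕ) (s : V) :
    Measurable fun c => walkMean nb (N c) φ k s (t c) :=
  Measurable.tsum fun s' => (measurable_graphWalk nb hN ht k s s').mul_const _

theorem measurable_walkTail {C : Type*} [MeasurableSpace C] {N : C → V → Conf ℝ}
    (hN : Measurable N) {t : C → ℝ} (ht : Measurable t) (k : ℕ) (s : V) :
    Measurable fun c => walkTail nb (N c) k s (t c) := by
  classical
  induction k generalizing s t with
  | zero => exact measurable_const
  | succ k ih =>
    have h1 := measurableSet_epochs_eq_empty ((measurable_pi_apply s).comp hN) ht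
    have h2 := measurable_sSup_epochs ((measurable_pi_apply s).comp hN) ht
    have he : (fun c => walkTail nb (N c) (k + 1) s (t c)) = fun c =>
        if epochs (N c s) (t c) = ∅ then 0 else
          nbAvg nb (fun x => walkTail nb (N c) k x (sSup (epochs (N c s) (t c)))) s := by
      funext c
      split_ifs with h
      · exact walkTail_succ_of_eq_empty h k
      · exact walkTail_succ_of_ne_empty h k
    rw [he]
    exact Measurable.ite h1 measurable_const (measurable_nbAvg nb (fun s'' => ih h2 s'') s)

theorem measurable_graphHarness [Countable V] {C : Type*} [MeasurableSpace C]
    {N : C → V → Conf ℝ} (hN : Measurable N) {t : C → ℝ} (ht : Measurable t) (γ : V → ℝ) (s : V) :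
    Measurable fun c => graphHarness nb (N c) γ (t c) s :=
  measurable_tsum_real fun s' =>
    (measurable_graphTrans nb hN ht s s').ennreal_toReal.mul_const _

end Measurability

/-! ### Mean bounds for the number of jumps and the displacement of the walk -/

section MeanBounds

variable {V : Type*} [Countable V] {π : Measure (Conf ℝ)} [IsProbabilityMeasure π]
  (nb : V → Finset V)

/-- The mean of a causal functional at the first jump of the backward walk. -/
theorem lintegral_first_jump_le (hπ : IsPoissonProcess id π) (hirr : ∀ s, s ∉ nb s)
    {X : V → ℝ → (V → Conf ℝ) → ℝ≥0∞}
    (hX : ∀ s, Measurable fun p : ℝ × (V → Conf ℝ) => X s p.1 p.2)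
    (hcausal : ∀ s t N, t ∉ N s → X s t (cutAll t N) = X s t N)
    {Y : ℝ → (V → Conf ℝ) → ℝ≥0∞} {s : V} (t : ℝ)
    (hY0 : ∀ N : V → Conf ℝ, epochs (N s) t = ∅ → Y t N = 0)
    (hY1 : ∀ N : V → Conf ℝ, epochs (N s) t ≠ ∅ →
      Y t N ≤ nbAvg nb (fun x => X x (sSup (epochs (N s) t)) N) s) :
    ∫⁻ N, Y t N ∂(clockLaw V π) ≤
      ∫⁻ u in Ioc 0 t, nbAvg nb (fun x => ∫⁻ N, X x u N ∂(clockLaw V π)) s := by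
  let G : ℝ → (V → Conf ℝ) → ℝ≥0∞ := fun τ N => nbAvg nb (fun x => X x τ N) s
  have hG : Measurable fun p : ℝ × (V → Conf ℝ) => G p.1 p.2 :=
    measurable_nbAvg nb (fun x => hX x) s
  -- The epoch of the first jump is one of the epochs in `(0, t]`; bounding its term by the sum over
  -- all of them gives a predictable sum. At that epoch no neighbour's clock rings, so causality
  -- allows the clocks to be cut.
  have h1 : ∫⁻ N, Y t N ∂(clockLaw V π) ≤
      ∫⁻ N, ∫⁻ τ in Ioc 0 t, G τ (cutAll τ N) ∂(confMeasure (N s)) ∂(clockLaw V π) := by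
    refine lintegral_mono_ae ?_
    filter_upwards [ae_disjoint_clocks (V := V) hπ] with N hN
    by_cases he : epochs (N s) t = ∅
    · rw [hY0 N he]; exact zero_le
    · have hm := sSup_epochs_mem he
      set σ := sSup (epochs (N s) t) with hσ
      have hmem : σ ∈ Ioc (0 : ℝ) t := hm.2
      calc Y t N ≤ G σ N := hY1 N he
        _ = G σ (cutAll σ N) := by
          refine nbAvg_congr nb fun x hx => (hcausal x σ N ?_).symm
          exact hN s x (fun h => hirr s (by rwa [← h] at hx)) σ hm.1
        _ = ∫⁻ τ in {σ}, G τ (cutAll τ N) ∂((confMeasure (N s)).restrict (Ioc 0 t)) := by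
          rw [Measure.restrict_restrict (measurableSet_singleton σ),
            inter_eq_left.2 (singleton_subset_iff.2 hmem), lintegral_singleton, confMeasure,
            Measure.restrict_apply (measurableSet_singleton σ),
            inter_eq_left.2 (singleton_subset_iff.2 hm.1), Measure.count_singleton, mul_one]
        _ ≤ _ := setLIntegral_le_lintegral _ _
  refine h1.trans (le_of_eq ?_)
  rw [lintegral_predictable_clockLaw hπ s hG]
  refine lintegral_congr fun u => ?_
  rw [← lintegral_nbAvg nb (φ := fun x N => X x u N)
    (fun x => (hX x).comp measurable_prodMk_left)]
  refine lintegral_congr_ae ?_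
  filter_upwards [ae_all_iff.2 fun x => ae_notMem_clock (V := V) hπ x u] with N hN
  exact nbAvg_congr nb fun x _ => hcausal x u N (hN x)

theorem lintegral_pow_div_factorial (k : ℕ) {t : ℝ} (ht : 0 ≤ t) :
    ∫⁻ u in Ioc 0 t, ENNReal.ofReal (u ^ k / k.factorial) =
      ENNReal.ofReal (t ^ (k + 1) / (k + 1).factorial) := by
  rw [← ofReal_integral_eq_lintegral_ofReal]
  · rw [← intervalIntegral.integral_of_le ht, intervalIntegral.integral_div, integral_pow,
      Nat.factorial_succ]
    congr 1
    push_cast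
    field_simp
    ring
  · exact ((by fun_prop : Continuous fun u : ℝ => u ^ k / k.factorial).integrableOn_Icc).mono_set
      Ioc_subset_Icc_self
  · filter_upwards [ae_restrict_mem measurableSet_Ioc] with u hu
    have := hu.1.le
    positivity

/-- Each jump costs one time integration, so `k` jumps give the volume of the simplex of ordered
jump times. -/
theorem lintegral_walkMean_one_le (hπ : IsPoissonProcess id π) (hirr : ∀ s, s ∉ nb s) (k : ℕ)
    (s : V) {t : ℝ} (ht : 0 ≤ t) :
    ∫⁻ N, walkMean nb N (fun _ => 1) k s t ∂(clockLaw V π) ≤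
      ENNReal.ofReal (t ^ k / k.factorial) := by
  induction k generalizing s t with
  | zero =>
    calc _ ≤ ∫⁻ _, 1 ∂(clockLaw V π) := lintegral_mono fun N => by
          simpa using sum_walkMean_one_le (nb := nb) (N := N) 1 s t
      _ = _ := by simp
  | succ k ih =>
    refine (lintegral_first_jump_le nb hπ hirr
      (X := fun s t N => walkMean nb N (fun _ => 1) k s t)
      (Y := fun t N => walkMean nb N (fun _ => 1) (k + 1) s t)
      (fun s => measurable_walkMean nb measurable_snd measurable_fst _ k s)
      (fun s t N h => walkMean_cutAll_of_notMem h k) t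
      (fun N h => walkMean_succ_of_eq_empty h k)
      (fun N h => (walkMean_succ_of_ne_empty h k).le)).trans ?_
    rw [← lintegral_pow_div_factorial k ht]
    refine lintegral_mono_ae ?_
    filter_upwards [ae_restrict_mem measurableSet_Ioc] with u hu
    calc _ ≤ nbAvg nb (fun _ => ENNReal.ofReal (u ^ k / k.factorial) * 1) s :=
          nbAvg_mono nb fun x _ => by rw [mul_one]; exact ih x hu.1.le
      _ ≤ _ := by
        rw [nbAvg_const_mul]
        exact mul_le_of_le_one_right' (nbAvg_one_le nb s)

theorem lintegral_walkTail_le (hπ : IsPoissonProcess id π) (hirr : ∀ s, s ∉ nb s) (k : ℕ)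
    (s : V) {t : ℝ} (ht : 0 ≤ t) :
    ∫⁻ N, walkTail nb N k s t ∂(clockLaw V π) ≤ ENNReal.ofReal (t ^ k / k.factorial) := by
  induction k generalizing s t with
  | zero => simp [walkTail]
  | succ k ih =>
    refine (lintegral_first_jump_le nb hπ hirr
      (X := fun s t N => walkTail nb N k s t)
      (Y := fun t N => walkTail nb N (k + 1) s t)
      (fun s => measurable_walkTail nb measurable_snd measurable_fst k s)
      (fun s t N h => walkTail_cutAll_of_notMem h k) t
      (fun N h => walkTail_succ_of_eq_empty h k)
      (fun N h => (walkTail_succ_of_ne_empty h k).le)).trans ?_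
    rw [← lintegral_pow_div_factorial k ht]
    refine lintegral_mono_ae ?_
    filter_upwards [ae_restrict_mem measurableSet_Ioc] with u hu
    calc _ ≤ nbAvg nb (fun _ => ENNReal.ofReal (u ^ k / k.factorial) * 1) s :=
          nbAvg_mono nb fun x _ => by rw [mul_one]; exact ih x hu.1.le
      _ ≤ _ := by
        rw [nbAvg_const_mul]
        exact mul_le_of_le_one_right' (nbAvg_one_le nb s)

/-- The backward walk almost surely makes finitely many jumps. -/
theorem ae_tsum_graphTrans_eq_one (hπ : IsPoissonProcess id π) (hirr : ∀ s, s ∉ nb s)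
    (hsymm : ∀ s, ∀ s' ∈ nb s, s ∈ nb s') {s : V} (hs : (nb s).Nonempty) {t : ℝ} (ht : 0 ≤ t) :
    ∀ᵐ N ∂(clockLaw V π), ∑' s', graphTrans nb N t s s' = 1 := by
  have hm : ∀ K, Measurable fun N : V → Conf ℝ => walkTail nb N K s t := fun K =>
    measurable_walkTail nb measurable_id measurable_const K s
  have h0 : ∫⁻ N, ⨅ K, walkTail nb N K s t ∂(clockLaw V π) = 0 := by
    refine le_antisymm (ge_of_tendsto' (x := atTop) (f := fun K : ℕ =>
      ENNReal.ofReal (t ^ K / K.factorial)) ?_ fun K => ?_) zero_le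
    · have := ENNReal.tendsto_ofReal (FloorSemiring.tendsto_pow_div_factorial_atTop t)
      rwa [ENNReal.ofReal_zero] at this
    · exact (lintegral_mono fun N => iInf_le _ K).trans (lintegral_walkTail_le nb hπ hirr K s ht)
  rw [lintegral_eq_zero_iff (Measurable.iInf hm)] at h0
  filter_upwards [h0] with N hN
  refine le_antisymm (tsum_graphTrans_le_one s t) ?_
  have hsum := tsum_graphTrans_mul (nb := nb) (N := N) (fun _ => 1) s t
  simp only [mul_one] at hsum
  rw [hsum]
  have h1 : ∀ K, 1 ≤ ∑' k, walkMean nb N (fun _ => 1) k s t + walkTail nb N K s t := by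
    intro K
    calc (1 : ℝ≥0∞) = _ := (sum_walkMean_add_walkTail hsymm K s t hs).symm
      _ ≤ _ := by
        gcongr
        exact ENNReal.sum_le_tsum _
  have h2 : 1 ≤ ⨅ K, (∑' k, walkMean nb N (fun _ => 1) k s t + walkTail nb N K s t) :=
    le_iInf h1
  rw [← ENNReal.add_iInf] at h2
  change (⨅ K, walkTail nb N K s t) = 0 at hN
  rwa [hN, add_zero] at h2

variable {nb}

/-- A bound of the mean square increment of `γ` along `k` steps of the walk. -/
noncomputable def stepBound (nb : V → Finset V) (γ : V → ℝ) : ℕ → V → ℝ≥0∞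
  | 0, _ => 0
  | k + 1, s => nbAvg nb (fun s' => 2 * ENNReal.ofReal ((γ s' - γ s) ^ 2) +
      2 * stepBound nb γ k s') s

theorem ofReal_sq_sub_le (a b c : ℝ) : ENNReal.ofReal ((a - c) ^ 2) ≤
    2 * ENNReal.ofReal ((b - c) ^ 2) + 2 * ENNReal.ofReal ((a - b) ^ 2) := by
  rw [show (2 : ℝ≥0∞) = ENNReal.ofReal 2 by simp, ← ENNReal.ofReal_mul zero_le_two,
    ← ENNReal.ofReal_mul zero_le_two, ← ENNReal.ofReal_add (by positivity) (by positivity)]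
  exact ENNReal.ofReal_le_ofReal (by nlinarith [sq_nonneg ((b - c) - (a - b))])

/-- The increment is split at the first jump by `(a + b)² ≤ 2a² + 2b²`, which is the recursion of
`stepBound`. The time factor `t ^ k / k!` separates from the graph, since one integration over the
jump time is done per step. -/
theorem lintegral_walkMean_sq_le (hπ : IsPoissonProcess id π) (hirr : ∀ s, s ∉ nb s) (γ : V → ℝ)
    (k : ℕ) (s : V) {t : ℝ} (ht : 0 ≤ t) :
    ∫⁻ N, walkMean nb N (fun x => ENNReal.ofReal ((γ x - γ s) ^ 2)) k s t ∂(clockLaw V π) ≤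
      ENNReal.ofReal (t ^ k / k.factorial) * stepBound nb γ k s := by
  induction k generalizing s t with
  | zero =>
    have : ∀ N : V → Conf ℝ,
        walkMean nb N (fun x => ENNReal.ofReal ((γ x - γ s) ^ 2)) 0 s t = 0 := by
      intro N
      by_cases h : epochs (N s) t = ∅
      · rw [walkMean_zero_of_eq_empty h]; simp
      · exact walkMean_zero_of_ne_empty h
    simp [this]
  | succ k ih =>
    let φ : V → V → ℝ≥0∞ := fun s x => ENNReal.ofReal ((γ x - γ s) ^ 2)
    let X : V → ℝ → (V → Conf ℝ) → ℝ≥0∞ := fun x u N =>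
      2 * φ s x * walkMean nb N (fun _ => 1) k x u + 2 * walkMean nb N (φ x) k x u
    have hmean : ∀ N x u, walkMean nb N (φ s) k x u ≤ X x u N := by
      intro N x u
      simp only [X, walkMean, mul_one]
      rw [← ENNReal.tsum_mul_left, ← ENNReal.tsum_mul_left, ← ENNReal.tsum_add]
      refine ENNReal.tsum_le_tsum fun y => ?_
      calc graphWalk nb N k x u y * φ s y
          ≤ graphWalk nb N k x u y * (2 * φ s x + 2 * φ x y) := by
            gcongr
            exact ofReal_sq_sub_le _ _ _
        _ = _ := by ring
    refine (lintegral_first_jump_le nb hπ hirr (X := X)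
      (Y := fun t N => walkMean nb N (φ s) (k + 1) s t)
      (fun x => ((measurable_walkMean nb measurable_snd measurable_fst _ k x).const_mul _).add
        ((measurable_walkMean nb measurable_snd measurable_fst _ k x).const_mul _))
      (fun x t N h => by simp only [X, walkMean_cutAll_of_notMem h k]) t
      (fun N h => walkMean_succ_of_eq_empty h k)
      (fun N h => (walkMean_succ_of_ne_empty h k).le.trans
        (nbAvg_mono nb fun x _ => hmean N x _))).trans ?_
    rw [← lintegral_pow_div_factorial k ht, ← lintegral_mul_const _ (by fun_prop)]
    refine lintegral_mono_ae ?_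
    filter_upwards [ae_restrict_mem measurableSet_Ioc] with u hu
    rw [stepBound, ← nbAvg_const_mul]
    refine nbAvg_mono nb fun x _ => ?_
    have hmw : ∀ φ : V → ℝ≥0∞, Measurable fun N : V → Conf ℝ => walkMean nb N φ k x u :=
      fun φ => measurable_walkMean nb measurable_id measurable_const φ k x
    simp only [X]
    rw [lintegral_add_left ((hmw _).const_mul _), lintegral_const_mul _ (hmw _),
      lintegral_const_mul _ (hmw _), mul_add]
    refine add_le_add ?_ ?_
    · rw [mul_comm]
      gcongr
      exact lintegral_walkMean_one_le nb hπ hirr k x hu.1.le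
    · rw [mul_left_comm]
      gcongr
      exact ih x hu.1.le

end MeanBounds

end Harness

namespace Harness

/-! ### Paths of the harness process on a graph -/

section Paths

variable {V : Type*} (nb : V → Finset V)

/-- The average over the neighbours. -/
noncomputable def nbMean (x : V → ℝ) (s : V) : ℝ :=
  ((nb s).card : ℝ)⁻¹ * ∑ s' ∈ nb s, x s'

open Classical in
/-- The surface after an update at `s`. -/
noncomputable def ring (x : V → ℝ) (s : V) : V → ℝ :=
  fun v => if v = s then nbMean nb x s else x v

theorem ring_self (x : V → ℝ) (s : V) : ring nb x s s = nbMean nb x s := if_pos rfl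

theorem ring_of_ne {x : V → ℝ} {s v : V} (h : v ≠ s) : ring nb x s v = x v := if_neg h

theorem measurable_nbMean (s : V) : Measurable fun x : V → ℝ => nbMean nb x s :=
  (Finset.measurable_fun_sum _ fun i _ => measurable_pi_apply i).const_mul _

theorem measurable_ring (s : V) : Measurable fun x : V → ℝ => ring nb x s := by
  refine measurable_pi_iff.2 fun v => ?_
  by_cases h : v = s
  · subst h; simp only [ring_self]; exact measurable_nbMean nb v
  · simp only [ring_of_ne nb h]; exact measurable_pi_apply v

/-- The almost sure properties of the clocks. -/
structure GoodPath (γ : V → ℝ) (N : V → Conf ℝ) : Prop where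
  finite : ∀ t s, ∑' s', graphTrans nb N t s s' * ENNReal.ofReal |γ s'| ≠ ⊤
  mass : ∀ t s, (nb s).Nonempty → ∑' s', graphTrans nb N t s s' = 1
  disjoint : ∀ s s', s ≠ s' → ∀ τ, τ ∈ N s → τ ∉ N s'

variable {nb} {γ : V → ℝ} {N : V → Conf ℝ}

theorem GoodPath.summable (h : GoodPath nb γ N) (t : ℝ) (s : V) :
    Summable fun s' => (graphTrans nb N t s s').toReal * γ s' := by
  have := ENNReal.summable_toReal (h.finite t s)
  refine Summable.of_abs (this.congr fun s' => ?_)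
  rw [ENNReal.toReal_mul, ENNReal.toReal_ofReal (abs_nonneg _), abs_mul,
    abs_of_nonneg ENNReal.toReal_nonneg]

theorem graphHarness_of_eq_empty {s : V} {t : ℝ} (h : epochs (N s) t = ∅) :
    graphHarness nb N γ t s = γ s := by
  classical
  simp only [graphHarness, graphTrans_of_eq_empty h]
  rw [tsum_eq_single s]
  · simp
  · intro s' hs'; simp [hs'.symm]

theorem toReal_nbAvg {φ : V → ℝ≥0∞} (hφ : ∀ x, φ x ≠ ⊤) (s : V) :
    (nbAvg nb φ s).toReal = nbMean nb (fun x => (φ x).toReal) s := by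
  simp only [nbAvg, nbMean, ENNReal.toReal_mul, ENNReal.toReal_inv, ENNReal.toReal_natCast]
  rw [ENNReal.toReal_sum fun x _ => hφ x]

theorem GoodPath.graphHarness_of_ne_empty (hN : GoodPath nb γ N) {s : V} {t : ℝ}
    (h : epochs (N s) t ≠ ∅) :
    graphHarness nb N γ t s =
      nbMean nb (graphHarness nb N γ (sSup (epochs (N s) t))) s := by
  have hs := fun s'' => hN.summable (sSup (epochs (N s) t)) s''
  simp only [graphHarness, nbMean]
  rw [← Summable.tsum_finsetSum fun s'' _ => hs s'', ← tsum_mul_left]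
  refine tsum_congr fun s' => ?_
  rw [graphTrans_of_ne_empty h, toReal_nbAvg fun x => graphTrans_ne_top _ _ _, nbMean, mul_assoc,
    Finset.sum_mul]

theorem sSup_epochs_of_mem {M : Conf ℝ} {τ : ℝ} (h : τ ∈ M) (h0 : 0 < τ) :
    epochs M τ ≠ ∅ ∧ sSup (epochs M τ) = τ := by
  have hτ : τ ∈ epochs M τ := ⟨h, h0, le_rfl⟩
  refine ⟨(nonempty_of_mem hτ).ne_empty, le_antisymm ?_ ?_⟩
  · exact csSup_le ⟨τ, hτ⟩ fun x hx => hx.2.2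
  · exact le_csSup (epochs_finite M τ).bddAbove hτ

/-- At an epoch the surface is updated. -/
theorem GoodPath.graphHarness_epoch (hN : GoodPath nb γ N) (hirr : ∀ s, s ∉ nb s) {s : V} {τ : ℝ}
    (hτ : τ ∈ N s) (h0 : 0 < τ) :
    graphHarness nb N γ τ = ring nb (graphHarness nb (cutAll τ N) γ τ) s := by
  -- No other clock rings at `τ`, so all heights except the one at `s` equal their values just
  -- before `τ`.
  have hne : ∀ v, v ≠ s → graphHarness nb (cutAll τ N) γ τ v = graphHarness nb N γ τ v :=
    fun v hv => graphHarness_cutAll_of_notMem (hN.disjoint s v hv.symm τ hτ)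
  obtain ⟨h1, h2⟩ := sSup_epochs_of_mem hτ h0
  funext v
  by_cases hv : v = s
  · subst hv
    rw [ring_self, hN.graphHarness_of_ne_empty h1, h2, nbMean, nbMean]
    congr 1
    exact Finset.sum_congr rfl fun x hx => (hne x fun h => hirr v (h ▸ hx)).symm
  · rw [ring_of_ne nb hv, hne v hv]

theorem lintegral_confMeasure_Ioc_of_singleton {M : Conf ℝ} {a b τ : ℝ}
    (h : (M : Set ℝ) ∩ Ioc a b = {τ}) (f : ℝ → ℝ≥0∞) :
    ∫⁻ x in Ioc a b, f x ∂(confMeasure M) = f τ := by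
  rw [confMeasure, Measure.restrict_restrict measurableSet_Ioc, inter_comm, h,
    lintegral_singleton, Measure.count_singleton, mul_one]

theorem lintegral_confMeasure_Ioc_of_empty {M : Conf ℝ} {a b : ℝ}
    (h : (M : Set ℝ) ∩ Ioc a b = ∅) (f : ℝ → ℝ≥0∞) :
    ∫⁻ x in Ioc a b, f x ∂(confMeasure M) = 0 := by
  rw [confMeasure, Measure.restrict_restrict measurableSet_Ioc, inter_comm, h,
    Measure.restrict_empty, lintegral_zero_measure]

theorem lintegral_confMeasure_Ioc_ne_top (M : Conf ℝ) (a b : ℝ) {f : ℝ → ℝ≥0∞}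
    (hf : ∀ x, f x ≠ ⊤) : ∫⁻ x in Ioc a b, f x ∂(confMeasure M) ≠ ⊤ := by
  have hfin : ((M : Set ℝ) ∩ Ioc a b).Finite := M.2 _ (Metric.isBounded_Ioc a b)
  rw [confMeasure, Measure.restrict_restrict measurableSet_Ioc, inter_comm, ← hfin.coe_toFinset,
    lintegral_finset]
  exact (ENNReal.sum_lt_top.2 fun x _ => by simpa using (hf x).lt_top).ne

theorem epochs_eq_of_inter_Ioc_eq_empty {M : Conf ℝ} {a b : ℝ} (hab : a ≤ b)
    (h : (M : Set ℝ) ∩ Ioc a b = ∅) : epochs M b = epochs M a := by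
  ext x
  constructor
  · rintro ⟨h1, h2, h3⟩
    refine ⟨h1, h2, not_lt.1 fun h4 => ?_⟩
    have : x ∈ (M : Set ℝ) ∩ Ioc a b := ⟨h1, h4, h3⟩
    rwa [h] at this
  · rintro ⟨h1, h2, h3⟩
    exact ⟨h1, h2, h3.trans hab⟩

/-- The evolution of a function of finitely many heights. -/
theorem GoodPath.evolution (hN : GoodPath nb γ N) (hirr : ∀ s, s ∉ nb s) {F : Finset V}
    {Z : (V → ℝ) → ℝ≥0∞} (hZ : ∀ x y : V → ℝ, (∀ v ∈ F, x v = y v) → Z x = Z y)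
    {a b : ℝ} (ha : 0 ≤ a) (hab : a ≤ b) :
    Z (graphHarness nb N γ b) +
      ∑ s ∈ F, ∫⁻ τ in Ioc a b, Z (graphHarness nb (cutAll τ N) γ τ) ∂(confMeasure (N s)) =
    Z (graphHarness nb N γ a) +
      ∑ s ∈ F, ∫⁻ τ in Ioc a b, Z (ring nb (graphHarness nb (cutAll τ N) γ τ) s)
        ∂(confMeasure (N s)) := by
  classical
  -- `Z` changes only at the finitely many epochs of points of `F`; the induction removes the last
  -- of them. Old values stand on the left and new values on the right, so nothing is subtracted.
  obtain ⟨C, hC⟩ : ∃ C : Finset ℝ, ∀ τ, τ ∈ C ↔ τ ∈ Ioc a b ∧ ∃ s ∈ F, τ ∈ N s := by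
    have hfin : (⋃ s ∈ F, (N s : Set ℝ) ∩ Ioc a b).Finite :=
      F.finite_toSet.biUnion fun s _ => (N s).2 _ (Metric.isBounded_Ioc a b)
    refine ⟨hfin.toFinset, fun τ => ?_⟩
    simp only [Finite.mem_toFinset, mem_iUnion, mem_inter_iff, SetLike.mem_coe, exists_prop]
    constructor
    · rintro ⟨s, hs, h1, h2⟩; exact ⟨h2, s, hs, h1⟩
    · rintro ⟨h2, s, hs, h1⟩; exact ⟨s, hs, h1, h2⟩
  induction C using Finset.induction_on_max generalizing b with
  | empty =>
    have he : ∀ s ∈ F, (N s : Set ℝ) ∩ Ioc a b = ∅ := by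
      intro s hs
      refine eq_empty_iff_forall_notMem.2 fun x hx => ?_
      exact absurd ((hC x).2 ⟨hx.2, s, hs, hx.1⟩) (Finset.notMem_empty x)
    rw [hZ (graphHarness nb N γ b) (graphHarness nb N γ a) fun v hv =>
      graphHarness_congr_epochs (epochs_eq_of_inter_Ioc_eq_empty hab (he v hv))]
    congr 1
    refine Finset.sum_congr rfl fun s hs => ?_
    rw [lintegral_confMeasure_Ioc_of_empty (he s hs), lintegral_confMeasure_Ioc_of_empty (he s hs)]
  | insert τ C hmax ih =>
    obtain ⟨hτ, s, hsF, hτs⟩ := (hC τ).1 (Finset.mem_insert_self τ C)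
    -- `v` separates the last epoch from all earlier ones, so on `F` the heights at `v` are the
    -- heights just before `τ`.
    obtain ⟨v, hav, hvτ, hvC⟩ : ∃ v, a ≤ v ∧ v < τ ∧ ∀ x ∈ C, x ≤ v := by
      refine ⟨(insert a C).max' (Finset.insert_nonempty _ _), ?_, ?_, ?_⟩
      · exact Finset.le_max' _ _ (Finset.mem_insert_self _ _)
      · refine (Finset.max'_lt_iff _ _).2 fun x hx => ?_
        rcases Finset.mem_insert.1 hx with rfl | hx
        · exact hτ.1
        · exact hmax x hx
      · exact fun x hx => Finset.le_max' _ _ (Finset.mem_insert_of_mem hx)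
    have hvb : v ≤ b := hvτ.le.trans hτ.2
    have hi : ∀ w ∈ F, (N w : Set ℝ) ∩ Ioc v b = if w = s then {τ} else ∅ := by
      intro w hw
      have hsub : ∀ x ∈ (N w : Set ℝ) ∩ Ioc v b, x = τ := by
        rintro x ⟨hx1, hx2⟩
        rcases Finset.mem_insert.1 ((hC x).2 ⟨⟨hav.trans_lt hx2.1, hx2.2⟩, w, hw, hx1⟩) with h | h
        · exact h
        · exact absurd (hvC x h) (not_le.2 hx2.1)
      split_ifs with hws
      · subst hws
        exact eq_singleton_iff_unique_mem.2 ⟨⟨hτs, hvτ, hτ.2⟩, hsub⟩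
      · refine eq_empty_iff_forall_notMem.2 fun x hx => ?_
        exact hN.disjoint s w (Ne.symm hws) τ hτs (hsub x hx ▸ hx.1)
    have hsplit : ∀ (w : V) (f : ℝ → ℝ≥0∞), w ∈ F → ∫⁻ x in Ioc a b, f x ∂(confMeasure (N w)) =
        ∫⁻ x in Ioc a v, f x ∂(confMeasure (N w)) + if w = s then f τ else 0 := by
      intro w f hw
      rw [← Ioc_union_Ioc_eq_Ioc hav hvb, lintegral_union measurableSet_Ioc
        (Ioc_disjoint_Ioc_of_le le_rfl)]
      congr 1
      have := hi w hw
      split_ifs with hws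
      · rw [if_pos hws] at this; exact lintegral_confMeasure_Ioc_of_singleton this f
      · rw [if_neg hws] at this; exact lintegral_confMeasure_Ioc_of_empty this f
    have hIH := ih hav fun x => ⟨fun hx =>
      have h := (hC x).1 (Finset.mem_insert_of_mem hx)
      ⟨⟨h.1.1, hvC x hx⟩, h.2⟩, fun hx => by
        rcases Finset.mem_insert.1 ((hC x).2 ⟨⟨hx.1.1, hx.1.2.trans hvb⟩, hx.2⟩) with h | h
        · exact absurd hx.1.2 (not_le.2 (h ▸ hvτ))
        · exact h⟩
    have hb : Z (graphHarness nb N γ b) = Z (ring nb (graphHarness nb (cutAll τ N) γ τ) s) := by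
      rw [← hN.graphHarness_epoch hirr hτs (ha.trans_lt hτ.1)]
      refine hZ _ _ fun w hw => graphHarness_congr_epochs
        (epochs_eq_of_inter_Ioc_eq_empty hτ.2 (eq_empty_iff_forall_notMem.2 fun x hx => ?_))
      have h1 : x ∈ (N w : Set ℝ) ∩ Ioc v b := ⟨hx.1, hvτ.trans hx.2.1, hx.2.2⟩
      rw [hi w hw] at h1
      split_ifs at h1
      · exact hx.2.1.ne' h1
      · exact h1
    have hv : Z (graphHarness nb N γ v) = Z (graphHarness nb (cutAll τ N) γ τ) := by
      refine hZ _ _ fun w hw => (graphHarness_cutAll ?_).symm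
      ext x
      constructor
      · rintro ⟨⟨h1, h2⟩, h3, h4⟩
        refine ⟨h1, h3, not_lt.1 fun h5 => ?_⟩
        have h6 : x ∈ (N w : Set ℝ) ∩ Ioc v b := ⟨h1, h5, h4.trans hτ.2⟩
        rw [hi w hw] at h6
        split_ifs at h6
        · exact h2.ne h6
        · exact h6
      · rintro ⟨h1, h2, h3⟩
        exact ⟨⟨h1, h3.trans_lt hvτ⟩, h2, h3.trans hvτ.le⟩
    rw [Finset.sum_congr rfl fun w hw => hsplit w _ hw,
      Finset.sum_congr rfl fun w hw => hsplit w (fun τ =>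
        Z (ring nb (graphHarness nb (cutAll τ N) γ τ) w)) hw,
      Finset.sum_add_distrib, Finset.sum_add_distrib, Finset.sum_ite_eq' F s,
      Finset.sum_ite_eq' F s (fun w => Z (ring nb (graphHarness nb (cutAll τ N) γ τ) w)),
      if_pos hsF, if_pos hsF, hb, ← add_assoc (Z (graphHarness nb N γ a)), ← hIH, hv]
    ring

/-- The old values of `Z` along the epochs have a finite sum and cancel from `GoodPath.evolution`,
so that only the bounds `Y` of the jumps remain. -/
theorem GoodPath.le_evolution (hN : GoodPath nb γ N) (hirr : ∀ s, s ∉ nb s) {F : Finset V}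
    {Z : (V → ℝ) → ℝ≥0∞} (hZ : ∀ x y : V → ℝ, (∀ v ∈ F, x v = y v) → Z x = Z y)
    (hfin : ∀ x, Z x ≠ ⊤) {Y : V → (V → ℝ) → ℝ≥0∞}
    (hY : ∀ s ∈ F, ∀ x, Z (ring nb x s) ≤ Z x + Y s x)
    (hYm : ∀ s, Measurable fun τ => Y s (graphHarness nb (cutAll τ N) γ τ))
    {a b : ℝ} (ha : 0 ≤ a) (hab : a ≤ b) :
    Z (graphHarness nb N γ b) ≤ Z (graphHarness nb N γ a) +
      ∑ s ∈ F, ∫⁻ τ in Ioc a b, Y s (graphHarness nb (cutAll τ N) γ τ) ∂(confMeasure (N s)) := by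
  have h := hN.evolution hirr hZ ha hab
  have htop : ∑ s ∈ F, ∫⁻ τ in Ioc a b, Z (graphHarness nb (cutAll τ N) γ τ)
      ∂(confMeasure (N s)) ≠ ⊤ := (ENNReal.sum_lt_top.2 fun s _ =>
    (lintegral_confMeasure_Ioc_ne_top _ _ _ fun τ => hfin _).lt_top).ne
  refine (ENNReal.add_le_add_iff_right htop).1 ?_
  rw [h, add_assoc, ← Finset.sum_add_distrib]
  gcongr with s hs
  rw [← lintegral_add_left (hYm s)]
  refine lintegral_mono fun τ => ?_
  rw [add_comm]
  exact hY s hs _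

theorem GoodPath.evolution_ge (hN : GoodPath nb γ N) (hirr : ∀ s, s ∉ nb s) {F : Finset V}
    {Z : (V → ℝ) → ℝ≥0∞} (hZ : ∀ x y : V → ℝ, (∀ v ∈ F, x v = y v) → Z x = Z y)
    (hfin : ∀ x, Z x ≠ ⊤) {Y : V → (V → ℝ) → ℝ≥0∞}
    (hY : ∀ s ∈ F, ∀ x, Z x ≤ Z (ring nb x s) + Y s x)
    (hYm : ∀ s, Measurable fun τ => Y s (graphHarness nb (cutAll τ N) γ τ))
    {a b : ℝ} (ha : 0 ≤ a) (hab : a ≤ b) :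
    Z (graphHarness nb N γ a) ≤ Z (graphHarness nb N γ b) +
      ∑ s ∈ F, ∫⁻ τ in Ioc a b, Y s (graphHarness nb (cutAll τ N) γ τ) ∂(confMeasure (N s)) := by
  have h := hN.evolution hirr hZ ha hab
  have htop : ∑ s ∈ F, ∫⁻ τ in Ioc a b, Z (ring nb (graphHarness nb (cutAll τ N) γ τ) s)
      ∂(confMeasure (N s)) ≠ ⊤ := (ENNReal.sum_lt_top.2 fun s _ =>
    (lintegral_confMeasure_Ioc_ne_top _ _ _ fun τ => hfin _).lt_top).ne
  refine (ENNReal.add_le_add_iff_right htop).1 ?_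
  rw [← h, add_assoc, ← Finset.sum_add_distrib]
  gcongr with s hs
  rw [← lintegral_add_left (hYm s)]
  refine lintegral_mono fun τ => ?_
  rw [add_comm]
  exact hY s hs _

/-- A surface with a constant added on each component of the graph. -/
theorem graphWalk_eq_zero_of_ne {δ : V → ℝ} (hδ : ∀ s, ∀ s' ∈ nb s, δ s' = δ s) (k : ℕ) {s s' : V}
    (t : ℝ) (h : δ s' ≠ δ s) : graphWalk nb N k s t s' = 0 := by
  classical
  induction k generalizing s t with
  | zero =>
    rw [graphWalk]
    refine if_neg ?_
    rintro ⟨-, rfl⟩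
    exact h rfl
  | succ k ih =>
    by_cases he : epochs (N s) t = ∅
    · exact graphWalk_succ_of_eq_empty he k s'
    · rw [graphWalk_succ_of_ne_empty he, nbAvg_congr nb (ψ := fun _ => 0 * 1) fun x hx => by
        rw [ih _ (by rwa [hδ s x hx]), zero_mul], nbAvg_const_mul, zero_mul]

theorem graphTrans_mul_const {δ : V → ℝ} (hδ : ∀ s, ∀ s' ∈ nb s, δ s' = δ s) (t : ℝ) (s s' : V) :
    (graphTrans nb N t s s').toReal * δ s' = (graphTrans nb N t s s').toReal * δ s := by
  by_cases h : δ s' = δ s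
  · rw [h]
  · have : graphTrans nb N t s s' = 0 := by
      simp [graphTrans, graphWalk_eq_zero_of_ne hδ _ t h]
    simp [this]

theorem GoodPath.hasSum_mass (hN : GoodPath nb γ N) (t : ℝ) {s : V} (hs : (nb s).Nonempty) :
    HasSum (fun s' => (graphTrans nb N t s s').toReal) 1 := by
  have h1 := hN.mass t s hs
  have h2 : Summable fun s' => (graphTrans nb N t s s').toReal :=
    ENNReal.summable_toReal (by rw [h1]; exact ENNReal.one_ne_top)
  have h3 := h2.hasSum
  rwa [← ENNReal.tsum_toReal_eq fun s' => graphTrans_ne_top _ _ _, h1, ENNReal.toReal_one] at h3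

/-- The walk never leaves its component and has total mass one, so `δ` is averaged to itself. This
is needed because only the gradient of the surface is covariant: two viewpoints give surfaces that
differ by such a `δ`. -/
theorem GoodPath.graphHarness_add (hN : GoodPath nb γ N) {δ : V → ℝ}
    (hδ : ∀ s, ∀ s' ∈ nb s, δ s' = δ s) (t : ℝ) {s : V} (hs : (nb s).Nonempty) :
    graphHarness nb N (fun x => γ x + δ x) t s = graphHarness nb N γ t s + δ s := by
  have h1 := (hN.summable t s).hasSum.add ((hN.hasSum_mass t hs).mul_right (δ s))
  rw [one_mul] at h1
  refine Eq.trans ?_ h1.tsum_eq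
  exact tsum_congr fun s' => by rw [mul_add, graphTrans_mul_const hδ]

/-- Jensen's inequality for the distribution of the backward walk. -/
theorem GoodPath.ofReal_sq_graphHarness_sub_le (hN : GoodPath nb γ N) (t : ℝ) {s : V}
    (hs : (nb s).Nonempty) (c : ℝ) :
    ENNReal.ofReal ((graphHarness nb N γ t s - c) ^ 2) ≤
      ∑' s', graphTrans nb N t s s' * ENNReal.ofReal ((γ s' - c) ^ 2) := by
  by_cases htop : ∑' s', graphTrans nb N t s s' * ENNReal.ofReal ((γ s' - c) ^ 2) = ⊤
  · rw [htop]; exact le_top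
  have hsq := ENNReal.summable_toReal htop
  simp only [ENNReal.toReal_mul, ENNReal.toReal_ofReal (sq_nonneg _)] at hsq
  have hm := hN.hasSum_mass t hs
  have h1 := (hN.summable t s).hasSum.sub (hm.mul_right c)
  change HasSum _ (graphHarness nb N γ t s - _) at h1
  rw [one_mul] at h1
  set m := graphHarness nb N γ t s - c with hmdef
  have h2 := (hsq.hasSum.sub (h1.mul_left (2 * m))).add (hm.mul_right (m ^ 2))
  -- The terms are `p * (γ - c - m)²`, whose sum, the variance, is the second moment about `c` minus
  -- `m²`.
  have h3 := h2.nonneg fun s' => by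
    have : 0 ≤ (graphTrans nb N t s s').toReal * (γ s' - c - m) ^ 2 :=
      mul_nonneg ENNReal.toReal_nonneg (sq_nonneg _)
    nlinarith
  have h4 : m ^ 2 ≤ ∑' s', (graphTrans nb N t s s').toReal * (γ s' - c) ^ 2 := by nlinarith
  refine (ENNReal.ofReal_le_ofReal h4).trans (le_of_eq ?_)
  rw [ENNReal.ofReal_tsum_of_nonneg (fun s' => mul_nonneg ENNReal.toReal_nonneg (sq_nonneg _)) hsq]
  refine tsum_congr fun s' => ?_
  rw [ENNReal.ofReal_mul ENNReal.toReal_nonneg, ENNReal.ofReal_toReal (graphTrans_ne_top _ _ _)]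

end Paths

/-! ### Almost sure properties of the clocks, simultaneously at all times -/

section AlmostSure

variable {V : Type*} [Countable V] {π : Measure (Conf ℝ)} [IsProbabilityMeasure π]
  {nb : V → Finset V} {γ : V → ℝ}

/-- A bound of the mean square displacement of the surface up to time `t`. -/
noncomputable def displacementBound (nb : V → Finset V) (γ : V → ℝ) (t : ℝ) (s : V) : ℝ≥0∞ :=
  ∑' k : ℕ, ENNReal.ofReal (t ^ k / k.factorial) * stepBound nb γ k s

theorem displacementBound_mono {t u : ℝ} (ht : 0 ≤ t) (htu : t ≤ u) (s : V) :
    displacementBound nb γ t s ≤ displacementBound nb γ u s := by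
  unfold displacementBound
  gcongr

theorem lintegral_tsum_graphTrans_sq_le (hπ : IsPoissonProcess id π) (hirr : ∀ s, s ∉ nb s)
    (s : V) {t : ℝ} (ht : 0 ≤ t) :
    ∫⁻ N, ∑' s', graphTrans nb N t s s' * ENNReal.ofReal ((γ s' - γ s) ^ 2) ∂(clockLaw V π) ≤
      displacementBound nb γ t s := by
  simp_rw [tsum_graphTrans_mul]
  have hm : ∀ k, Measurable fun N : V → Conf ℝ =>
      walkMean nb N (fun s' => ENNReal.ofReal ((γ s' - γ s) ^ 2)) k s t := fun k =>
    measurable_walkMean nb measurable_id measurable_const _ k s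
  rw [lintegral_tsum fun k => (hm k).aemeasurable]
  exact ENNReal.tsum_le_tsum fun k => lintegral_walkMean_sq_le hπ hirr γ k s ht

/-- The mean bounds hold at fixed times, hence almost surely at all rational times; every real time
has the same epochs at a given point as some later rational time, or as time `0` if it is negative.
-/
theorem ae_goodPath (hπ : IsPoissonProcess id π) (hirr : ∀ s, s ∉ nb s)
    (hsymm : ∀ s, ∀ s' ∈ nb s, s ∈ nb s')
    (hfin : ∀ s (n : ℕ), displacementBound nb γ n s ≠ ⊤) :
    ∀ᵐ N ∂(clockLaw V π), GoodPath nb γ N := by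
  have h1 : ∀ᵐ N ∂(clockLaw V π), ∀ (q : ℚ) (s : V), 0 ≤ (q : ℝ) →
      ∑' s', graphTrans nb N q s s' * ENNReal.ofReal ((γ s' - γ s) ^ 2) ≠ ⊤ := by
    refine ae_all_iff.2 fun q => ae_all_iff.2 fun s => ?_
    by_cases hq : 0 ≤ (q : ℝ)
    · have hm : Measurable fun N : V → Conf ℝ =>
          ∑' s', graphTrans nb N q s s' * ENNReal.ofReal ((γ s' - γ s) ^ 2) :=
        Measurable.tsum fun s' =>
          (measurable_graphTrans nb measurable_id measurable_const s s').mul_const _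
      have h := ae_lt_top hm (((lintegral_tsum_graphTrans_sq_le hπ hirr s hq).trans
        (displacementBound_mono hq (Nat.le_ceil _) s)).trans_lt (hfin s _).lt_top).ne
      filter_upwards [h] with N hN _ using hN.ne
    · simp [hq]
  have h2 : ∀ᵐ N ∂(clockLaw V π), ∀ (q : ℚ) (s : V), 0 ≤ (q : ℝ) → (nb s).Nonempty →
      ∑' s', graphTrans nb N q s s' = 1 := by
    refine ae_all_iff.2 fun q => ae_all_iff.2 fun s => ?_
    by_cases hq : 0 ≤ (q : ℝ)
    · by_cases hs : (nb s).Nonempty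
      · filter_upwards [ae_tsum_graphTrans_eq_one nb hπ hirr hsymm hs hq] with N hN _ _ using hN
      · simp [hs]
    · simp [hq]
  filter_upwards [h1, h2, ae_disjoint_clocks (V := V) hπ] with N hN1 hN2 hN3
  have key : ∀ (t : ℝ) (s : V), ∃ q : ℚ, 0 ≤ (q : ℝ) ∧ epochs (N s) t = epochs (N s) q := by
    intro t s
    by_cases ht : 0 ≤ t
    · obtain ⟨q, hq, he⟩ := exists_rat_of_eventually_nhdsGT (eventually_epochs_eq (N s) t)
      exact ⟨q, ht.trans hq.le, he.symm⟩
    · refine ⟨0, by simp, ?_⟩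
      rw [epochs_nonpos _ (not_le.1 ht).le, epochs_nonpos _ (by simp)]
  refine ⟨fun t s => ?_, fun t s hs => ?_, hN3⟩
  · obtain ⟨q, hq0, hq⟩ := key t s
    simp_rw [graphTrans_congr_epochs hq]
    -- Absolute convergence of the series follows from the mean square increment, because the walk
    -- has total mass at most one.
    have hle : ∀ s', ENNReal.ofReal |γ s'| ≤
        ENNReal.ofReal (|γ s| + 1) + ENNReal.ofReal ((γ s' - γ s) ^ 2) := by
      intro s'
      rw [← ENNReal.ofReal_add (by positivity) (by positivity)]
      refine ENNReal.ofReal_le_ofReal ?_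
      have h1 : |γ s'| ≤ |γ s| + |γ s' - γ s| := by
        have := abs_add_le (γ s) (γ s' - γ s)
        rwa [add_sub_cancel] at this
      have h2 : |γ s' - γ s| ≤ 1 + (γ s' - γ s) ^ 2 := by
        rw [← sq_abs (γ s' - γ s)]
        nlinarith [sq_nonneg (|γ s' - γ s| - 1), abs_nonneg (γ s' - γ s)]
      linarith
    refine ne_top_of_le_ne_top ?_ (ENNReal.tsum_le_tsum fun s' => mul_le_mul_right (hle s') _)
    simp_rw [mul_add]
    rw [ENNReal.tsum_add, ENNReal.tsum_mul_right]
    refine ENNReal.add_ne_top.2 ⟨ENNReal.mul_ne_top ?_ ENNReal.ofReal_ne_top, hN1 q s hq0⟩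
    exact ((tsum_graphTrans_le_one s q).trans_lt ENNReal.one_lt_top).ne
  · obtain ⟨q, hq0, hq⟩ := key t s
    simp_rw [graphTrans_congr_epochs hq]
    exact hN2 q s hq0 hs

end AlmostSure

end Harness

namespace Harness

/-! ### Mean evolution of the harness process on a graph -/

theorem tendsto_setLIntegral_Ioi_zero {μ : Measure ℝ} {f : ℝ → ℝ≥0∞}
    (h : ∫⁻ x in Ioi 0, f x ∂μ ≠ ⊤) :
    Tendsto (fun n : ℕ => ∫⁻ x in Ioi (n : ℝ), f x ∂μ) atTop (𝓝 0) := by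
  have h1 := tendsto_measure_iInter_atTop (μ := μ.withDensity f) (s := fun n : ℕ => Ioi (n : ℝ))
    (fun n => measurableSet_Ioi.nullMeasurableSet)
    (fun m n hmn => Ioi_subset_Ioi (by exact_mod_cast hmn))
    ⟨0, by rw [withDensity_apply _ measurableSet_Ioi]; simpa using h⟩
  have h2 : (⋂ n : ℕ, Ioi (n : ℝ)) = ∅ := by
    refine eq_empty_iff_forall_notMem.2 fun x hx => ?_
    obtain ⟨n, hn⟩ := exists_nat_gt x
    exact lt_asymm hn (mem_iInter.1 hx n)
  rw [h2, measure_empty] at h1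
  refine h1.congr fun n => ?_
  exact withDensity_apply _ measurableSet_Ioi

/-- Integrability makes `w` small at some late time, and the one-sided control keeps it small from
then on. -/
theorem tendsto_zero_of_le_add {w : ℝ → ℝ≥0∞} {U : ℕ → ℝ≥0∞} (hU : Tendsto U atTop (𝓝 0))
    (hw : ∀ (n : ℕ) (a b : ℝ), n ≤ a → a ≤ b → w b ≤ w a + U n)
    (hint : ∫⁻ t in Ioi 0, w t ≠ ⊤) : Tendsto w atTop (𝓝 0) := by
  refine ENNReal.tendsto_nhds_zero.2 fun ε hε => ?_
  have hε2 : 0 < ε / 2 := ENNReal.half_pos hε.ne'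
  obtain ⟨n, hn⟩ := (ENNReal.tendsto_nhds_zero.1 hU (ε / 2) hε2).exists
  obtain ⟨a, ha, hwa⟩ : ∃ a : ℝ, n ≤ a ∧ w a ≤ ε / 2 := by
    by_contra! hcon
    refine hint (eq_top_iff.2 ?_)
    calc (⊤ : ℝ≥0∞) = (ε / 2) * volume (Ioi (n : ℝ)) := by
          rw [Real.volume_Ioi, ENNReal.mul_top hε2.ne']
      _ = ∫⁻ _ in Ioi (n : ℝ), ε / 2 := by rw [setLIntegral_const]
      _ ≤ ∫⁻ t in Ioi (n : ℝ), w t :=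
        setLIntegral_mono' measurableSet_Ioi fun t ht => (hcon t (le_of_lt ht)).le
      _ ≤ _ := lintegral_mono_set (Ioi_subset_Ioi n.cast_nonneg)
  filter_upwards [eventually_ge_atTop a] with b hb
  calc w b ≤ w a + U n := hw n a b ha hb
    _ ≤ ε / 2 + ε / 2 := add_le_add hwa hn
    _ = ε := ENNReal.add_halves ε

theorem iUnion_Ioc_zero_natCast : (⋃ n : ℕ, Ioc (0 : ℝ) n) = Ioi 0 := by
  ext x
  simp only [mem_iUnion, mem_Ioc, mem_Ioi]
  constructor
  · rintro ⟨n, h, -⟩; exact h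
  · intro h
    obtain ⟨n, hn⟩ := exists_nat_ge x
    exact ⟨n, h, hn⟩

theorem monotone_Ioc_zero_natCast : Monotone fun n : ℕ => Ioc (0 : ℝ) n :=
  fun _ _ h => Ioc_subset_Ioc_right (by exact_mod_cast h)

theorem setLIntegral_Ioi_eq_iSup (μ : Measure ℝ) (f : ℝ → ℝ≥0∞) :
    ∫⁻ x in Ioi 0, f x ∂μ = ⨆ n : ℕ, ∫⁻ x in Ioc 0 (n : ℝ), f x ∂μ := by
  rw [← iUnion_Ioc_zero_natCast,
    setLIntegral_iUnion_of_directed f (monotone_Ioc_zero_natCast.directed_le)]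

/-! ### The normalized Laplacian and its changes under updates -/

section Disc

variable {V : Type*} (nb : V → Finset V)

/-- The normalized Laplacian. -/
noncomputable def disc (x : V → ℝ) (s : V) : ℝ :=
  ((nb s).card : ℝ)⁻¹ * ∑ s' ∈ nb s, (x s' - x s)

variable {nb}

theorem disc_eq {s : V} (hs : (nb s).Nonempty) (x : V → ℝ) : disc nb x s = nbMean nb x s - x s := by
  have : ((nb s).card : ℝ) ≠ 0 := by exact_mod_cast hs.card_ne_zero
  rw [disc, Finset.sum_sub_distrib, Finset.sum_const, nsmul_eq_mul, nbMean]
  field_simp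

theorem measurable_disc (s : V) : Measurable fun x : V → ℝ => disc nb x s :=
  (Finset.measurable_fun_sum _ fun i _ =>
    (measurable_pi_apply i).sub (measurable_pi_apply s)).const_mul _

theorem disc_ring_self (hirr : ∀ s, s ∉ nb s) (x : V → ℝ) (s : V) :
    disc nb (ring nb x s) s = 0 := by
  rcases (nb s).eq_empty_or_nonempty with h | h
  · simp [disc, h]
  · rw [disc_eq h, ring_self, nbMean, nbMean, Finset.sum_congr rfl fun v hv =>
      ring_of_ne nb (x := x) (ne_of_mem_of_not_mem hv (hirr s)), sub_self]

/-- The update raises the height at `v` by the normalized Laplacian at `v`, and `v` carries weight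
`1 / card` in the average at `s`. -/
theorem disc_ring_of_mem (hirr : ∀ s, s ∉ nb s) (hsymm : ∀ s, ∀ s' ∈ nb s, s ∈ nb s')
    (x : V → ℝ) {s v : V} (hv : v ∈ nb s) :
    disc nb (ring nb x v) s = disc nb x s + ((nb s).card : ℝ)⁻¹ * disc nb x v := by
  classical
  have hsv : s ≠ v := fun h => hirr s (by rwa [← h] at hv)
  rw [disc_eq ⟨s, hsymm s v hv⟩, disc, disc, ← mul_add]
  congr 1
  rw [← Finset.add_sum_erase _ _ hv, ← Finset.add_sum_erase _ (fun y => x y - x s) hv, ring_self,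
    ring_of_ne nb hsv, Finset.sum_congr rfl fun y hy => by
      rw [ring_of_ne nb (x := x) (Finset.ne_of_mem_erase hy)]]
  ring

/-- The second moment about the mean falls short of the second moment about `x s` by the squared
distance of `x s` from the mean. This is the source of the energy dissipation. -/
theorem sum_sq_sub_nbMean (x : V → ℝ) {s : V} (hs : (nb s).Nonempty) :
    ∑ s' ∈ nb s, (x s' - nbMean nb x s) ^ 2 + (nb s).card * disc nb x s ^ 2 =
      ∑ s' ∈ nb s, (x s' - x s) ^ 2 := by
  have hc : ((nb s).card : ℝ) ≠ 0 := by exact_mod_cast hs.card_ne_zero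
  have h1 : ∑ s' ∈ nb s, (x s' - x s) = (nb s).card * disc nb x s := by
    rw [disc]; field_simp
  have h2 : ∀ s', (x s' - nbMean nb x s) ^ 2 =
      (x s' - x s) ^ 2 - 2 * disc nb x s * (x s' - x s) + disc nb x s ^ 2 := by
    intro s'; rw [disc_eq hs]; ring
  simp_rw [h2]
  rw [Finset.sum_add_distrib, Finset.sum_sub_distrib, ← Finset.mul_sum, h1, Finset.sum_const,
    nsmul_eq_mul]
  ring

open Classical in
/-- The bound of the change of the squared normalized Laplacian at `s` by an update at `v`. -/
noncomputable def discChange (nb : V → Finset V) (s v : V) (x : V → ℝ) : ℝ≥0∞ :=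
  if v = s then ENNReal.ofReal (disc nb x s ^ 2) else
    ((nb s).card : ℝ≥0∞)⁻¹ *
      (ENNReal.ofReal (disc nb x s ^ 2) + 2 * ENNReal.ofReal (disc nb x v ^ 2))

theorem measurable_discChange (s v : V) : Measurable (discChange nb s v) := by
  have h := fun s : V => ((measurable_disc (nb := nb) s).pow_const 2).ennreal_ofReal
  unfold discChange
  by_cases hv : v = s
  · simp only [if_pos hv]; exact h s
  · simp only [if_neg hv]; exact ((h s).add ((h v).const_mul 2)).const_mul _

theorem ofReal_sq_le_add {a b c Y : ℝ} (h : a ^ 2 ≤ b ^ 2 + c * Y) (hc : 0 ≤ c) (hY : 0 ≤ Y) :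
    ENNReal.ofReal (a ^ 2) ≤
      ENNReal.ofReal (b ^ 2) + ENNReal.ofReal c * ENNReal.ofReal Y := by
  rw [← ENNReal.ofReal_mul hc, ← ENNReal.ofReal_add (sq_nonneg _) (mul_nonneg hc hY)]
  exact ENNReal.ofReal_le_ofReal h

theorem discChange_of_mem (hirr : ∀ s, s ∉ nb s) (x : V → ℝ) {s v : V} (hv : v ∈ nb s) :
    discChange nb s v x = ENNReal.ofReal ((nb s).card : ℝ)⁻¹ *
      ENNReal.ofReal (disc nb x s ^ 2 + 2 * disc nb x v ^ 2) := by
  have hc : 0 < ((nb s).card : ℝ) := by exact_mod_cast Finset.card_pos.2 ⟨v, hv⟩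
  rw [discChange, if_neg (ne_of_mem_of_not_mem hv (hirr s)), ENNReal.ofReal_inv_of_pos hc,
    ENNReal.ofReal_natCast, ENNReal.ofReal_add (sq_nonneg _) (by positivity),
    ENNReal.ofReal_mul zero_le_two, ENNReal.ofReal_ofNat]

theorem discChange_spec (hirr : ∀ s, s ∉ nb s) (hsymm : ∀ s, ∀ s' ∈ nb s, s ∈ nb s')
    (x : V → ℝ) {s v : V} (hv : v = s ∨ v ∈ nb s) :
    ENNReal.ofReal (disc nb (ring nb x v) s ^ 2) ≤
      ENNReal.ofReal (disc nb x s ^ 2) + discChange nb s v x ∧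
    ENNReal.ofReal (disc nb x s ^ 2) ≤
      ENNReal.ofReal (disc nb (ring nb x v) s ^ 2) + discChange nb s v x := by
  rcases hv with rfl | hv
  · rw [disc_ring_self hirr, discChange, if_pos rfl]
    simp
  · rw [disc_ring_of_mem hirr hsymm x hv, discChange_of_mem hirr x hv]
    have hc1 : (1 : ℝ) ≤ (nb s).card := by exact_mod_cast Finset.card_pos.2 ⟨v, hv⟩
    have hc : ((nb s).card : ℝ)⁻¹ ≤ 1 := inv_le_one_of_one_le₀ hc1
    have hc0 : 0 ≤ ((nb s).card : ℝ)⁻¹ := by positivity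
    set c := ((nb s).card : ℝ)⁻¹
    set f := disc nb x s
    set g := disc nb x v
    -- The new value is `f + c * g` with `c ≤ 1`. From `2 * |f * g| ≤ f² + g²` and `c² ≤ c`, its
    -- square differs from `f²` by at most `c * (f² + 2 * g²)`.
    have h1 : 0 ≤ c * (f - g) ^ 2 := mul_nonneg hc0 (sq_nonneg _)
    have h1' : 0 ≤ c * (f + g) ^ 2 := mul_nonneg hc0 (sq_nonneg _)
    have h2 : c * c * g ^ 2 ≤ c * 1 * g ^ 2 := by gcongr
    have h3 : 0 ≤ c * c * g ^ 2 := by positivity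
    have h4 : 0 ≤ c * g ^ 2 := by positivity
    constructor
    · refine ofReal_sq_le_add ?_ hc0 (by positivity)
      nlinarith
    · refine ofReal_sq_le_add ?_ hc0 (by positivity)
      nlinarith

end Disc

/-! ### Expectations over the clocks -/

section Mean

variable {V : Type*} [Countable V] {π : Measure (Conf ℝ)} [IsProbabilityMeasure π]
  {nb : V → Finset V} {γ : V → ℝ}

theorem measurable_graphHarness_pi (γ : V → ℝ) :
    Measurable fun p : ℝ × (V → Conf ℝ) => graphHarness nb p.2 γ p.1 :=
  measurable_pi_iff.2 fun s => measurable_graphHarness nb measurable_snd measurable_fst γ s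

theorem measurable_lintegral_graphHarness {Y : (V → ℝ) → ℝ≥0∞} (hY : Measurable Y) :
    Measurable fun u : ℝ => ∫⁻ N, Y (graphHarness nb N γ u) ∂(clockLaw V π) :=
  (hY.comp (measurable_graphHarness_pi γ)).lintegral_prod_right'

/-- The height just before an epoch is a functional of the strict past, so the predictable formula
applies; at a fixed time almost surely no clock rings and the cut is invisible. -/
theorem lintegral_ring (hπ : IsPoissonProcess id π) {Y : (V → ℝ) → ℝ≥0∞} (hY : Measurable Y)
    (s : V) (a b : ℝ) :
    ∫⁻ N, ∫⁻ τ in Ioc a b, Y (graphHarness nb (cutAll τ N) γ τ) ∂(confMeasure (N s))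
      ∂(clockLaw V π) =
    ∫⁻ u in Ioc a b, ∫⁻ N, Y (graphHarness nb N γ u) ∂(clockLaw V π) := by
  rw [lintegral_predictable_clockLaw hπ s (G := fun u N => Y (graphHarness nb N γ u))
    (hY.comp (measurable_graphHarness_pi γ)) a b]
  refine lintegral_congr fun u => lintegral_congr_ae ?_
  filter_upwards [ae_all_iff.2 fun x => ae_notMem_clock (V := V) hπ x u] with N hN
  congr 1
  exact funext fun x => graphHarness_cutAll_of_notMem (hN x)

theorem measurable_lintegral_ring {Y : (V → ℝ) → ℝ≥0∞} (hY : Measurable Y) (s : V) {B : Set ℝ}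
    (hB : MeasurableSet B) :
    Measurable fun N : V → Conf ℝ =>
      ∫⁻ τ in B, Y (graphHarness nb (cutAll τ N) γ τ) ∂(confMeasure (N s)) :=
  measurable_lintegral_confMeasure (measurable_pi_apply s)
    (g := fun N τ => Y (graphHarness nb (cutAll τ N) γ τ))
    (hY.comp ((measurable_graphHarness_pi γ).comp
      (measurable_snd.prodMk (measurable_cutAll measurable_fst measurable_snd)))) hB

theorem lintegral_ring_Ioi (hπ : IsPoissonProcess id π) {Y : (V → ℝ) → ℝ≥0∞} (hY : Measurable Y)
    (s : V) :
    ∫⁻ N, ∫⁻ τ in Ioi 0, Y (graphHarness nb (cutAll τ N) γ τ) ∂(confMeasure (N s))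
      ∂(clockLaw V π) =
    ∫⁻ u in Ioi 0, ∫⁻ N, Y (graphHarness nb N γ u) ∂(clockLaw V π) := by
  simp_rw [setLIntegral_Ioi_eq_iSup]
  rw [lintegral_iSup]
  · simp_rw [lintegral_ring hπ hY s]
  · exact fun n => measurable_lintegral_ring hY s measurableSet_Ioc
  · exact fun m n hmn N => lintegral_mono_set (monotone_Ioc_zero_natCast hmn)

theorem measurable_comp_cutAll {Y : (V → ℝ) → ℝ≥0∞} (hY : Measurable Y) (N : V → Conf ℝ) :
    Measurable fun τ => Y (graphHarness nb (cutAll τ N) γ τ) :=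
  hY.comp ((measurable_graphHarness_pi γ).comp
    (measurable_id.prodMk (measurable_cutAll measurable_const measurable_id)))

theorem measurable_comp_graphHarness {Y : (V → ℝ) → ℝ≥0∞} (hY : Measurable Y) (t : ℝ) :
    Measurable fun N : V → Conf ℝ => Y (graphHarness nb N γ t) :=
  (hY.comp (measurable_graphHarness_pi γ)).comp measurable_prodMk_left

/-- Dynkin's formula for a function of finitely many heights, with loss terms moved to the left so
that all terms are nonnegative. -/
theorem lintegral_evolution (hπ : IsPoissonProcess id π) (hirr : ∀ s, s ∉ nb s)
    (hgood : ∀ᵐ N ∂(clockLaw V π), GoodPath nb γ N) {F : Finset V}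
    {Z : (V → ℝ) → ℝ≥0∞} (hZm : Measurable Z)
    (hZ : ∀ x y : V → ℝ, (∀ v ∈ F, x v = y v) → Z x = Z y) {a b : ℝ} (ha : 0 ≤ a) (hab : a ≤ b) :
    ∫⁻ N, Z (graphHarness nb N γ b) ∂(clockLaw V π) +
      ∑ _s ∈ F, ∫⁻ u in Ioc a b, ∫⁻ N, Z (graphHarness nb N γ u) ∂(clockLaw V π) =
    ∫⁻ N, Z (graphHarness nb N γ a) ∂(clockLaw V π) +
      ∑ s ∈ F, ∫⁻ u in Ioc a b, ∫⁻ N, Z (ring nb (graphHarness nb N γ u) s)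
        ∂(clockLaw V π) := by
  have hm : ∀ t, Measurable fun N : V → Conf ℝ => Z (graphHarness nb N γ t) := fun t =>
    measurable_comp_graphHarness hZm t
  have hr : ∀ s, Measurable fun x => Z (ring nb x s) := fun s => hZm.comp (measurable_ring nb s)
  rw [Finset.sum_congr rfl fun s _ => (lintegral_ring (nb := nb) (γ := γ) hπ hZm s a b).symm]
  rw [Finset.sum_congr rfl fun s _ => (lintegral_ring (nb := nb) (γ := γ) hπ (hr s) s a b).symm]
  rw [← lintegral_finsetSum _ fun s _ => measurable_lintegral_ring hZm s measurableSet_Ioc,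
    ← lintegral_finsetSum _ fun s _ => measurable_lintegral_ring (hr s) s measurableSet_Ioc,
    ← lintegral_add_left (hm b), ← lintegral_add_left (hm a)]
  refine lintegral_congr_ae ?_
  filter_upwards [hgood] with N hN
  exact hN.evolution hirr hZ ha hab

theorem lintegral_le_evolution (hπ : IsPoissonProcess id π) (hirr : ∀ s, s ∉ nb s)
    (hgood : ∀ᵐ N ∂(clockLaw V π), GoodPath nb γ N) {F : Finset V}
    {Z : (V → ℝ) → ℝ≥0∞} (hZm : Measurable Z)
    (hZ : ∀ x y : V → ℝ, (∀ v ∈ F, x v = y v) → Z x = Z y) (hfin : ∀ x, Z x ≠ ⊤)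
    {Y : V → (V → ℝ) → ℝ≥0∞} (hYm : ∀ s, Measurable (Y s))
    (hY : ∀ s ∈ F, ∀ x, Z (ring nb x s) ≤ Z x + Y s x ∧ Z x ≤ Z (ring nb x s) + Y s x)
    {a b : ℝ} (ha : 0 ≤ a) (hab : a ≤ b) :
    ∫⁻ N, Z (graphHarness nb N γ b) ∂(clockLaw V π) ≤
      ∫⁻ N, Z (graphHarness nb N γ a) ∂(clockLaw V π) +
        ∑ s ∈ F, ∫⁻ u in Ioc a b, ∫⁻ N, Y s (graphHarness nb N γ u) ∂(clockLaw V π) ∧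
    ∫⁻ N, Z (graphHarness nb N γ a) ∂(clockLaw V π) ≤
      ∫⁻ N, Z (graphHarness nb N γ b) ∂(clockLaw V π) +
        ∑ s ∈ F, ∫⁻ u in Ioc a b, ∫⁻ N, Y s (graphHarness nb N γ u) ∂(clockLaw V π) := by
  have hm : ∀ t, Measurable fun N : V → Conf ℝ => Z (graphHarness nb N γ t) := fun t =>
    measurable_comp_graphHarness hZm t
  rw [Finset.sum_congr rfl fun s _ =>
      (lintegral_ring (nb := nb) (γ := γ) hπ (hYm s) s a b).symm,
    ← lintegral_finsetSum _ fun s _ => measurable_lintegral_ring (hYm s) s measurableSet_Ioc,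
    ← lintegral_add_left (hm a), ← lintegral_add_left (hm b)]
  constructor
  · refine lintegral_mono_ae ?_
    filter_upwards [hgood] with N hN
    exact hN.le_evolution hirr hZ hfin (fun s hs x => (hY s hs x).1)
      (fun s => measurable_comp_cutAll (hYm s) N) ha hab
  · refine lintegral_mono_ae ?_
    filter_upwards [hgood] with N hN
    exact hN.evolution_ge hirr hZ hfin (fun s hs x => (hY s hs x).2)
      (fun s => measurable_comp_cutAll (hYm s) N) ha hab

/-- The mean square gradient along an edge. -/
noncomputable def edgeMean (π : Measure (Conf ℝ)) [IsProbabilityMeasure π] (nb : V → Finset V)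
    (γ : V → ℝ) (t : ℝ) (s s' : V) : ℝ≥0∞ :=
  ∫⁻ N, ENNReal.ofReal ((graphHarness nb N γ t s' - graphHarness nb N γ t s) ^ 2) ∂(clockLaw V π)

/-- The mean square of the normalized Laplacian. -/
noncomputable def discMean (π : Measure (Conf ℝ)) [IsProbabilityMeasure π] (nb : V → Finset V)
    (γ : V → ℝ) (t : ℝ) (s : V) : ℝ≥0∞ :=
  ∫⁻ N, ENNReal.ofReal (disc nb (graphHarness nb N γ t) s ^ 2) ∂(clockLaw V π)

/-- The mean square gradient along an edge after an update at `s`. -/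
noncomputable def ringMean (π : Measure (Conf ℝ)) [IsProbabilityMeasure π] (nb : V → Finset V)
    (γ : V → ℝ) (t : ℝ) (s s' : V) : ℝ≥0∞ :=
  ∫⁻ N, ENNReal.ofReal ((graphHarness nb N γ t s' - nbMean nb (graphHarness nb N γ t) s) ^ 2)
    ∂(clockLaw V π)

theorem measurable_ofReal_sq_sub (s s' : V) :
    Measurable fun x : V → ℝ => ENNReal.ofReal ((x s' - x s) ^ 2) := by fun_prop

theorem measurable_ofReal_sq_disc (s : V) :
    Measurable fun x : V → ℝ => ENNReal.ofReal (disc nb x s ^ 2) :=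
  ((measurable_disc s).pow_const 2).ennreal_ofReal

theorem measurable_ofReal_sq_sub_nbMean (s s' : V) :
    Measurable fun x : V → ℝ => ENNReal.ofReal ((x s' - nbMean nb x s) ^ 2) :=
  (((measurable_pi_apply s').sub (measurable_nbMean nb s)).pow_const 2).ennreal_ofReal

theorem measurable_edgeMean (s s' : V) : Measurable fun t => edgeMean π nb γ t s s' :=
  measurable_lintegral_graphHarness (measurable_ofReal_sq_sub s s')

theorem measurable_discMean (s : V) : Measurable fun t => discMean π nb γ t s :=
  measurable_lintegral_graphHarness (measurable_ofReal_sq_disc s)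

theorem measurable_ringMean (s s' : V) : Measurable fun t => ringMean π nb γ t s s' :=
  measurable_lintegral_graphHarness (measurable_ofReal_sq_sub_nbMean s s')

theorem edgeMean_zero (s s' : V) :
    edgeMean π nb γ 0 s s' = ENNReal.ofReal ((γ s' - γ s) ^ 2) := by
  simp [edgeMean, graphHarness_of_eq_empty (epochs_nonpos _ le_rfl)]

/-- The squared difference along an edge depends on two heights, so only the two clocks at its ends
act on it, each at rate one. -/
theorem edgeMean_add_lintegral (hπ : IsPoissonProcess id π) (hirr : ∀ s, s ∉ nb s)
    (hgood : ∀ᵐ N ∂(clockLaw V π), GoodPath nb γ N) {s s' : V} (hne : s ≠ s') {t : ℝ}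
    (ht : 0 ≤ t) :
    edgeMean π nb γ t s s' + 2 * ∫⁻ u in Ioc 0 t, edgeMean π nb γ u s s' =
      edgeMean π nb γ 0 s s' + ((∫⁻ u in Ioc 0 t, ringMean π nb γ u s s') +
        ∫⁻ u in Ioc 0 t, ringMean π nb γ u s' s) := by
  classical
  have h := lintegral_evolution (F := {s, s'}) hπ hirr hgood (measurable_ofReal_sq_sub s s')
    (fun x y hxy => by rw [hxy s (by simp), hxy s' (by simp)]) le_rfl ht
  rw [Finset.sum_pair hne, Finset.sum_pair hne, ← two_mul] at h
  simp only [ring_self, ring_of_ne nb hne, ring_of_ne nb hne.symm] at h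
  have h2 : ∀ u, ∫⁻ N, ENNReal.ofReal ((nbMean nb (graphHarness nb N γ u) s' -
      graphHarness nb N γ u s) ^ 2) ∂(clockLaw V π) = ringMean π nb γ u s' s := fun u =>
    lintegral_congr fun N => by rw [← neg_sub, neg_sq]
  simp_rw [h2] at h
  exact h

theorem sum_ringMean_add (t : ℝ) {s : V} (hs : (nb s).Nonempty) :
    ∑ s' ∈ nb s, ringMean π nb γ t s s' + (nb s).card * discMean π nb γ t s =
      ∑ s' ∈ nb s, edgeMean π nb γ t s s' := by
  have hm : ∀ {Y : (V → ℝ) → ℝ≥0∞}, Measurable Y →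
      Measurable fun N : V → Conf ℝ => Y (graphHarness nb N γ t) := fun hY =>
    measurable_comp_graphHarness hY t
  simp only [ringMean, discMean, edgeMean]
  rw [← lintegral_finsetSum _ fun s' _ => hm (measurable_ofReal_sq_sub_nbMean s s'),
    ← lintegral_finsetSum _ fun s' _ => hm (measurable_ofReal_sq_sub s s'),
    ← lintegral_const_mul _ (hm (measurable_ofReal_sq_disc s)),
    ← lintegral_add_right _ ((hm (measurable_ofReal_sq_disc s)).const_mul _)]
  refine lintegral_congr fun N => ?_
  rw [← ENNReal.ofReal_natCast, ← ENNReal.ofReal_mul (Nat.cast_nonneg _),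
    ← ENNReal.ofReal_sum_of_nonneg fun _ _ => sq_nonneg _,
    ← ENNReal.ofReal_sum_of_nonneg fun _ _ => sq_nonneg _,
    ← ENNReal.ofReal_add (Finset.sum_nonneg fun _ _ => sq_nonneg _) (by positivity),
    sum_sq_sub_nbMean _ hs]

/-- A crude bound from `(a + b + c)² ≤ 3 * (a² + b² + c²)` and Jensen's inequality; it serves only
to know that the energies are finite. -/
theorem edgeMean_le (hπ : IsPoissonProcess id π) (hirr : ∀ s, s ∉ nb s)
    (hgood : ∀ᵐ N ∂(clockLaw V π), GoodPath nb γ N) {s s' : V} (hs : (nb s).Nonempty)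
    (hs' : (nb s').Nonempty) {t : ℝ} (ht : 0 ≤ t) :
    edgeMean π nb γ t s s' ≤ 3 * (edgeMean π nb γ 0 s s' + displacementBound nb γ t s +
      displacementBound nb γ t s') := by
  have hd : ∀ {s : V}, (nb s).Nonempty →
      ∫⁻ N, ENNReal.ofReal ((graphHarness nb N γ t s - γ s) ^ 2) ∂(clockLaw V π) ≤
        displacementBound nb γ t s := fun {s} hs =>
    (lintegral_mono_ae (hgood.mono fun N hN => hN.ofReal_sq_graphHarness_sub_le t hs _)).trans
      (lintegral_tsum_graphTrans_sq_le hπ hirr s ht)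
  have hm : ∀ s, Measurable fun N : V → Conf ℝ =>
      ENNReal.ofReal ((graphHarness nb N γ t s - γ s) ^ 2) := fun s =>
    (((measurable_graphHarness nb measurable_id measurable_const γ s).sub_const _).pow_const
      2).ennreal_ofReal
  calc edgeMean π nb γ t s s'
      ≤ ∫⁻ N, 3 * (ENNReal.ofReal ((γ s' - γ s) ^ 2) +
          ENNReal.ofReal ((graphHarness nb N γ t s - γ s) ^ 2) +
          ENNReal.ofReal ((graphHarness nb N γ t s' - γ s') ^ 2)) ∂(clockLaw V π) := by
        refine lintegral_mono fun N => ?_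
        rw [← ENNReal.ofReal_add (sq_nonneg _) (sq_nonneg _),
          ← ENNReal.ofReal_add (by positivity) (sq_nonneg _),
          show (3 : ℝ≥0∞) = ENNReal.ofReal 3 by simp, ← ENNReal.ofReal_mul (by norm_num)]
        refine ENNReal.ofReal_le_ofReal ?_
        set x := graphHarness nb N γ t s - γ s
        set y := graphHarness nb N γ t s' - γ s'
        have : graphHarness nb N γ t s' - graphHarness nb N γ t s = (γ s' - γ s) - x + y := by
          simp only [x, y]; ring
        rw [this]
        nlinarith [sq_nonneg ((γ s' - γ s) + x), sq_nonneg ((γ s' - γ s) - y), sq_nonneg (x + y)]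
    _ = 3 * (ENNReal.ofReal ((γ s' - γ s) ^ 2) +
          ∫⁻ N, ENNReal.ofReal ((graphHarness nb N γ t s - γ s) ^ 2) ∂(clockLaw V π) +
          ∫⁻ N, ENNReal.ofReal ((graphHarness nb N γ t s' - γ s') ^ 2) ∂(clockLaw V π)) := by
        have h12 : Measurable fun N : V → Conf ℝ => ENNReal.ofReal ((γ s' - γ s) ^ 2) +
            ENNReal.ofReal ((graphHarness nb N γ t s - γ s) ^ 2) +
            ENNReal.ofReal ((graphHarness nb N γ t s' - γ s') ^ 2) :=
          (measurable_const.add (hm s)).add (hm s')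
        rw [lintegral_const_mul _ h12, lintegral_add_right _ (hm s'), lintegral_add_right _ (hm s), lintegral_const,
          measure_univ, mul_one]
    _ ≤ _ := by
        rw [edgeMean_zero]
        gcongr
        · exact hd hs
        · exact hd hs'

theorem lintegral_discChange_self (t : ℝ) (s : V) :
    ∫⁻ N, discChange nb s s (graphHarness nb N γ t) ∂(clockLaw V π) = discMean π nb γ t s := by
  simp [discChange, discMean]

/-- The factor `1 / card` in `discChange` turns the sum over the neighbours into an average, so the
constant does not depend on the degree. -/
theorem sum_lintegral_discChange_le (hirr : ∀ s, s ∉ nb s) (t : ℝ) (s : V) :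
    ∑ v ∈ nb s, ∫⁻ N, discChange nb s v (graphHarness nb N γ t) ∂(clockLaw V π) ≤
      discMean π nb γ t s + 2 * nbAvg nb (discMean π nb γ t) s := by
  have hm : ∀ s, Measurable fun N : V → Conf ℝ =>
      ENNReal.ofReal (disc nb (graphHarness nb N γ t) s ^ 2) := fun s =>
    measurable_comp_graphHarness (measurable_ofReal_sq_disc s) t
  have h : ∀ v ∈ nb s, ∫⁻ N, discChange nb s v (graphHarness nb N γ t) ∂(clockLaw V π) =
      ((nb s).card : ℝ≥0∞)⁻¹ * (discMean π nb γ t s * 1 + 2 * discMean π nb γ t v) := by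
    intro v hv
    have hvs : v ≠ s := ne_of_mem_of_not_mem hv (hirr s)
    simp only [discChange, if_neg hvs]
    have hm2 : Measurable fun N : V → Conf ℝ =>
        ENNReal.ofReal (disc nb (graphHarness nb N γ t) s ^ 2) +
          2 * ENNReal.ofReal (disc nb (graphHarness nb N γ t) v ^ 2) :=
      (hm s).add ((hm v).const_mul _)
    rw [lintegral_const_mul _ hm2, lintegral_add_left (hm s),
      lintegral_const_mul _ (hm v), mul_one, discMean, discMean]
  rw [Finset.sum_congr rfl h, ← Finset.mul_sum]
  change nbAvg nb (fun v => discMean π nb γ t s * 1 + 2 * discMean π nb γ t v) s ≤ _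
  rw [nbAvg_add, nbAvg_const_mul, nbAvg_const_mul]
  gcongr
  exact mul_le_of_le_one_right' (nbAvg_one_le nb s)

theorem measurable_lintegral_discChange (s v : V) : Measurable fun t : ℝ =>
    ∫⁻ N, discChange nb s v (graphHarness nb N γ t) ∂(clockLaw V π) :=
  measurable_lintegral_graphHarness (measurable_discChange s v)

open Classical in
theorem sum_setLIntegral_discChange_le (hirr : ∀ s, s ∉ nb s) (s : V) (B : Set ℝ) :
    ∑ v ∈ insert s (nb s), ∫⁻ u in B,
      ∫⁻ N, discChange nb s v (graphHarness nb N γ u) ∂(clockLaw V π) ≤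
    ∫⁻ u in B, (2 * discMean π nb γ u s + 2 * nbAvg nb (discMean π nb γ u) s) := by
  rw [← lintegral_finsetSum _ fun v _ => measurable_lintegral_discChange s v]
  refine lintegral_mono fun u => ?_
  rw [Finset.sum_insert (hirr s), lintegral_discChange_self]
  refine (add_le_add_right (sum_lintegral_discChange_le hirr u s) _).trans (le_of_eq ?_)
  ring

theorem disc_congr [DecidableEq V] {x y : V → ℝ} {s : V} (h : ∀ v ∈ insert s (nb s), x v = y v) :
    ENNReal.ofReal (disc nb x s ^ 2) = ENNReal.ofReal (disc nb y s ^ 2) := by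
  rw [disc, disc, Finset.sum_congr rfl fun v hv => by
    rw [h v (Finset.mem_insert_of_mem hv), h s (Finset.mem_insert_self _ _)]]

/-- In mean, `discChange_spec` bounds the change of the mean square at `s`, in both directions, by
its own time integral and the time integral of its average over the neighbours. -/
theorem discMean_le (hπ : IsPoissonProcess id π) (hirr : ∀ s, s ∉ nb s)
    (hsymm : ∀ s, ∀ s' ∈ nb s, s ∈ nb s')
    (hgood : ∀ᵐ N ∂(clockLaw V π), GoodPath nb γ N) (s : V) {a b : ℝ} (ha : 0 ≤ a) (hab : a ≤ b) :
    discMean π nb γ b s ≤ discMean π nb γ a s +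
      ∫⁻ u in Ioc a b, (2 * discMean π nb γ u s + 2 * nbAvg nb (discMean π nb γ u) s) ∧
    discMean π nb γ a s ≤ discMean π nb γ b s +
      ∫⁻ u in Ioc a b, (2 * discMean π nb γ u s + 2 * nbAvg nb (discMean π nb γ u) s) := by
  classical
  have h := lintegral_le_evolution hπ hirr hgood (measurable_ofReal_sq_disc (nb := nb) s)
    (fun x y hxy => disc_congr hxy) (fun x => ENNReal.ofReal_ne_top)
    (Y := discChange nb s) (measurable_discChange s)
    (fun v hv x => discChange_spec hirr hsymm x (Finset.mem_insert.1 hv)) ha hab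
  have h2 := sum_setLIntegral_discChange_le (π := π) (γ := γ) hirr s (Ioc a b)
  exact ⟨h.1.trans (by gcongr; exact le_rfl), h.2.trans (by gcongr; exact le_rfl)⟩

theorem lintegral_discMean_nbAvg_ne_top (hint : ∀ s, ∫⁻ u in Ioi 0, discMean π nb γ u s ≠ ⊤)
    (s : V) :
    ∫⁻ u in Ioi 0, (2 * discMean π nb γ u s + 2 * nbAvg nb (discMean π nb γ u) s) ≠ ⊤ := by
  rw [lintegral_add_left ((measurable_discMean s).const_mul 2),
    lintegral_const_mul _ (measurable_discMean s),
    lintegral_const_mul _ (measurable_nbAvg nb measurable_discMean s),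
    lintegral_nbAvg nb measurable_discMean]
  refine ENNReal.add_ne_top.2 ⟨ENNReal.mul_ne_top (by simp) (hint s),
    ENNReal.mul_ne_top (by simp) ?_⟩
  rcases (nb s).eq_empty_or_nonempty with h | h
  · simp [nbAvg, h]
  · exact ENNReal.mul_ne_top (by simpa using h.ne_empty)
      (ENNReal.sum_lt_top.2 fun x _ => (hint x).lt_top).ne

/-- `tendsto_zero_of_le_add` applies, with the tails of the integral in `discMean_le` as bound of
the later increase. -/
theorem tendsto_discMean (hπ : IsPoissonProcess id π) (hirr : ∀ s, s ∉ nb s)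
    (hsymm : ∀ s, ∀ s' ∈ nb s, s ∈ nb s')
    (hgood : ∀ᵐ N ∂(clockLaw V π), GoodPath nb γ N)
    (hint : ∀ s, ∫⁻ u in Ioi 0, discMean π nb γ u s ≠ ⊤) (s : V) :
    Tendsto (fun t => discMean π nb γ t s) atTop (𝓝 0) := by
  refine tendsto_zero_of_le_add
    (tendsto_setLIntegral_Ioi_zero (lintegral_discMean_nbAvg_ne_top hint s))
    (fun n a b hna hab => ?_) (hint s)
  refine (discMean_le hπ hirr hsymm hgood s (n.cast_nonneg.trans hna) hab).1.trans ?_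
  gcongr
  exact Ioc_subset_Ioi_self.trans (Ioi_subset_Ioi hna)

theorem ae_tendsto_disc (hπ : IsPoissonProcess id π) (hirr : ∀ s, s ∉ nb s)
    (hsymm : ∀ s, ∀ s' ∈ nb s, s ∈ nb s')
    (hgood : ∀ᵐ N ∂(clockLaw V π), GoodPath nb γ N)
    (hint : ∀ s, ∫⁻ u in Ioi 0, discMean π nb γ u s ≠ ⊤) (s : V) :
    ∀ᵐ N ∂(clockLaw V π), Tendsto (fun t => disc nb (graphHarness nb N γ t) s) atTop (𝓝 0) := by
  classical
  have hZm := measurable_ofReal_sq_disc (nb := nb) s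
  have h1 : ∀ᵐ N ∂(clockLaw V π),
      ∫⁻ t in Ioi 0, ENNReal.ofReal (disc nb (graphHarness nb N γ t) s ^ 2) < ⊤ := by
    have hm : Measurable fun p : (V → Conf ℝ) × ℝ =>
        ENNReal.ofReal (disc nb (graphHarness nb p.1 γ p.2) s ^ 2) :=
      hZm.comp ((measurable_graphHarness_pi γ).comp measurable_swap)
    refine ae_lt_top hm.lintegral_prod_right' ?_
    rw [lintegral_lintegral_swap hm.aemeasurable]
    exact hint s
  -- The total change along all epochs is almost surely finite, since its mean is the time integral
  -- of an integrable quantity. Its tails bound the later increase on a fixed path.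
  have h2 : ∀ᵐ N ∂(clockLaw V π), ∀ v ∈ insert s (nb s),
      ∫⁻ τ in Ioi 0, discChange nb s v (graphHarness nb (cutAll τ N) γ τ)
        ∂(confMeasure (N v)) ≠ ⊤ := by
    have hsum := ne_top_of_le_ne_top (lintegral_discMean_nbAvg_ne_top hint s)
      (sum_setLIntegral_discChange_le hirr s (Ioi 0))
    refine (ae_ball_iff (Finset.countable_toSet _)).2 fun v hv => ?_
    have hv' := (ENNReal.sum_lt_top.1 hsum.lt_top) v hv
    rw [← lintegral_ring_Ioi hπ (measurable_discChange s v) v] at hv'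
    exact (ae_lt_top (measurable_lintegral_ring (measurable_discChange s v) v measurableSet_Ioi)
      hv'.ne).mono fun N hN => hN.ne
  filter_upwards [hgood, h1, h2] with N hN hN1 hN2
  have hU : Tendsto (fun n : ℕ => ∑ v ∈ insert s (nb s), ∫⁻ τ in Ioi (n : ℝ),
      discChange nb s v (graphHarness nb (cutAll τ N) γ τ) ∂(confMeasure (N v))) atTop (𝓝 0) := by
    rw [← Finset.sum_const_zero (s := insert s (nb s))]
    exact tendsto_finsetSum _ fun v hv => tendsto_setLIntegral_Ioi_zero (hN2 v hv)
  have h3 := tendsto_zero_of_le_add hU (fun n a b hna hab => by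
    refine (hN.le_evolution hirr (fun x y hxy => disc_congr hxy) (fun x => ENNReal.ofReal_ne_top)
      (fun v hv x => (discChange_spec hirr hsymm x (Finset.mem_insert.1 hv)).1)
      (fun v => measurable_comp_cutAll (measurable_discChange s v) N)
      (n.cast_nonneg.trans hna) hab).trans ?_
    gcongr
    exact Ioc_subset_Ioi_self.trans (Ioi_subset_Ioi hna)) hN1.ne
  have h4 := (ENNReal.tendsto_toReal ENNReal.zero_ne_top).comp h3
  have h5 : Tendsto (fun t => |disc nb (graphHarness nb N γ t) s|) atTop (𝓝 0) := by
    have := (Real.continuous_sqrt.tendsto _).comp h4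
    simp only [ENNReal.toReal_zero, Real.sqrt_zero] at this
    refine this.congr fun t => ?_
    simp only [Function.comp_apply]
    rw [ENNReal.toReal_ofReal (sq_nonneg _), Real.sqrt_sq_eq_abs]
  exact tendsto_zero_iff_abs_tendsto_zero _ |>.2 h5

end Mean

end Harness

namespace Harness

/-! ### The Voronoi graph of a configuration -/

section Link

variable {d : ℕ} {S : Conf (Site d)}

/-- The number of neighbours as an extended real. -/
noncomputable def degE (s : Site d) (S : Conf (Site d)) : ℝ≥0∞ :=
  ∑' s' : S, ENNReal.ofReal (cond s s' S)

open Classical in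
theorem ofReal_cond (s s' : Site d) (S : Conf (Site d)) :
    ENNReal.ofReal (cond s s' S) = if VorNeighbor S s s' then 1 else 0 := by
  rw [cond]; split_ifs <;> simp

theorem degE_ne_top_iff {s : Site d} :
    degE s S ≠ ⊤ ↔ {s' : S | VorNeighbor S s s'}.Finite := by
  classical
  constructor
  · intro h
    refine (ENNReal.finite_const_le_of_tsum_ne_top h one_ne_zero).subset fun s' hs' => ?_
    change 1 ≤ ENNReal.ofReal (cond s s' S)
    rw [ofReal_cond, if_pos (show VorNeighbor S s s' from hs')]
  · intro h
    rw [degE, tsum_eq_sum (s := h.toFinset) fun s' hs' => by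
      rw [ofReal_cond, if_neg (show ¬ VorNeighbor S s s' from fun h' => hs' (h.mem_toFinset.2 h'))]]
    exact (ENNReal.sum_lt_top.2 fun x _ => ENNReal.ofReal_lt_top).ne

theorem degE_ne_top_of_finite {s : Site d} (h : {s' | VorNeighbor S s s'}.Finite) :
    degE s S ≠ ⊤ :=
  degE_ne_top_iff.2 (Set.Finite.preimage (f := ((↑) : S → Site d)) Subtype.val_injective.injOn h)

theorem measurable_degE {C : Type*} [MeasurableSpace C] {S : C → Conf (Site d)}
    (hS : Measurable S) {s : C → Site d} (hs : Measurable s) :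
    Measurable fun c => degE (s c) (S c) :=
  measurable_tsum_conf (g := fun c s' => ENNReal.ofReal (cond (s c) s' (S c))) hS
    (measurable_cond (hS.comp measurable_fst) (hs.comp measurable_fst)
      measurable_snd).ennreal_ofReal

theorem degE_shift (x s : Site d) (S : Conf (Site d)) : degE (s - x) (shift x S) = degE s S := by
  rw [degE, degE, ← (shiftEquiv x S).tsum_eq]
  exact tsum_congr fun s' => congrArg ENNReal.ofReal (cond_shift x s s' S)

open Classical in
/-- The set of neighbours of a point (empty if it is infinite). -/
noncomputable def nbS (S : Conf (Site d)) (s : S) : Finset S :=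
  if h : {s' : S | VorNeighbor S s s'}.Finite then h.toFinset else ∅

/-- All points have finitely many neighbours. -/
def FiniteDegrees (S : Conf (Site d)) : Prop := ∀ s ∈ S, degE s S ≠ ⊤

theorem FiniteDegrees.mem_nbS (hS : FiniteDegrees S) {s s' : S} :
    s' ∈ nbS S s ↔ VorNeighbor S s s' := by
  have h := degE_ne_top_iff.1 (hS s s.2)
  rw [nbS, dif_pos h, Finite.mem_toFinset]
  exact Iff.rfl

theorem notMem_nbS (S : Conf (Site d)) (s : S) : s ∉ nbS S s := by
  unfold nbS
  split_ifs with h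
  · rw [Finite.mem_toFinset]
    exact fun h' => h'.2.2.1 rfl
  · exact Finset.notMem_empty s

theorem FiniteDegrees.nbS_symm (hS : FiniteDegrees S) : ∀ s, ∀ s' ∈ nbS S s, s ∈ nbS S s' :=
  fun _ _ h => hS.mem_nbS.2 (hS.mem_nbS.1 h).symm

theorem FiniteDegrees.tsum_cond_mul (hS : FiniteDegrees S) (s : S) (φ : S → ℝ) :
    ∑' s' : S, cond s s' S * φ s' = ∑ s' ∈ nbS S s, φ s' := by
  classical
  rw [tsum_eq_sum (s := nbS S s) fun s' hs' => by
    rw [cond, if_neg fun h => hs' (hS.mem_nbS.2 h), zero_mul]]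
  exact Finset.sum_congr rfl fun s' hs' => by rw [cond, if_pos (hS.mem_nbS.1 hs'), one_mul]

theorem FiniteDegrees.tsum_ofReal_cond_mul (hS : FiniteDegrees S) (s : S) (φ : S → ℝ≥0∞) :
    ∑' s' : S, ENNReal.ofReal (cond s s' S) * φ s' = ∑ s' ∈ nbS S s, φ s' := by
  classical
  rw [tsum_eq_sum (s := nbS S s) fun s' hs' => by
    rw [ofReal_cond, if_neg fun h => hs' (hS.mem_nbS.2 h), zero_mul]]
  exact Finset.sum_congr rfl fun s' hs' => by
    rw [ofReal_cond, if_pos (hS.mem_nbS.1 hs'), one_mul]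

theorem FiniteDegrees.deg_eq (hS : FiniteDegrees S) (s : S) : deg s S = (nbS S s).card := by
  have := hS.tsum_cond_mul s fun _ => 1
  simpa [deg] using this

theorem FiniteDegrees.degE_eq (hS : FiniteDegrees S) (s : S) : degE s S = (nbS S s).card := by
  have := hS.tsum_ofReal_cond_mul s fun _ => 1
  simpa [degE] using this

theorem FiniteDegrees.inv_deg_mul_lap (hS : FiniteDegrees S) (η : Site d → ℝ) (s : S) :
    (deg s S)⁻¹ * lap S η s = disc (nbS S) (fun x : S => η x) s := by
  rw [hS.deg_eq, lap, hS.tsum_cond_mul s fun s' => η s' - η s, disc]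

theorem FiniteDegrees.lap_eq (hS : FiniteDegrees S) (η : Site d → ℝ) (s : S) :
    lap S η s = deg s S * disc (nbS S) (fun x : S => η x) s := by
  rcases (nbS S s).eq_empty_or_nonempty with h | h
  · rw [lap, hS.tsum_cond_mul s fun s' => η s' - η s]
    simp [disc, h]
  · rw [← hS.inv_deg_mul_lap, mul_inv_cancel_left₀]
    rw [hS.deg_eq]
    exact_mod_cast h.card_ne_zero

/-- This links the real-valued walk to the walk on the abstract graph with values in `ℝ≥0∞`, where
series need no summability. -/
theorem FiniteDegrees.walkProb_eq (hS : FiniteDegrees S) (N : Site d → Conf ℝ) (k : ℕ) (s : S)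
    (t : ℝ) (s' : S) :
    walkProb S N k s t s' = (graphWalk (nbS S) (fun x : S => N x) k s t s').toReal := by
  classical
  induction k generalizing s t with
  | zero =>
    rw [walkProb, graphWalk]
    by_cases h : epochs (N s) t = ∅ ∧ s = s'
    · rw [if_pos ⟨h.1, congrArg _ h.2⟩, if_pos h, ENNReal.toReal_one]
    · rw [if_neg fun h' => h ⟨h'.1, Subtype.ext h'.2⟩, if_neg h, ENNReal.toReal_zero]
  | succ k ih =>
    by_cases h : epochs (N s) t = ∅
    · rw [walkProb, if_pos h, graphWalk_succ_of_eq_empty (N := fun x : S => N x) h,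
        ENNReal.toReal_zero]
    · have hle : ∀ (x : S) (u : ℝ), graphWalk (nbS S) (fun x : S => N x) k x u s' ≠ ⊤ :=
        fun x u => ne_top_of_le_ne_top (graphTrans_ne_top (nb := nbS S) x s' u) (ENNReal.le_tsum k)
      rw [walkProb, if_neg h, graphWalk_succ_of_ne_empty (N := fun x : S => N x) h,
        toReal_nbAvg fun x => hle x _, nbMean]
      have hterm : ∀ x : S, cond s x S / deg s S *
          walkProb S N k x (sSup (epochs (N s) t)) s' = (deg s S)⁻¹ * (cond s x S *
            (graphWalk (nbS S) (fun x : S => N x) k x (sSup (epochs (N s) t)) s').toReal) := by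
        intro x; rw [ih]; ring
      rw [tsum_congr hterm, tsum_mul_left, hS.tsum_cond_mul s fun x =>
        (graphWalk (nbS S) (fun x : S => N x) k x (sSup (epochs (N s) t)) s').toReal, hS.deg_eq]

theorem FiniteDegrees.transProb_eq (hS : FiniteDegrees S) (N : Site d → Conf ℝ) (t : ℝ)
    (s s' : S) :
    transProb S N t s s' = (graphTrans (nbS S) (fun x : S => N x) t s s').toReal := by
  rw [transProb, graphTrans, ENNReal.tsum_toReal_eq fun k =>
    ne_top_of_le_ne_top (graphTrans_ne_top s s' t) (ENNReal.le_tsum k)]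
  exact tsum_congr fun k => hS.walkProb_eq N k s t s'

theorem FiniteDegrees.harness_eq (hS : FiniteDegrees S) (N : Site d → Conf ℝ) (γ : Site d → ℝ)
    (t : ℝ) (s : S) :
    harness S N γ t s = graphHarness (nbS S) (fun x : S => N x) (fun x : S => γ x) t s :=
  tsum_congr fun s' => by rw [hS.transProb_eq]

end Link

/-! ### Dependence of the harness process on its data -/

section Data

variable {d : ℕ}

theorem walkProb_congr {S : Conf (Site d)} {N N' : Site d → Conf ℝ} (h : ∀ x ∈ S, N x = N' x)
    (k : ℕ) {s : Site d} (hs : s ∈ S) (t : ℝ) (s' : Site d) :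
    walkProb S N k s t s' = walkProb S N' k s t s' := by
  classical
  induction k generalizing s t with
  | zero => rw [walkProb, walkProb, h s hs]
  | succ k ih =>
    rw [walkProb, walkProb, h s hs]
    simp_rw [fun s'' : S => fun u => ih s''.2 u]

theorem harness_congr {S : Conf (Site d)} {N N' : Site d → Conf ℝ} (h : ∀ x ∈ S, N x = N' x)
    {γ γ' : Site d → ℝ} (hγ : ∀ x ∈ S, γ x = γ' x) (t : ℝ) {s : Site d} (hs : s ∈ S) :
    harness S N γ t s = harness S N' γ' t s :=
  tsum_congr fun s' => by
    rw [hγ s' s'.2, transProb, transProb, tsum_congr fun k => walkProb_congr h k hs t s']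

theorem walkProb_congr_epochs (S : Conf (Site d)) {N : Site d → Conf ℝ} {s : Site d} {t u : ℝ}
    (h : epochs (N s) t = epochs (N s) u) (k : ℕ) (s' : Site d) :
    walkProb S N k s t s' = walkProb S N k s u s' := by
  classical
  cases k with
  | zero => rw [walkProb, walkProb, h]
  | succ k => rw [walkProb, walkProb, h]

theorem transProb_congr_epochs (S : Conf (Site d)) {N : Site d → Conf ℝ} {s : Site d} {t u : ℝ}
    (h : epochs (N s) t = epochs (N s) u) (s' : Site d) :
    transProb S N t s s' = transProb S N u s s' :=
  tsum_congr fun k => walkProb_congr_epochs S h k s'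

theorem harness_congr_epochs (S : Conf (Site d)) {N : Site d → Conf ℝ} {s : Site d} {t u : ℝ}
    (h : epochs (N s) t = epochs (N s) u) (γ : Site d → ℝ) :
    harness S N γ t s = harness S N γ u s :=
  tsum_congr fun s' => by rw [transProb_congr_epochs S h]

theorem walkProb_shift (x : Site d) (S : Conf (Site d)) (N : Site d → Conf ℝ) (k : ℕ)
    (s : Site d) (t : ℝ) (s' : Site d) :
    walkProb (shift x S) N k (s - x) t (s' - x) =
      walkProb S (fun y => N (y - x)) k s t s' := by
  classical
  induction k generalizing s t with
  | zero => rw [walkProb, walkProb]; simp only [sub_left_inj]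
  | succ k ih =>
    rw [walkProb, walkProb, ← (shiftEquiv x S).tsum_eq]
    refine if_congr Iff.rfl rfl (tsum_congr fun s'' => ?_)
    change cond (s - x) (s'' - x) (shift x S) / deg (s - x) (shift x S) *
      walkProb (shift x S) N k (s'' - x) _ (s' - x) = _
    rw [cond_shift, deg_shift, ih]

theorem harness_shift (x : Site d) (S : Conf (Site d)) (N : Site d → Conf ℝ) (γ : Site d → ℝ)
    (t : ℝ) (s : Site d) :
    harness (shift x S) N γ t (s - x) =
      harness S (fun y => N (y - x)) (fun y => γ (y - x)) t s := by
  rw [harness, harness, ← (shiftEquiv x S).tsum_eq]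
  refine tsum_congr fun s' => ?_
  change transProb (shift x S) N t (s - x) (s' - x) * γ (s' - x) = _
  rw [transProb, transProb, tsum_congr fun k => walkProb_shift x S N k s t s']

theorem lap_shift (x : Site d) (S : Conf (Site d)) (η : Site d → ℝ) (s : Site d) :
    lap (shift x S) η (s - x) = lap S (fun y => η (y - x)) s := by
  rw [lap, lap, ← (shiftEquiv x S).tsum_eq]
  refine tsum_congr fun s' => ?_
  change cond (s - x) (s' - x) (shift x S) * (η (s' - x) - η (s - x)) = _
  rw [cond_shift]

theorem measurable_walkProb {C : Type*} [MeasurableSpace C] {S : C → Conf (Site d)}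
    (hS : Measurable S) {N : C → Site d → Conf ℝ}
    (hN : Measurable fun p : C × Site d => N p.1 p.2) (k : ℕ) :
    Measurable fun p : C × Site d × ℝ × Site d =>
      walkProb (S p.1) (N p.1) k p.2.1 p.2.2.1 p.2.2.2 := by
  classical
  have hN' : Measurable fun p : C × Site d × ℝ × Site d => N p.1 p.2.1 :=
    hN.comp (measurable_fst.prodMk (measurable_fst.comp measurable_snd))
  have ht : Measurable fun p : C × Site d × ℝ × Site d => p.2.2.1 := by fun_prop
  have he := measurableSet_epochs_eq_empty hN' ht
  induction k with
  | zero =>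
    have h2 : MeasurableSet {p : C × Site d × ℝ × Site d | p.2.1 = p.2.2.2} :=
      measurableSet_eq_fun (by fun_prop) (by fun_prop)
    exact Measurable.ite (he.inter h2) measurable_const measurable_const
  | succ k ih =>
    refine Measurable.ite he measurable_const ?_
    have hS' : Measurable fun q : (C × Site d × ℝ × Site d) × Site d => S q.1.1 :=
      hS.comp (measurable_fst.comp measurable_fst)
    refine measurable_tsum_conf_real (C := C × Site d × ℝ × Site d)
      (g := fun p s'' => cond p.2.1 s'' (S p.1) / deg p.2.1 (S p.1) *
        walkProb (S p.1) (N p.1) k s'' (sSup (epochs (N p.1 p.2.1) p.2.2.1)) p.2.2.2)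
      (hS.comp measurable_fst) ?_
    refine ((measurable_cond hS' (by fun_prop) measurable_snd).div
      (measurable_deg hS' (by fun_prop))).mul ?_
    exact ih.comp ((measurable_fst.comp measurable_fst).prodMk (measurable_snd.prodMk
      (((measurable_sSup_epochs hN' ht).comp measurable_fst).prodMk
        ((by fun_prop : Measurable fun p : C × Site d × ℝ × Site d => p.2.2.2).comp
          measurable_fst))))

theorem measurable_transProb {C : Type*} [MeasurableSpace C] {S : C → Conf (Site d)}
    (hS : Measurable S) {N : C → Site d → Conf ℝ}
    (hN : Measurable fun p : C × Site d => N p.1 p.2) :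
    Measurable fun p : C × Site d × ℝ × Site d =>
      transProb (S p.1) (N p.1) p.2.2.1 p.2.1 p.2.2.2 :=
  measurable_tsum_real fun k => measurable_walkProb hS hN k

theorem measurable_harness {C : Type*} [MeasurableSpace C] {S : C → Conf (Site d)}
    (hS : Measurable S) {N : C → Site d → Conf ℝ}
    (hN : Measurable fun p : C × Site d => N p.1 p.2) {γ : C → Site d → ℝ}
    (hγ : Measurable fun p : C × Site d => γ p.1 p.2) {t : C → ℝ} (ht : Measurable t)
    {s : C → Site d} (hs : Measurable s) :
    Measurable fun c => harness (S c) (N c) (γ c) (t c) (s c) := by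
  refine measurable_tsum_conf_real (g := fun c s' =>
    transProb (S c) (N c) (t c) (s c) s' * γ c s') hS (Measurable.mul ?_ hγ)
  exact (measurable_transProb hS hN).comp (measurable_fst.prodMk ((hs.comp measurable_fst).prodMk
    ((ht.comp measurable_fst).prodMk measurable_snd)))

theorem measurable_lap {C : Type*} [MeasurableSpace C] {S : C → Conf (Site d)}
    (hS : Measurable S) {η : C → Site d → ℝ} (hη : Measurable fun p : C × Site d => η p.1 p.2)
    {s : C → Site d} (hs : Measurable s) : Measurable fun c => lap (S c) (η c) (s c) :=
  measurable_tsum_conf_real (g := fun c s' => cond (s c) s' (S c) * (η c s' - η c (s c))) hS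
    ((measurable_cond (hS.comp measurable_fst) (hs.comp measurable_fst) measurable_snd).mul
      (hη.sub (hη.comp (measurable_fst.prodMk (hs.comp measurable_fst)))))

/-- The law of clocks attached to points with distinct indices. -/
theorem measurePreserving_clocks {Ω : Type*} [MeasurableSpace Ω] {Q : Measure Ω}
    [IsProbabilityMeasure Q] {T : ℕ → Ω → Conf ℝ} (hT : ∀ n, IsPoissonProcess (T n) Q)
    (hT_indep : iIndepFun T Q) {π : Measure (Conf ℝ)} [IsProbabilityMeasure π]
    (hπ : π = Q.map (T 0)) {V : Type*} {i : V → ℕ} (hi : Function.Injective i) :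
    MeasurePreserving (fun ω v => T (i v) ω) Q (clockLaw V π) := by
  have hm : ∀ v, Measurable (T (i v)) := fun v => (hT _).measurable
  refine ⟨measurable_pi_iff.2 hm, ?_⟩
  rw [(iIndepFun_iff_map_fun_eq_infinitePi_map hm).1 (hT_indep.precomp hi), clockLaw]
  congr 1
  funext v
  rw [hπ]
  exact (hT _).map_eq (hT 0)

end Data

end Harness

namespace Harness

/-! ### Invariance of the means under functions that are constant along edges -/

section AddConst

variable {V : Type*} [Countable V] {π : Measure (Conf ℝ)} [IsProbabilityMeasure π]
  {nb : V → Finset V} {γ δ : V → ℝ}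

theorem ae_graphHarness_add (hgood : ∀ᵐ N ∂(clockLaw V π), GoodPath nb γ N)
    (hδ : ∀ s, ∀ s' ∈ nb s, δ s' = δ s) (t : ℝ) :
    ∀ᵐ N ∂(clockLaw V π), ∀ s, (nb s).Nonempty →
      graphHarness nb N (fun x => γ x + δ x) t s = graphHarness nb N γ t s + δ s :=
  hgood.mono fun _ hN _ hs => hN.graphHarness_add hδ t hs

theorem ae_disc_graphHarness_add (hgood : ∀ᵐ N ∂(clockLaw V π), GoodPath nb γ N)
    (hsymm : ∀ s, ∀ s' ∈ nb s, s ∈ nb s') (hδ : ∀ s, ∀ s' ∈ nb s, δ s' = δ s) (t : ℝ) :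
    ∀ᵐ N ∂(clockLaw V π), ∀ s, disc nb (graphHarness nb N (fun x => γ x + δ x) t) s =
      disc nb (graphHarness nb N γ t) s := by
  filter_upwards [ae_graphHarness_add hgood hδ t] with N hN s
  rw [disc, disc]
  congr 1
  refine Finset.sum_congr rfl fun s' h => ?_
  rw [hN s ⟨s', h⟩, hN s' ⟨s, hsymm s s' h⟩, hδ s s' h]
  ring

theorem discMean_add_const (hgood : ∀ᵐ N ∂(clockLaw V π), GoodPath nb γ N)
    (hsymm : ∀ s, ∀ s' ∈ nb s, s ∈ nb s') (hδ : ∀ s, ∀ s' ∈ nb s, δ s' = δ s) (t : ℝ) (s : V) :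
    discMean π nb (fun x => γ x + δ x) t s = discMean π nb γ t s := by
  refine lintegral_congr_ae ?_
  filter_upwards [ae_disc_graphHarness_add hgood hsymm hδ t] with N hN
  rw [hN s]

theorem ringMean_add_const (hgood : ∀ᵐ N ∂(clockLaw V π), GoodPath nb γ N)
    (hsymm : ∀ s, ∀ s' ∈ nb s, s ∈ nb s') (hδ : ∀ s, ∀ s' ∈ nb s, δ s' = δ s) (t : ℝ) {s s' : V}
    (h : s' ∈ nb s) :
    ringMean π nb (fun x => γ x + δ x) t s s' = ringMean π nb γ t s s' := by
  refine lintegral_congr_ae ?_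
  filter_upwards [ae_graphHarness_add hgood hδ t, ae_disc_graphHarness_add hgood hsymm hδ t]
    with N hN hN'
  have h1 := hN' s
  rw [disc_eq ⟨s', h⟩, disc_eq ⟨s', h⟩, hN s ⟨s', h⟩] at h1
  rw [hN s' ⟨s, hsymm s s' h⟩, hδ s s' h]
  congr 2
  linarith

end AddConst

/-! ### Mean values for a fixed configuration -/

section Quenched

variable {d : ℕ} {Ω : Type*} [MeasurableSpace Ω]

/-- A measurable system of clocks and a surface with covariant gradient. -/
structure Model (Q : Measure Ω) (T : ℕ → Ω → Conf ℝ) (idx : Site d → Conf (Site d) → ℕ)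
    (γ : Site d → Conf (Site d) → ℝ) : Prop where
  poisson : ∀ n, IsPoissonProcess (T n) Q
  indep : iIndepFun T Q
  measurable_idx : Measurable fun p : Site d × Conf (Site d) => idx p.1 p.2
  injOn_idx : ∀ S : Conf (Site d), InjOn (fun s => idx s S) (S : Set (Site d))
  measurable_surface : Measurable fun p : Site d × Conf (Site d) => γ p.1 p.2
  covariant : IsCovariant fun s s' S => grad S (fun x => γ x S) s s'

/-- The harness process with initial surface `γ` as a function of all its data. -/
noncomputable def height (T : ℕ → Ω → Conf ℝ) (idx : Site d → Conf (Site d) → ℕ)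
    (γ : Site d → Conf (Site d) → ℝ) (S : Conf (Site d)) (ω : Ω) (t : ℝ) (s : Site d) : ℝ :=
  harness S (fun x => T (idx x S) ω) (fun x => γ x S) t s

variable (Q : Measure Ω) (T : ℕ → Ω → Conf ℝ) (idx : Site d → Conf (Site d) → ℕ)
  (γ : Site d → Conf (Site d) → ℝ)

/-- The mean square gradient along an edge of a fixed configuration. -/
noncomputable def edgeQ (t : ℝ) (x y : Site d) (S : Conf (Site d)) : ℝ≥0∞ :=
  ∫⁻ ω, ENNReal.ofReal ((height T idx γ S ω t y - height T idx γ S ω t x) ^ 2) ∂Q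

/-- The mean square normalized Laplacian for a fixed configuration. -/
noncomputable def discQ (t : ℝ) (x : Site d) (S : Conf (Site d)) : ℝ≥0∞ :=
  ∫⁻ ω, ENNReal.ofReal (((deg x S)⁻¹ * lap S (height T idx γ S ω t) x) ^ 2) ∂Q

/-- The mean square gradient along an edge after an update at its first end. -/
noncomputable def ringQ (t : ℝ) (x y : Site d) (S : Conf (Site d)) : ℝ≥0∞ :=
  ∫⁻ ω, ENNReal.ofReal ((height T idx γ S ω t y - height T idx γ S ω t x -
    (deg x S)⁻¹ * lap S (height T idx γ S ω t) x) ^ 2) ∂Q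

/-- The bound of the mean square displacement in `k` steps. -/
noncomputable def stepBoundE : ℕ → Site d → Conf (Site d) → ℝ≥0∞
  | 0, _, _ => 0
  | k + 1, s, S => (degE s S)⁻¹ * ∑' s' : S, ENNReal.ofReal (cond s s' S) *
      (2 * ENNReal.ofReal (grad S (fun x => γ x S) s s' ^ 2) + 2 * stepBoundE k s' S)

/-- The bound of the mean square displacement up to time `t`. -/
noncomputable def dispE (t : ℝ) (s : Site d) (S : Conf (Site d)) : ℝ≥0∞ :=
  ∑' k : ℕ, ENNReal.ofReal (t ^ k / k.factorial) * stepBoundE γ k s S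

/-- The configurations on which the harness process is well defined. -/
structure GoodConf (S : Conf (Site d)) : Prop where
  finite : FiniteDegrees S
  disp : ∀ s ∈ S, ∀ n : ℕ, dispE γ n s S ≠ ⊤

variable {Q T idx γ}

theorem Model.measurable_height [IsProbabilityMeasure Q] (h : Model Q T idx γ) {C : Type*}
    [MeasurableSpace C]
    {S : C → Conf (Site d)} (hS : Measurable S) {ω : C → Ω} (hω : Measurable ω) {t : C → ℝ}
    (ht : Measurable t) {s : C → Site d} (hs : Measurable s) :
    Measurable fun c => height T idx γ (S c) (ω c) (t c) (s c) := by
  have hT : Measurable fun p : Ω × ℕ => T p.2 p.1 :=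
    measurable_from_prod_countable_left fun n => (h.poisson n).measurable
  refine measurable_harness hS (N := fun c x => T (idx x (S c)) (ω c)) ?_
    (γ := fun c x => γ x (S c)) ?_ ht hs
  · exact hT.comp ((hω.comp measurable_fst).prodMk
      (h.measurable_idx.comp (measurable_snd.prodMk (hS.comp measurable_fst))))
  · exact h.measurable_surface.comp (measurable_snd.prodMk (hS.comp measurable_fst))

theorem Model.measurable_lap_height [IsProbabilityMeasure Q] (h : Model Q T idx γ) {C : Type*}
    [MeasurableSpace C] {S : C → Conf (Site d)} (hS : Measurable S) {ω : C → Ω}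
    (hω : Measurable ω) {t : C → ℝ} (ht : Measurable t) {s : C → Site d} (hs : Measurable s) :
    Measurable fun c => lap (S c) (height T idx γ (S c) (ω c) (t c)) (s c) :=
  measurable_lap hS (η := fun c => height T idx γ (S c) (ω c) (t c))
    (h.measurable_height (hS.comp measurable_fst) (hω.comp measurable_fst)
      (ht.comp measurable_fst) measurable_snd) hs

theorem Model.measurable_edgeQ [IsProbabilityMeasure Q] (h : Model Q T idx γ) {C : Type*}
    [MeasurableSpace C] {S : C → Conf (Site d)} (hS : Measurable S) {t : C → ℝ}
    (ht : Measurable t) {x y : C → Site d} (hx : Measurable x) (hy : Measurable y) :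
    Measurable fun c => edgeQ Q T idx γ (t c) (x c) (y c) (S c) := by
  have h1 := fun {z : C → Site d} (hz : Measurable z) =>
    h.measurable_height (C := C × Ω) (hS.comp measurable_fst) measurable_snd
      (ht.comp measurable_fst) (hz.comp measurable_fst)
  exact (((h1 hy).sub (h1 hx)).pow_const 2).ennreal_ofReal.lintegral_prod_right'

theorem Model.measurable_discQ [IsProbabilityMeasure Q] (h : Model Q T idx γ) {C : Type*}
    [MeasurableSpace C] {S : C → Conf (Site d)} (hS : Measurable S) {t : C → ℝ}
    (ht : Measurable t) {x : C → Site d} (hx : Measurable x) :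
    Measurable fun c => discQ Q T idx γ (t c) (x c) (S c) := by
  have h1 := h.measurable_lap_height (C := C × Ω) (hS.comp measurable_fst) measurable_snd
      (ht.comp measurable_fst) (hx.comp measurable_fst)
  exact ((((measurable_deg hS hx).comp measurable_fst).inv.mul h1).pow_const
    2).ennreal_ofReal.lintegral_prod_right'

theorem Model.measurable_ringQ [IsProbabilityMeasure Q] (h : Model Q T idx γ) {C : Type*}
    [MeasurableSpace C] {S : C → Conf (Site d)} (hS : Measurable S) {t : C → ℝ}
    (ht : Measurable t) {x y : C → Site d} (hx : Measurable x) (hy : Measurable y) :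
    Measurable fun c => ringQ Q T idx γ (t c) (x c) (y c) (S c) := by
  have h1 := h.measurable_lap_height (C := C × Ω) (hS.comp measurable_fst) measurable_snd
      (ht.comp measurable_fst) (hx.comp measurable_fst)
  have h2 := fun {z : C → Site d} (hz : Measurable z) =>
    h.measurable_height (C := C × Ω) (hS.comp measurable_fst) measurable_snd
      (ht.comp measurable_fst) (hz.comp measurable_fst)
  exact ((((h2 hy).sub (h2 hx)).sub (((measurable_deg hS hx).comp measurable_fst).inv.mul
    h1)).pow_const 2).ennreal_ofReal.lintegral_prod_right'

theorem measurable_grad {η : Site d → Conf (Site d) → ℝ}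
    (hη : Measurable fun p : Site d × Conf (Site d) => η p.1 p.2) {C : Type*} [MeasurableSpace C]
    {S : C → Conf (Site d)} (hS : Measurable S) {x y : C → Site d} (hx : Measurable x)
    (hy : Measurable y) : Measurable fun c => grad (S c) (fun z => η z (S c)) (x c) (y c) :=
  (measurable_cond hS hx hy).mul ((hη.comp (hy.prodMk hS)).sub (hη.comp (hx.prodMk hS)))

theorem measurable_stepBoundE (hγ : Measurable fun p : Site d × Conf (Site d) => γ p.1 p.2)
    (k : ℕ) : Measurable fun p : Site d × Conf (Site d) => stepBoundE γ k p.1 p.2 := by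
  induction k with
  | zero => exact measurable_const
  | succ k ih =>
    refine (measurable_degE measurable_snd measurable_fst).inv.mul
      (measurable_tsum_conf (C := Site d × Conf (Site d)) (g := fun p s' =>
        ENNReal.ofReal (cond p.1 s' p.2) *
          (2 * ENNReal.ofReal (grad p.2 (fun x => γ x p.2) p.1 s' ^ 2) +
            2 * stepBoundE γ k s' p.2)) measurable_snd ?_)
    have hS : Measurable fun q : (Site d × Conf (Site d)) × Site d => q.1.2 := by fun_prop
    have hs : Measurable fun q : (Site d × Conf (Site d)) × Site d => q.1.1 := by fun_prop
    have h1 := ((measurable_grad hγ hS hs measurable_snd).pow_const 2).ennreal_ofReal.const_mul 2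
    have h2 := (ih.comp (measurable_snd.prodMk hS)).const_mul 2
    exact (measurable_cond hS hs measurable_snd).ennreal_ofReal.mul (h1.add h2)

theorem measurable_dispE (hγ : Measurable fun p : Site d × Conf (Site d) => γ p.1 p.2)
    (t : ℝ) : Measurable fun p : Site d × Conf (Site d) => dispE γ t p.1 p.2 :=
  Measurable.tsum fun k => (measurable_stepBoundE hγ k).const_mul _

/-- Only degrees and gradients enter, so covariance of the gradient suffices. -/
theorem stepBoundE_shift (hγ : IsCovariant fun s s' S => grad S (fun x => γ x S) s s') (k : ℕ)
    {S : Conf (Site d)} {x s : Site d} (hx : x ∈ S) (hs : s ∈ S) :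
    stepBoundE γ k (s - x) (shift x S) = stepBoundE γ k s S := by
  induction k generalizing s with
  | zero => rfl
  | succ k ih =>
    rw [stepBoundE, stepBoundE, degE_shift, ← (shiftEquiv x S).tsum_eq]
    congr 1
    refine tsum_congr fun s' => ?_
    change ENNReal.ofReal (cond (s - x) (s' - x) (shift x S)) *
      (2 * ENNReal.ofReal (grad (shift x S) (fun z => γ z (shift x S)) (s - x) (s' - x) ^ 2) +
        2 * stepBoundE γ k (s' - x) (shift x S)) = _
    rw [cond_shift, ih s'.2]
    have := hγ S x hx s hs s' s'.2
    simp only at this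
    rw [this]

theorem dispE_shift (hγ : IsCovariant fun s s' S => grad S (fun x => γ x S) s s') (t : ℝ)
    {S : Conf (Site d)} {x s : Site d} (hx : x ∈ S) (hs : s ∈ S) :
    dispE γ t (s - x) (shift x S) = dispE γ t s S :=
  tsum_congr fun k => by rw [stepBoundE_shift hγ k hx hs]

theorem FiniteDegrees.grad_eq {S : Conf (Site d)} (hS : FiniteDegrees S) (η : Site d → ℝ)
    {s s' : S} (h : s' ∈ nbS S s) : grad S η s s' = η s' - η s := by
  classical
  rw [grad, cond, if_pos (hS.mem_nbS.1 h), one_mul]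

theorem FiniteDegrees.stepBoundE_eq {S : Conf (Site d)} (hS : FiniteDegrees S) (k : ℕ) (s : S) :
    stepBoundE γ k s S = stepBound (nbS S) (fun x : S => γ x S) k s := by
  induction k generalizing s with
  | zero => rfl
  | succ k ih =>
    rw [stepBoundE, stepBound, hS.degE_eq, nbAvg, hS.tsum_ofReal_cond_mul s fun s' =>
      (2 * ENNReal.ofReal (grad S (fun x => γ x S) s s' ^ 2) + 2 * stepBoundE γ k s' S)]
    congr 1
    refine Finset.sum_congr rfl fun s' hs' => ?_
    rw [ih, hS.grad_eq _ hs']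

theorem FiniteDegrees.dispE_eq {S : Conf (Site d)} (hS : FiniteDegrees S) (t : ℝ) (s : S) :
    dispE γ t s S = displacementBound (nbS S) (fun x : S => γ x S) t s :=
  tsum_congr fun k => by rw [hS.stepBoundE_eq]

/-! ### Means for a fixed configuration and change of viewpoint -/

section Law

variable [IsProbabilityMeasure Q] {π : Measure (Conf ℝ)} [IsProbabilityMeasure π]

theorem Model.isPoisson (h : Model Q T idx γ) (hπ : π = Q.map (T 0)) : IsPoissonProcess id π :=
  hπ ▸ (h.poisson 0).id_map

theorem GoodConf.ae_goodPath (h : Model Q T idx γ) (hπ : π = Q.map (T 0)) {S : Conf (Site d)}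
    (hS : GoodConf γ S) :
    ∀ᵐ N ∂(clockLaw S π), GoodPath (nbS S) (fun x : S => γ x S) N :=
  Harness.ae_goodPath (h.isPoisson hπ) (notMem_nbS S) hS.finite.nbS_symm fun s n => by
    rw [← hS.finite.dispE_eq]
    exact hS.disp s s.2 n

/-- Every injective indexing attaches i.i.d. clocks to the points, so means do not depend on the
enumeration. -/
theorem Model.lintegral_comp (h : Model Q T idx γ) (hπ : π = Q.map (T 0)) {V : Type*} [Countable V]
    {i : V → ℕ} (hi : Function.Injective i) {Φ : (V → ℝ) → ℝ≥0∞} (hΦ : Measurable Φ)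
    (nb : V → Finset V) (γ' : V → ℝ) (t : ℝ) :
    ∫⁻ ω, Φ (graphHarness nb (fun v => T (i v) ω) γ' t) ∂Q =
      ∫⁻ N, Φ (graphHarness nb N γ' t) ∂(clockLaw V π) :=
  (measurePreserving_clocks h.poisson h.indep hπ hi).lintegral_comp
    (measurable_comp_graphHarness hΦ t)

/-- The surface seen from the point `x`. -/
def seenFrom (γ : Site d → Conf (Site d) → ℝ) (x : Site d) (S : Conf (Site d)) : S → ℝ :=
  fun y => γ ((y : Site d) - x) (shift x S)

theorem Model.injective_idx_shift (h : Model Q T idx γ) (x : Site d) (S : Conf (Site d)) :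
    Function.Injective fun y : S => idx ((y : Site d) - x) (shift x S) := by
  intro y z hyz
  have := h.injOn_idx (shift x S) (shiftEquiv x S y).2 (shiftEquiv x S z).2 hyz
  exact (shiftEquiv x S).injective (Subtype.ext this)

theorem Model.injective_idx (h : Model Q T idx γ) (S : Conf (Site d)) :
    Function.Injective fun y : S => idx y S :=
  fun y z hyz => Subtype.ext (h.injOn_idx S y.2 z.2 hyz)

theorem FiniteDegrees.height_shift {S : Conf (Site d)} (hS : FiniteDegrees S) (x : Site d) (ω : Ω)
    (t : ℝ) (y : S) :
    height T idx γ (shift x S) ω t (y - x) = graphHarness (nbS S)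
      (fun v : S => T (idx ((v : Site d) - x) (shift x S)) ω) (seenFrom γ x S) t y := by
  rw [height, harness_shift, hS.harness_eq]
  rfl

theorem FiniteDegrees.height_eq {S : Conf (Site d)} (hS : FiniteDegrees S) (ω : Ω)
    (t : ℝ) (y : S) :
    height T idx γ S ω t y = graphHarness (nbS S)
      (fun v : S => T (idx v S) ω) (fun v : S => γ v S) t y :=
  hS.harness_eq _ _ _ _

theorem FiniteDegrees.disc_height_shift {S : Conf (Site d)} (hS : FiniteDegrees S) (x : Site d)
    (ω : Ω) (t : ℝ) (y : S) :
    (deg ((y : Site d) - x) (shift x S))⁻¹ * lap (shift x S) (height T idx γ (shift x S) ω t) (y - x) =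
      disc (nbS S) (graphHarness (nbS S)
        (fun v : S => T (idx ((v : Site d) - x) (shift x S)) ω) (seenFrom γ x S) t) y := by
  rw [deg_shift, lap_shift, hS.inv_deg_mul_lap]
  congr 1
  exact funext fun v => hS.height_shift x ω t v

theorem FiniteDegrees.disc_height {S : Conf (Site d)} (hS : FiniteDegrees S)
    (ω : Ω) (t : ℝ) (y : S) :
    (deg y S)⁻¹ * lap S (height T idx γ S ω t) y =
      disc (nbS S) (graphHarness (nbS S)
        (fun v : S => T (idx v S) ω) (fun v : S => γ v S) t) y := by
  rw [hS.inv_deg_mul_lap]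
  congr 1
  exact funext fun v => hS.height_eq ω t v

/-- Equal gradients mean that the surfaces seen from two viewpoints differ by a function that takes
the same value at both ends of each edge. -/
theorem Model.seenFrom_sub (h : Model Q T idx γ) {S : Conf (Site d)} (hS : FiniteDegrees S)
    {x : Site d} (hx : x ∈ S) (s s' : S) (hs : s' ∈ nbS S s) :
    seenFrom γ x S s' - γ s' S = seenFrom γ x S s - γ s S := by
  classical
  have h1 := h.covariant S x hx s s.2 s' s'.2
  simp only [grad, cond_shift] at h1
  rw [cond, if_pos (hS.mem_nbS.1 hs), one_mul, one_mul] at h1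
  simp only [seenFrom]
  linarith

theorem seenFrom_eq_add (x : Site d) (S : Conf (Site d)) :
    seenFrom γ x S = fun y : S => γ y S + (seenFrom γ x S y - γ y S) := by
  funext y; ring

/-- Recentring changes the indices of the clocks and the surface. The first does not affect the law
of the clocks, and the second adds a function constant along edges, which the normalized Laplacian
does not see. -/
theorem Model.discQ_shift (h : Model Q T idx γ) (hπ : π = Q.map (T 0)) {S : Conf (Site d)}
    (hS : GoodConf γ S) {x : Site d} (hx : x ∈ S) (t : ℝ) (y : S) :
    discQ Q T idx γ t (y - x) (shift x S) =
      discMean π (nbS S) (fun v : S => γ v S) t y := by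
  rw [discQ, ← discMean_add_const (hS.ae_goodPath h hπ) hS.finite.nbS_symm
    (h.seenFrom_sub hS.finite hx) t y, ← seenFrom_eq_add]
  simp_rw [hS.finite.disc_height_shift]
  exact h.lintegral_comp hπ (h.injective_idx_shift x S) (measurable_ofReal_sq_disc y) _ _ _

theorem Model.ringQ_shift (h : Model Q T idx γ) (hπ : π = Q.map (T 0)) {S : Conf (Site d)}
    (hS : GoodConf γ S) {x : Site d} (hx : x ∈ S) (t : ℝ) {y z : S} (hyz : z ∈ nbS S y) :
    ringQ Q T idx γ t (y - x) (z - x) (shift x S) =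
      ringMean π (nbS S) (fun v : S => γ v S) t y z := by
  rw [ringQ, ← ringMean_add_const (hS.ae_goodPath h hπ) hS.finite.nbS_symm
    (h.seenFrom_sub hS.finite hx) t hyz, ← seenFrom_eq_add]
  simp_rw [hS.finite.disc_height_shift, hS.finite.height_shift, disc_eq ⟨z, hyz⟩,
    sub_sub, add_sub_cancel]
  exact h.lintegral_comp hπ (h.injective_idx_shift x S) (measurable_ofReal_sq_sub_nbMean y z) _ _ _

theorem Model.edgeQ_eq (h : Model Q T idx γ) (hπ : π = Q.map (T 0)) {S : Conf (Site d)}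
    (hS : FiniteDegrees S) (t : ℝ) (y z : S) :
    edgeQ Q T idx γ t y z S = edgeMean π (nbS S) (fun v : S => γ v S) t y z := by
  rw [edgeQ]
  simp_rw [hS.height_eq]
  exact h.lintegral_comp hπ (h.injective_idx S) (measurable_ofReal_sq_sub y z) _ _ _

theorem Model.discQ_eq (h : Model Q T idx γ) (hπ : π = Q.map (T 0)) {S : Conf (Site d)}
    (hS : FiniteDegrees S) (t : ℝ) (y : S) :
    discQ Q T idx γ t y S = discMean π (nbS S) (fun v : S => γ v S) t y := by
  rw [discQ]
  simp_rw [hS.disc_height]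
  exact h.lintegral_comp hπ (h.injective_idx S) (measurable_ofReal_sq_disc y) _ _ _

theorem Model.ringQ_eq (h : Model Q T idx γ) (hπ : π = Q.map (T 0)) {S : Conf (Site d)}
    (hS : FiniteDegrees S) (t : ℝ) {y z : S} (hyz : z ∈ nbS S y) :
    ringQ Q T idx γ t y z S = ringMean π (nbS S) (fun v : S => γ v S) t y z := by
  rw [ringQ]
  simp_rw [hS.disc_height, hS.height_eq, disc_eq ⟨z, hyz⟩, sub_sub, add_sub_cancel]
  exact h.lintegral_comp hπ (h.injective_idx S) (measurable_ofReal_sq_sub_nbMean y z) _ _ _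

end Law

end Quenched

end Harness

namespace Harness

/-! ### Mean values under the Palm measure -/

section PalmLevel

variable {d : ℕ} {Ω : Type*} [MeasurableSpace Ω] {P : Measure (Conf (Site d))}
  [IsProbabilityMeasure P] [IsProbabilityMeasure (palm P)] {Q : Measure Ω}
  [IsProbabilityMeasure Q] {T : ℕ → Ω → Conf ℝ} {idx : Site d → Conf (Site d) → ℕ}
  {γ : Site d → Conf (Site d) → ℝ}

theorem ae_zero_mem_palm : ∀ᵐ S ∂(palm P), (0 : Site d) ∈ S := by
  have hm : MeasurableSet {S : Conf (Site d) | (0 : Site d) ∈ S} :=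
    measurableSet_mem_conf measurable_id measurable_const
  rw [ae_iff, palm_apply (by exact hm.compl)]
  refine (lintegral_congr fun S => ?_).trans lintegral_zero
  rw [Nat.cast_eq_zero, palmCount]
  convert Set.ncard_empty (Site d)
  refine eq_empty_iff_forall_notMem.2 ?_
  rintro s ⟨h1, -, h2⟩
  exact h2 (by rw [mem_conf_shift, zero_add]; exact h1)

/-- Sums over the neighbours of the typical point. -/
theorem measurable_tsum_cond_mul {C : Type*} [MeasurableSpace C] {S : C → Conf (Site d)}
    (hS : Measurable S) {q : C → Site d → ℝ≥0∞} (hq : Measurable fun p : C × Site d => q p.1 p.2) :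
    Measurable fun c => ∑' x : S c, ENNReal.ofReal (cond 0 x (S c)) * q c x :=
  measurable_tsum_conf (g := fun c x => ENNReal.ofReal (cond 0 x (S c)) * q c x) hS
    ((measurable_cond (hS.comp measurable_fst) measurable_const
      measurable_snd).ennreal_ofReal.mul hq)

/-- Mass transport along edges: the roles of the typical point and its neighbour may be exchanged.
Covariance is asked only almost surely and for neighbours, since the means over the clocks have it
only on good configurations. -/
theorem lintegral_palm_edge_swap (hP : ∀ x : Site d, MeasurePreserving (shift x) P P)
    {q : Site d → Site d → Conf (Site d) → ℝ≥0∞}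
    (hq : Measurable fun p : Site d × Site d × Conf (Site d) => q p.1 p.2.1 p.2.2)
    (hcov : ∀ᵐ S ∂(palm P), ∀ x ∈ S, VorNeighbor S x 0 → q 0 (-x) (shift x S) = q x 0 S) :
    ∫⁻ S, ∑' x : S, ENNReal.ofReal (cond 0 x S) * q x 0 S ∂(palm P) =
      ∫⁻ S, ∑' x : S, ENNReal.ofReal (cond 0 x S) * q 0 x S ∂(palm P) := by
  classical
  have hH : Measurable fun p : Site d × Conf (Site d) =>
      ENNReal.ofReal (cond 0 p.1 p.2) * q 0 p.1 p.2 :=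
    (measurable_cond measurable_snd measurable_const measurable_fst).ennreal_ofReal.mul
      (hq.comp (measurable_const.prodMk measurable_id))
  refine Eq.trans ?_ (lintegral_palm_swap hP
    (H := fun x S => ENNReal.ofReal (cond 0 x S) * q 0 x S) hH).symm
  refine lintegral_congr_ae ?_
  filter_upwards [hcov] with S hS
  refine tsum_congr fun x => ?_
  have h1 : cond 0 (-(x : Site d)) (shift x S) = cond 0 x S := by
    have := cond_shift (x : Site d) x 0 S
    rw [sub_self, zero_sub] at this
    rw [this, cond_symm]
  rw [h1, ofReal_cond]
  split_ifs with h
  · rw [hS x x.2 h.symm]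
  · rw [zero_mul, zero_mul]

/-- The standing assumptions in the form in which they are used. -/
structure Setting (P : Measure (Conf (Site d))) (Q : Measure Ω) (T : ℕ → Ω → Conf ℝ)
    (idx : Site d → Conf (Site d) → ℕ) (γ : Site d → Conf (Site d) → ℝ) : Prop where
  model : Model Q T idx γ
  stationary : ∀ x : Site d, MeasurePreserving (shift x) P P
  finite : ∀ᵐ S ∂(palm P), {s | VorNeighbor S 0 s}.Finite
  moment : ∫⁻ S, ∑' x : S, ENNReal.ofReal (cond 0 x S) *
    ENNReal.ofReal (grad S (fun y => γ y S) 0 x ^ 2) ∂(palm P) ≠ ⊤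

theorem Setting.ae_finiteDegrees (h : Setting P Q T idx γ) :
    ∀ᵐ S ∂(palm P), FiniteDegrees S := by
  have hm : MeasurableSet {S : Conf (Site d) | degE 0 S ≠ ⊤} :=
    (measurable_degE measurable_id measurable_const) (measurableSet_singleton ⊤).compl
  filter_upwards [ae_palm_forall h.stationary hm
    (h.finite.mono fun S hS => degE_ne_top_of_finite hS)] with S hS x hx
  have := hS x hx
  have h2 := degE_shift x x S
  rw [sub_self] at h2
  rwa [h2] at this

theorem tsum_ofReal_cond_mul_const (S : Conf (Site d)) (c : ℝ≥0∞) :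
    ∑' x : S, ENNReal.ofReal (cond 0 x S) * c = degE 0 S * c := ENNReal.tsum_mul_right

/-- Weighting by the degree absorbs the factor `1 / deg` of a step, and mass transport returns the
bound at the neighbour to the origin: degree-biased, the environment seen from the walk is
stationary. The recursion is `I (k + 1) ≤ 2 * G + 2 * I k`. -/
theorem Setting.lintegral_stepBoundE_le (h : Setting P Q T idx γ) (k : ℕ) :
    ∫⁻ S, degE 0 S * stepBoundE γ k 0 S ∂(palm P) ≤
      4 ^ k * ∫⁻ S, ∑' x : S, ENNReal.ofReal (cond 0 x S) *
        ENNReal.ofReal (grad S (fun y => γ y S) 0 x ^ 2) ∂(palm P) := by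
  induction k with
  | zero => simp [stepBoundE]
  | succ k ih =>
    set G := ∫⁻ S, ∑' x : S, ENNReal.ofReal (cond 0 x S) *
        ENNReal.ofReal (grad S (fun y => γ y S) 0 x ^ 2) ∂(palm P)
    have hγ := h.model.measurable_surface
    have hm1 : Measurable fun S : Conf (Site d) => ∑' x : S, ENNReal.ofReal (cond 0 x S) *
        ENNReal.ofReal (grad S (fun y => γ y S) 0 x ^ 2) :=
      measurable_tsum_cond_mul (S := fun S : Conf (Site d) => S)
        (q := fun S x => ENNReal.ofReal (grad S (fun y => γ y S) 0 x ^ 2)) measurable_id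
        ((measurable_grad hγ measurable_fst measurable_const
          measurable_snd).pow_const 2).ennreal_ofReal
    have hswap : ∫⁻ S, ∑' x : S, ENNReal.ofReal (cond 0 x S) * stepBoundE γ k x S ∂(palm P) =
        ∫⁻ S, degE 0 S * stepBoundE γ k 0 S ∂(palm P) := by
      rw [← lintegral_palm_edge_swap h.stationary (q := fun _ y S => stepBoundE γ k y S)
        ((measurable_stepBoundE hγ k).comp measurable_snd)
        (Eventually.of_forall fun S x hx hx0 => by
          rw [← zero_sub]; exact stepBoundE_shift h.model.covariant k hx hx0.2.1)]
      exact lintegral_congr fun S => tsum_ofReal_cond_mul_const S _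
    calc ∫⁻ S, degE 0 S * stepBoundE γ (k + 1) 0 S ∂(palm P)
        ≤ ∫⁻ S, (2 * (∑' x : S, ENNReal.ofReal (cond 0 x S) *
            ENNReal.ofReal (grad S (fun y => γ y S) 0 x ^ 2)) +
          2 * ∑' x : S, ENNReal.ofReal (cond 0 x S) * stepBoundE γ k x S) ∂(palm P) := by
          refine lintegral_mono fun S => ?_
          rw [stepBoundE, ← mul_assoc]
          refine (mul_le_of_le_one_left' (ENNReal.mul_inv_le_one _)).trans (le_of_eq ?_)
          rw [← ENNReal.tsum_mul_left, ← ENNReal.tsum_mul_left, ← ENNReal.tsum_add]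
          exact tsum_congr fun x => by ring
      _ = 2 * G + 2 * ∫⁻ S, degE 0 S * stepBoundE γ k 0 S ∂(palm P) := by
          rw [lintegral_add_left (hm1.const_mul 2), lintegral_const_mul _ hm1,
            lintegral_const_mul' _ _ (by simp), hswap]
      _ ≤ 2 * (4 ^ k * G) + 2 * (4 ^ k * G) := by
          gcongr
          exact le_mul_of_one_le_left' (one_le_pow₀ (by norm_num))
      _ = 4 ^ (k + 1) * G := by ring

/-- The sum is dominated by the exponential series of `4 * t` times the initial energy. -/
theorem Setting.lintegral_dispE_ne_top (h : Setting P Q T idx γ) (t : ℝ) :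
    ∫⁻ S, degE 0 S * dispE γ t 0 S ∂(palm P) ≠ ⊤ := by
  have hγ := h.model.measurable_surface
  have hm : ∀ k, Measurable fun S : Conf (Site d) => degE 0 S * stepBoundE γ k 0 S := fun k =>
    (measurable_degE measurable_id measurable_const).mul
      ((measurable_stepBoundE hγ k).comp (measurable_const.prodMk measurable_id))
  have heq : ∀ S, degE 0 S * dispE γ t 0 S =
      ∑' k : ℕ, ENNReal.ofReal (t ^ k / k.factorial) * (degE 0 S * stepBoundE γ k 0 S) := by
    intro S
    rw [dispE, ← ENNReal.tsum_mul_left]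
    exact tsum_congr fun k => by ring
  simp_rw [heq]
  rw [lintegral_tsum fun k => ((hm k).const_mul _).aemeasurable]
  simp_rw [lintegral_const_mul _ (hm _)]
  refine ne_top_of_le_ne_top ?_ (ENNReal.tsum_le_tsum fun k =>
    mul_le_mul_right (h.lintegral_stepBoundE_le k) _)
  simp_rw [← mul_assoc]
  rw [ENNReal.tsum_mul_right]
  refine ENNReal.mul_ne_top ?_ h.moment
  have hsum := (Real.summable_pow_div_factorial (4 * t)).tsum_ofReal_ne_top
  refine ne_of_eq_of_ne (tsum_congr fun k => ?_) hsum
  rw [mul_pow, mul_comm, mul_div_assoc, ENNReal.ofReal_mul (by positivity),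
    ENNReal.ofReal_pow (by norm_num)]
  simp

/-- Estimates weighted by the degree say nothing at a point without neighbours, so finiteness there
is supplied separately. -/
theorem degE_mul_ne_top {a : ℝ≥0∞} {S : Conf (Site d)} (h : degE 0 S * a ≠ ⊤)
    (h0 : degE 0 S = 0 → a ≠ ⊤) : a ≠ ⊤ := by
  by_cases hd : degE 0 S = 0
  · exact h0 hd
  · intro ha
    rw [ha, ENNReal.mul_top hd] at h
    exact h rfl

theorem stepBoundE_of_degE_eq_zero {S : Conf (Site d)} (h : degE 0 S = 0) (k : ℕ) :
    stepBoundE γ k 0 S = 0 := by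
  cases k with
  | zero => rfl
  | succ k =>
    have h0 := ENNReal.tsum_eq_zero.1 h
    rw [stepBoundE, ENNReal.tsum_eq_zero.2 fun x => by rw [h0 x, zero_mul], mul_zero]

theorem Setting.ae_goodConf (h : Setting P Q T idx γ) : ∀ᵐ S ∂(palm P), GoodConf γ S := by
  have hγ := h.model.measurable_surface
  have hdm : ∀ n : ℕ, Measurable fun S : Conf (Site d) => dispE γ n 0 S := fun n =>
    (measurable_dispE hγ n).comp (measurable_const.prodMk measurable_id)
  have hm : MeasurableSet {S : Conf (Site d) | ∀ n : ℕ, dispE γ n 0 S ≠ ⊤} := by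
    rw [Set.ofPred_forall]
    exact MeasurableSet.iInter fun n => (hdm n) (measurableSet_singleton ⊤).compl
  have h1 : ∀ᵐ S ∂(palm P), ∀ n : ℕ, dispE γ n 0 S ≠ ⊤ := by
    refine ae_all_iff.2 fun n => ?_
    filter_upwards [ae_lt_top ((measurable_degE measurable_id measurable_const).mul (hdm n))
      (h.lintegral_dispE_ne_top n)] with S hS
    refine degE_mul_ne_top (S := S) (ne_of_lt hS) fun h0 => ?_
    simp [dispE, stepBoundE_of_degE_eq_zero h0]
  filter_upwards [h.ae_finiteDegrees, ae_palm_forall h.stationary hm h1] with S hS1 hS2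
  refine ⟨hS1, fun s hs n => ?_⟩
  have h2 := dispE_shift h.model.covariant n hs hs
  rw [sub_self] at h2
  rw [← h2]
  exact hS2 s hs n

variable (P Q T idx γ)

/-- Twice the mean energy of the surface at time `t`. -/
noncomputable def energy (t : ℝ) : ℝ≥0∞ :=
  ∫⁻ S, ∑' x : S, ENNReal.ofReal (cond 0 x S) * edgeQ Q T idx γ t 0 x S ∂(palm P)

/-- Twice the mean energy after an update of the typical point. -/
noncomputable def ringEnergy (t : ℝ) : ℝ≥0∞ :=
  ∫⁻ S, ∑' x : S, ENNReal.ofReal (cond 0 x S) * ringQ Q T idx γ t 0 x S ∂(palm P)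

/-- The rate at which the energy decreases. -/
noncomputable def dissipation (t : ℝ) : ℝ≥0∞ :=
  ∫⁻ S, degE 0 S * discQ Q T idx γ t 0 S ∂(palm P)

variable {P Q T idx γ}

theorem Model.measurable_tsum_edgeQ (h : Model Q T idx γ) :
    Measurable fun p : ℝ × Conf (Site d) =>
      ∑' x : p.2, ENNReal.ofReal (cond 0 x p.2) * edgeQ Q T idx γ p.1 0 x p.2 :=
  measurable_tsum_cond_mul (q := fun p x => edgeQ Q T idx γ p.1 0 x p.2) measurable_snd
    (h.measurable_edgeQ (by fun_prop) (by fun_prop) measurable_const measurable_snd)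

theorem Model.measurable_tsum_ringQ (h : Model Q T idx γ) :
    Measurable fun p : ℝ × Conf (Site d) =>
      ∑' x : p.2, ENNReal.ofReal (cond 0 x p.2) * ringQ Q T idx γ p.1 0 x p.2 :=
  measurable_tsum_cond_mul (q := fun p x => ringQ Q T idx γ p.1 0 x p.2) measurable_snd
    (h.measurable_ringQ (by fun_prop) (by fun_prop) measurable_const measurable_snd)

theorem Model.measurable_tsum_ringQ_symm (h : Model Q T idx γ) :
    Measurable fun p : ℝ × Conf (Site d) =>
      ∑' x : p.2, ENNReal.ofReal (cond 0 x p.2) * ringQ Q T idx γ p.1 x 0 p.2 :=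
  measurable_tsum_cond_mul (q := fun p x => ringQ Q T idx γ p.1 x 0 p.2) measurable_snd
    (h.measurable_ringQ (by fun_prop) (by fun_prop) measurable_snd measurable_const)

theorem Model.measurable_tsum_discQ (h : Model Q T idx γ) :
    Measurable fun p : ℝ × Conf (Site d) =>
      ∑' x : p.2, ENNReal.ofReal (cond 0 x p.2) * discQ Q T idx γ p.1 x p.2 :=
  measurable_tsum_cond_mul (q := fun p x => discQ Q T idx γ p.1 x p.2) measurable_snd
    (h.measurable_discQ (by fun_prop) (by fun_prop) measurable_snd)

theorem Model.measurable_degE_mul_discQ (h : Model Q T idx γ) :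
    Measurable fun p : ℝ × Conf (Site d) => degE 0 p.2 * discQ Q T idx γ p.1 0 p.2 :=
  (measurable_degE measurable_snd measurable_const).mul
    (h.measurable_discQ measurable_snd measurable_fst measurable_const)

theorem Model.measurable_tsum_edgeQ_right (h : Model Q T idx γ) (t : ℝ) :
    Measurable fun S : Conf (Site d) =>
      ∑' x : S, ENNReal.ofReal (cond 0 x S) * edgeQ Q T idx γ t 0 x S :=
  h.measurable_tsum_edgeQ.comp measurable_prodMk_left

theorem Model.measurable_tsum_ringQ_right (h : Model Q T idx γ) (t : ℝ) :
    Measurable fun S : Conf (Site d) =>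
      ∑' x : S, ENNReal.ofReal (cond 0 x S) * ringQ Q T idx γ t 0 x S :=
  h.measurable_tsum_ringQ.comp measurable_prodMk_left

theorem Model.measurable_ringEnergy (h : Model Q T idx γ) : Measurable (ringEnergy P Q T idx γ) :=
  h.measurable_tsum_ringQ.lintegral_prod_right'

theorem Model.measurable_dissipation (h : Model Q T idx γ) :
    Measurable (dissipation P Q T idx γ) :=
  h.measurable_degE_mul_discQ.lintegral_prod_right'

theorem Model.exists_law (h : Model Q T idx γ) :
    ∃ π : Measure (Conf ℝ), IsProbabilityMeasure π ∧ π = Q.map (T 0) :=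
  ⟨_, Measure.isProbabilityMeasure_map (h.poisson 0).measurable.aemeasurable, rfl⟩

/-- An update at the neighbour has, by mass transport, the same mean effect as an update at the
typical point. -/
theorem Setting.lintegral_tsum_ringQ_symm (h : Setting P Q T idx γ) (t : ℝ) :
    ∫⁻ S, ∑' x : S, ENNReal.ofReal (cond 0 x S) * ringQ Q T idx γ t x 0 S ∂(palm P) =
      ringEnergy P Q T idx γ t := by
  refine lintegral_palm_edge_swap h.stationary (q := fun x y S => ringQ Q T idx γ t x y S)
    (h.model.measurable_ringQ (by fun_prop) measurable_const (by fun_prop) (by fun_prop)) ?_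
  obtain ⟨π, _, hπ⟩ := h.model.exists_law
  filter_upwards [h.ae_goodConf] with S hS x hx hx0
  have hmem : (⟨0, hx0.2.1⟩ : S) ∈ nbS S ⟨x, hx⟩ := hS.finite.mem_nbS.2 hx0
  have h1 := h.model.ringQ_shift hπ hS hx t hmem
  rw [← h.model.ringQ_eq hπ hS.finite t hmem] at h1
  simpa using h1

theorem Setting.lintegral_tsum_discQ (h : Setting P Q T idx γ) (t : ℝ) :
    ∫⁻ S, ∑' x : S, ENNReal.ofReal (cond 0 x S) * discQ Q T idx γ t x S ∂(palm P) =
      dissipation P Q T idx γ t := by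
  have hswap := lintegral_palm_edge_swap h.stationary (q := fun _ y S => discQ Q T idx γ t y S)
    (h.model.measurable_discQ (by fun_prop) measurable_const (by fun_prop)) (by
      obtain ⟨π, _, hπ⟩ := h.model.exists_law
      filter_upwards [h.ae_goodConf] with S hS x hx hx0
      have h1 := h.model.discQ_shift hπ hS hx t ⟨0, hx0.2.1⟩
      rw [← h.model.discQ_eq hπ hS.finite t] at h1
      simpa using h1)
  rw [← hswap]
  exact lintegral_congr fun S => tsum_ofReal_cond_mul_const S _

theorem Setting.lintegral_tsum_dispE (h : Setting P Q T idx γ) (t : ℝ) :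
    ∫⁻ S, ∑' x : S, ENNReal.ofReal (cond 0 x S) * dispE γ t x S ∂(palm P) =
      ∫⁻ S, degE 0 S * dispE γ t 0 S ∂(palm P) := by
  have hswap := lintegral_palm_edge_swap h.stationary (q := fun _ y S => dispE γ t y S)
    ((measurable_dispE h.model.measurable_surface t).comp measurable_snd)
    (Eventually.of_forall fun S x hx hx0 => by
      rw [← zero_sub]; exact dispE_shift h.model.covariant t hx hx0.2.1)
  rw [← hswap]
  exact lintegral_congr fun S => tsum_ofReal_cond_mul_const S _

theorem Setting.ringEnergy_add_dissipation (h : Setting P Q T idx γ) (t : ℝ) :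
    ringEnergy P Q T idx γ t + dissipation P Q T idx γ t = energy P Q T idx γ t := by
  obtain ⟨π, _, hπ⟩ := h.model.exists_law
  rw [ringEnergy, dissipation, energy,
    ← lintegral_add_left (h.model.measurable_tsum_ringQ_right t)]
  refine lintegral_congr_ae ?_
  filter_upwards [h.ae_goodConf, ae_zero_mem_palm] with S hS h0
  let o : S := ⟨0, h0⟩
  have h1 := fun φ => hS.finite.tsum_ofReal_cond_mul o φ
  have hd : degE 0 S = _ := hS.finite.degE_eq o
  simp only [o] at h1
  rw [h1 fun x => ringQ Q T idx γ t 0 x S, h1 fun x => edgeQ Q T idx γ t 0 x S, hd,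
    Finset.sum_congr rfl fun x hx => h.model.ringQ_eq hπ hS.finite t (y := o) (z := x) hx,
    Finset.sum_congr rfl fun x _ => h.model.edgeQ_eq hπ hS.finite t o x]
  have hdq := h.model.discQ_eq hπ hS.finite t o
  simp only [o] at hdq
  rw [hdq]
  rcases (nbS S o).eq_empty_or_nonempty with he | he
  · simp only [o] at he
    simp [o, he]
  · exact sum_ringMean_add t he

theorem sum_balance {ι : Type*} {F : Finset ι} {a b : ι → ℝ≥0∞} {E R R' : ι → ℝ → ℝ≥0∞}
    {μ : Measure ℝ} (hE : ∀ x, Measurable (E x)) (hR : ∀ x, Measurable (R x))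
    (hR' : ∀ x, Measurable (R' x)) (h : ∀ x ∈ F,
      a x + 2 * ∫⁻ u, E x u ∂μ = b x + ((∫⁻ u, R x u ∂μ) + ∫⁻ u, R' x u ∂μ)) :
    ∑ x ∈ F, a x + 2 * ∫⁻ u, ∑ x ∈ F, E x u ∂μ =
      ∑ x ∈ F, b x + ((∫⁻ u, ∑ x ∈ F, R x u ∂μ) + ∫⁻ u, ∑ x ∈ F, R' x u ∂μ) := by
  rw [lintegral_finsetSum _ fun x _ => hE x, lintegral_finsetSum _ fun x _ => hR x,
    lintegral_finsetSum _ fun x _ => hR' x, Finset.mul_sum, ← Finset.sum_add_distrib,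
    ← Finset.sum_add_distrib, ← Finset.sum_add_distrib]
  exact Finset.sum_congr rfl h

/-- The edges at the origin are hit by the clocks at both ends, whose effects agree in mean; hence
the factor `2` on each side. -/
theorem Setting.energy_add_lintegral_energy (h : Setting P Q T idx γ) {t : ℝ} (ht : 0 ≤ t) :
    energy P Q T idx γ t + 2 * ∫⁻ u in Ioc 0 t, energy P Q T idx γ u =
      energy P Q T idx γ 0 + 2 * ∫⁻ u in Ioc 0 t, ringEnergy P Q T idx γ u := by
  obtain ⟨π, _, hπ⟩ := h.model.exists_law
  have hpt : ∀ᵐ S : Conf (Site d) ∂(palm P),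
      ∑' x : S, ENNReal.ofReal (cond 0 x S) * edgeQ Q T idx γ t 0 x S +
        2 * ∫⁻ u in Ioc 0 t, ∑' x : S, ENNReal.ofReal (cond 0 x S) * edgeQ Q T idx γ u 0 x S =
      ∑' x : S, ENNReal.ofReal (cond 0 x S) * edgeQ Q T idx γ 0 0 x S +
        ((∫⁻ u in Ioc 0 t, ∑' x : S, ENNReal.ofReal (cond 0 x S) * ringQ Q T idx γ u 0 x S) +
        ∫⁻ u in Ioc 0 t, ∑' x : S, ENNReal.ofReal (cond 0 x S) * ringQ Q T idx γ u x 0 S) := by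
    filter_upwards [h.ae_goodConf, ae_zero_mem_palm] with S hS h0
    let o : S := ⟨0, h0⟩
    have h1 : ∀ φ : S → ℝ≥0∞, ∑' x : S, ENNReal.ofReal (cond 0 x S) * φ x =
        ∑ x ∈ nbS S o, φ x := fun φ => hS.finite.tsum_ofReal_cond_mul o φ
    have h2 : ∀ u, ∑' x : S, ENNReal.ofReal (cond 0 x S) * edgeQ Q T idx γ u 0 x S =
        ∑ x ∈ nbS S o, edgeMean π (nbS S) (fun v : S => γ v S) u o x := fun u => by
      rw [h1 fun x => edgeQ Q T idx γ u 0 x S]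
      exact Finset.sum_congr rfl fun x _ => h.model.edgeQ_eq hπ hS.finite u o x
    have h3 : ∀ u, ∑' x : S, ENNReal.ofReal (cond 0 x S) * ringQ Q T idx γ u 0 x S =
        ∑ x ∈ nbS S o, ringMean π (nbS S) (fun v : S => γ v S) u o x := fun u => by
      rw [h1 fun x => ringQ Q T idx γ u 0 x S]
      exact Finset.sum_congr rfl fun x hx =>
        h.model.ringQ_eq hπ hS.finite u (y := o) (z := x) hx
    have h4 : ∀ u, ∑' x : S, ENNReal.ofReal (cond 0 x S) * ringQ Q T idx γ u x 0 S =
        ∑ x ∈ nbS S o, ringMean π (nbS S) (fun v : S => γ v S) u x o := fun u => by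
      rw [h1 fun x => ringQ Q T idx γ u x 0 S]
      exact Finset.sum_congr rfl fun x hx =>
        h.model.ringQ_eq hπ hS.finite u (y := x) (z := o) (hS.finite.nbS_symm _ _ hx)
    rw [h2 t, h2 0, lintegral_congr h2, lintegral_congr h3, lintegral_congr h4]
    exact sum_balance (measurable_edgeMean o) (measurable_ringMean o)
      (fun x => measurable_ringMean x o) fun x hx => edgeMean_add_lintegral (h.model.isPoisson hπ)
      (notMem_nbS S) (hS.ae_goodPath h.model hπ)
      (ne_of_mem_of_not_mem hx (notMem_nbS S o)).symm ht
  have hE := h.model.measurable_tsum_edgeQ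
  have hR := h.model.measurable_tsum_ringQ
  have hR' := h.model.measurable_tsum_ringQ_symm
  have key := lintegral_congr_ae hpt
  have hE1 : Measurable fun S : Conf (Site d) => ∫⁻ u in Ioc 0 t,
      ∑' x : S, ENNReal.ofReal (cond 0 x S) * edgeQ Q T idx γ u 0 x S :=
    (hE.comp measurable_swap).lintegral_prod_right'
  have hR1 : Measurable fun S : Conf (Site d) => ∫⁻ u in Ioc 0 t,
      ∑' x : S, ENNReal.ofReal (cond 0 x S) * ringQ Q T idx γ u 0 x S :=
    (hR.comp measurable_swap).lintegral_prod_right'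
  have hE2 : ∫⁻ S, (∫⁻ u in Ioc 0 t, ∑' x : S, ENNReal.ofReal (cond 0 x S) *
      edgeQ Q T idx γ u 0 x S) ∂(palm P) = ∫⁻ u in Ioc 0 t, energy P Q T idx γ u :=
    (lintegral_lintegral_swap (hE.aemeasurable (μ := (volume.restrict _).prod _))).symm
  have hR2 : ∫⁻ S, (∫⁻ u in Ioc 0 t, ∑' x : S, ENNReal.ofReal (cond 0 x S) *
      ringQ Q T idx γ u 0 x S) ∂(palm P) = ∫⁻ u in Ioc 0 t, ringEnergy P Q T idx γ u :=
    (lintegral_lintegral_swap (hR.aemeasurable (μ := (volume.restrict _).prod _))).symm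
  have hR3 : ∫⁻ S, (∫⁻ u in Ioc 0 t, ∑' x : S, ENNReal.ofReal (cond 0 x S) *
      ringQ Q T idx γ u x 0 S) ∂(palm P) = ∫⁻ u in Ioc 0 t, ringEnergy P Q T idx γ u := by
    simp_rw [← h.lintegral_tsum_ringQ_symm]
    exact (lintegral_lintegral_swap (hR'.aemeasurable (μ := (volume.restrict _).prod _))).symm
  rw [lintegral_add_left (h.model.measurable_tsum_edgeQ_right t),
    lintegral_add_left (h.model.measurable_tsum_edgeQ_right 0),
    lintegral_const_mul _ hE1, lintegral_add_left hR1, hE2, hR2, hR3] at key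
  rw [two_mul (∫⁻ u in Ioc 0 t, ringEnergy P Q T idx γ u)]
  exact key

theorem dispE_mono {t u : ℝ} (ht : 0 ≤ t) (htu : t ≤ u) (s : Site d) (S : Conf (Site d)) :
    dispE γ t s S ≤ dispE γ u s S := by
  unfold dispE
  gcongr

/-- A bound uniform on `[0, b]`, needed before energies can be subtracted from the balance. -/
theorem Setting.energy_le (h : Setting P Q T idx γ) {t b : ℝ} (ht : 0 ≤ t) (htb : t ≤ b) :
    energy P Q T idx γ t ≤ 3 * (energy P Q T idx γ 0 +
      2 * ∫⁻ S, degE 0 S * dispE γ b 0 S ∂(palm P)) := by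
  obtain ⟨π, _, hπ⟩ := h.model.exists_law
  have hpt : ∀ᵐ S : Conf (Site d) ∂(palm P),
      ∑' x : S, ENNReal.ofReal (cond 0 x S) * edgeQ Q T idx γ t 0 x S ≤
      3 * ((∑' x : S, ENNReal.ofReal (cond 0 x S) * edgeQ Q T idx γ 0 0 x S +
        degE 0 S * dispE γ b 0 S) + ∑' x : S, ENNReal.ofReal (cond 0 x S) * dispE γ b x S) := by
    filter_upwards [h.ae_goodConf, ae_zero_mem_palm] with S hS h0
    let o : S := ⟨0, h0⟩
    have h1 : ∀ φ : S → ℝ≥0∞, ∑' x : S, ENNReal.ofReal (cond 0 x S) * φ x =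
        ∑ x ∈ nbS S o, φ x := fun φ => hS.finite.tsum_ofReal_cond_mul o φ
    rw [← tsum_ofReal_cond_mul_const, h1 fun x => edgeQ Q T idx γ t 0 x S,
      h1 fun x => edgeQ Q T idx γ 0 0 x S, h1 fun x => dispE γ b x S, h1 fun _ => dispE γ b 0 S,
      ← Finset.sum_add_distrib, ← Finset.sum_add_distrib, Finset.mul_sum]
    refine Finset.sum_le_sum fun x hx => ?_
    have h2 := edgeMean_le (h.model.isPoisson hπ) (notMem_nbS S) (hS.ae_goodPath h.model hπ)
      ⟨x, hx⟩ ⟨o, hS.finite.nbS_symm _ _ hx⟩ ht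
    rw [← h.model.edgeQ_eq hπ hS.finite, ← h.model.edgeQ_eq hπ hS.finite, ← hS.finite.dispE_eq,
      ← hS.finite.dispE_eq] at h2
    refine h2.trans ?_
    gcongr
    · exact dispE_mono ht htb _ _
    · exact dispE_mono ht htb _ _
  have hE := h.model.measurable_tsum_edgeQ
  have hB := measurable_dispE h.model.measurable_surface b
  have hm1 : Measurable fun S : Conf (Site d) => degE 0 S * dispE γ b 0 S :=
    (measurable_degE measurable_id measurable_const).mul
      (hB.comp (measurable_const.prodMk measurable_id))
  have hm2 : Measurable fun S : Conf (Site d) =>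
      ∑' x : S, ENNReal.ofReal (cond 0 x S) * dispE γ b x S :=
    measurable_tsum_cond_mul (S := fun S : Conf (Site d) => S) (q := fun S x => dispE γ b x S) measurable_id
      (hB.comp measurable_swap)
  refine (lintegral_mono_ae hpt).trans (le_of_eq ?_)
  rw [lintegral_const_mul' _ _ (by simp), lintegral_add_right _ hm2, lintegral_add_right _ hm1,
    h.lintegral_tsum_dispE, two_mul, add_assoc]
  rfl

theorem Setting.energy_zero_ne_top (h : Setting P Q T idx γ) : energy P Q T idx γ 0 ≠ ⊤ := by
  obtain ⟨π, _, hπ⟩ := h.model.exists_law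
  refine ne_of_eq_of_ne (lintegral_congr_ae ?_) h.moment
  filter_upwards [h.ae_goodConf, ae_zero_mem_palm] with S hS h0
  let o : S := ⟨0, h0⟩
  have h1 : ∀ φ : S → ℝ≥0∞, ∑' x : S, ENNReal.ofReal (cond 0 x S) * φ x =
      ∑ x ∈ nbS S o, φ x := fun φ => hS.finite.tsum_ofReal_cond_mul o φ
  rw [h1 fun x => edgeQ Q T idx γ 0 0 x S,
    h1 fun x => ENNReal.ofReal (grad S (fun y => γ y S) 0 x ^ 2)]
  refine Finset.sum_congr rfl fun x hx => ?_
  have h2 := hS.finite.grad_eq (fun y => γ y S) hx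
  simp only [o] at h2
  rw [h2]
  exact (h.model.edgeQ_eq hπ hS.finite 0 o x).trans (edgeMean_zero o x)

theorem Setting.lintegral_energy_ne_top (h : Setting P Q T idx γ) (t : ℝ) :
    ∫⁻ u in Ioc 0 t, energy P Q T idx γ u ≠ ⊤ := by
  refine ne_top_of_le_ne_top ?_ (setLIntegral_mono' measurableSet_Ioc fun u hu =>
    h.energy_le hu.1.le hu.2)
  rw [setLIntegral_const]
  refine ENNReal.mul_ne_top (ENNReal.mul_ne_top (by simp) (ENNReal.add_ne_top.2
    ⟨h.energy_zero_ne_top, ENNReal.mul_ne_top (by simp) (h.lintegral_dispE_ne_top t)⟩)) ?_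
  simp

theorem Setting.energy_balance_zero (h : Setting P Q T idx γ) {t : ℝ} (ht : 0 ≤ t) :
    energy P Q T idx γ t + 2 * ∫⁻ u in Ioc 0 t, dissipation P Q T idx γ u =
      energy P Q T idx γ 0 := by
  have h1 := h.energy_add_lintegral_energy ht
  have h2 : ∫⁻ u in Ioc 0 t, energy P Q T idx γ u =
      (∫⁻ u in Ioc 0 t, ringEnergy P Q T idx γ u) +
        ∫⁻ u in Ioc 0 t, dissipation P Q T idx γ u := by
    rw [← lintegral_add_left h.model.measurable_ringEnergy]
    exact lintegral_congr fun u => (h.ringEnergy_add_dissipation u).symm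
  -- Writing the energy as energy after an update plus dissipation, the former occurs on both sides
  -- and, being finite, cancels.
  have h3 : 2 * ∫⁻ u in Ioc 0 t, ringEnergy P Q T idx γ u ≠ ⊤ :=
    ENNReal.mul_ne_top (by simp) (ne_top_of_le_ne_top (h.lintegral_energy_ne_top t)
      (by rw [h2]; exact le_self_add))
  refine (ENNReal.add_left_inj h3).1 ?_
  rw [← h1, h2]
  ring

theorem Setting.energy_balance (h : Setting P Q T idx γ) {a b : ℝ} (ha : 0 ≤ a) (hab : a ≤ b) :
    energy P Q T idx γ b + 2 * ∫⁻ u in Ioc a b, dissipation P Q T idx γ u =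
      energy P Q T idx γ a := by
  have h1 := h.energy_balance_zero ha
  have h2 := h.energy_balance_zero (ha.trans hab)
  rw [← Ioc_union_Ioc_eq_Ioc ha hab, lintegral_union measurableSet_Ioc
    (Ioc_disjoint_Ioc_of_le le_rfl)] at h2
  have h3 : 2 * ∫⁻ u in Ioc 0 a, dissipation P Q T idx γ u ≠ ⊤ :=
    ne_top_of_le_ne_top h.energy_zero_ne_top (by rw [← h1]; exact le_add_self)
  refine (ENNReal.add_left_inj h3).1 ?_
  rw [h1, ← h2]
  ring

theorem Setting.dissipation_le (h : Setting P Q T idx γ) {t : ℝ} (ht : 0 ≤ t) :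
    dissipation P Q T idx γ t ≤ energy P Q T idx γ 0 :=
  calc _ ≤ energy P Q T idx γ t := by rw [← h.ringEnergy_add_dissipation t]; exact le_add_self
    _ ≤ _ := by rw [← h.energy_balance_zero ht]; exact le_self_add

/-- In `discMean_le` multiplied by the degree, the average over the neighbours becomes a sum, which
mass transport turns into the dissipation; thus `2 + 2 = 4`. -/
theorem Setting.dissipation_le_add (h : Setting P Q T idx γ) {a b : ℝ} (ha : 0 ≤ a)
    (hab : a ≤ b) :
    dissipation P Q T idx γ b ≤ dissipation P Q T idx γ a +
      4 * ∫⁻ u in Ioc a b, dissipation P Q T idx γ u ∧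
    dissipation P Q T idx γ a ≤ dissipation P Q T idx γ b +
      4 * ∫⁻ u in Ioc a b, dissipation P Q T idx γ u := by
  obtain ⟨π, _, hπ⟩ := h.model.exists_law
  have hF := h.model.measurable_degE_mul_discQ
  have hF' := h.model.measurable_tsum_discQ
  let J : Conf (Site d) → ℝ≥0∞ := fun S => ∫⁻ u in Ioc a b, (2 * (degE 0 S *
    discQ Q T idx γ u 0 S) + 2 * ∑' x : S, ENNReal.ofReal (cond 0 x S) * discQ Q T idx γ u x S)
  have hJ : ∫⁻ S, J S ∂(palm P) = 4 * ∫⁻ u in Ioc a b, dissipation P Q T idx γ u := by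
    have hJm : Measurable fun p : Conf (Site d) × ℝ => 2 * (degE 0 p.1 *
        discQ Q T idx γ p.2 0 p.1) +
        2 * ∑' x : p.1, ENNReal.ofReal (cond 0 x p.1) * discQ Q T idx γ p.2 x p.1 :=
      ((hF.comp measurable_swap).const_mul 2).add ((hF'.comp measurable_swap).const_mul 2)
    simp only [J]
    rw [lintegral_lintegral_swap hJm.aemeasurable, ← lintegral_const_mul' _ _ (by simp)]
    refine lintegral_congr fun u => ?_
    have hm1 : Measurable fun S : Conf (Site d) => degE 0 S * discQ Q T idx γ u 0 S :=
      hF.comp measurable_prodMk_left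
    rw [lintegral_add_left (hm1.const_mul 2), lintegral_const_mul _ hm1,
      lintegral_const_mul' _ _ (by simp), h.lintegral_tsum_discQ, ← dissipation]
    ring
  have hpt : ∀ᵐ S : Conf (Site d) ∂(palm P),
      degE 0 S * discQ Q T idx γ b 0 S ≤ degE 0 S * discQ Q T idx γ a 0 S + J S ∧
      degE 0 S * discQ Q T idx γ a 0 S ≤ degE 0 S * discQ Q T idx γ b 0 S + J S := by
    filter_upwards [h.ae_goodConf, ae_zero_mem_palm] with S hS h0
    let o : S := ⟨0, h0⟩
    have h1 : ∀ φ : S → ℝ≥0∞, ∑' x : S, ENNReal.ofReal (cond 0 x S) * φ x =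
        ∑ x ∈ nbS S o, φ x := fun φ => hS.finite.tsum_ofReal_cond_mul o φ
    have hq : ∀ u, discQ Q T idx γ u 0 S = discMean π (nbS S) (fun v : S => γ v S) u o :=
      fun u => h.model.discQ_eq hπ hS.finite u o
    have hd : degE 0 S = (nbS S o).card := hS.finite.degE_eq o
    have hJS : (nbS S o).card * ∫⁻ u in Ioc a b,
        (2 * discMean π (nbS S) (fun v : S => γ v S) u o +
          2 * nbAvg (nbS S) (discMean π (nbS S) (fun v : S => γ v S) u) o) ≤ J S := by
      rw [← lintegral_const_mul' _ _ (ENNReal.natCast_ne_top _)]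
      refine lintegral_mono fun u => ?_
      rw [h1 fun x => discQ Q T idx γ u x S, hq, hd,
        Finset.sum_congr rfl fun x _ => h.model.discQ_eq hπ hS.finite u x, mul_add,
        mul_left_comm, mul_left_comm _ 2]
      gcongr
      rw [nbAvg, ← mul_assoc]
      exact mul_le_of_le_one_left' (ENNReal.mul_inv_le_one _)
    have h2 := discMean_le (h.model.isPoisson hπ) (notMem_nbS S) hS.finite.nbS_symm
      (hS.ae_goodPath h.model hπ) o ha hab
    rw [hq, hq, hd]
    constructor
    · refine (mul_le_mul_right h2.1 _).trans ?_
      rw [mul_add]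
      gcongr
    · refine (mul_le_mul_right h2.2 _).trans ?_
      rw [mul_add]
      gcongr
  have hm : ∀ u, Measurable fun S : Conf (Site d) => degE 0 S * discQ Q T idx γ u 0 S :=
    fun u => hF.comp measurable_prodMk_left
  rw [← hJ, dissipation, dissipation, ← lintegral_add_left (hm a), ← lintegral_add_left (hm b)]
  exact ⟨lintegral_mono_ae (hpt.mono fun S hS => hS.1),
    lintegral_mono_ae (hpt.mono fun S hS => hS.2)⟩

/-- Without neighbours `deg 0 S = 0`, whose inverse is `0` by convention. -/
theorem Model.discQ_of_degE_eq_zero {S : Conf (Site d)} (h : degE 0 S = 0) (t : ℝ) :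
    discQ Q T idx γ t 0 S = 0 := by
  have h0 : ∀ x : S, cond 0 x S = 0 := by
    classical
    intro x
    have := ENNReal.tsum_eq_zero.1 h x
    rw [ofReal_cond] at this
    rw [cond]
    split_ifs at this ⊢ with hv
    · exact absurd this one_ne_zero
    · rfl
  have hd : deg 0 S = 0 := by simp [deg, h0]
  simp [discQ, hd]

/-- The energy balance bounds the total dissipation by the initial energy. Tonelli's theorem gives
finiteness at the origin, and covariance of `discQ` extends it to all points. -/
theorem Setting.ae_lintegral_discQ_ne_top (h : Setting P Q T idx γ) :
    ∀ᵐ S ∂(palm P), ∀ x ∈ S, ∫⁻ u in Ioi 0, discQ Q T idx γ u x S ≠ ⊤ := by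
  have hF := h.model.measurable_degE_mul_discQ
  have hD : Measurable fun p : Conf (Site d) × ℝ => discQ Q T idx γ p.2 0 p.1 :=
    h.model.measurable_discQ measurable_fst measurable_snd measurable_const
  have htot : ∫⁻ u in Ioi 0, dissipation P Q T idx γ u ≠ ⊤ := by
    rw [setLIntegral_Ioi_eq_iSup]
    refine ne_top_of_le_ne_top h.energy_zero_ne_top (iSup_le fun n => ?_)
    rw [← h.energy_balance_zero n.cast_nonneg]
    refine le_add_left ?_
    exact le_mul_of_one_le_left' one_le_two
  have hm0 : Measurable fun S : Conf (Site d) => ∫⁻ u in Ioi 0, discQ Q T idx γ u 0 S :=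
    hD.lintegral_prod_right'
  have h0 : ∀ᵐ S ∂(palm P), ∫⁻ u in Ioi 0, discQ Q T idx γ u 0 S ≠ ⊤ := by
    have hint : ∫⁻ S, degE 0 S * (∫⁻ u in Ioi 0, discQ Q T idx γ u 0 S) ∂(palm P) ≠ ⊤ := by
      simp only [dissipation] at htot
      rw [lintegral_lintegral_swap hF.aemeasurable] at htot
      refine ne_of_eq_of_ne (lintegral_congr fun S => ?_) htot
      exact (lintegral_const_mul _ (hD.comp measurable_prodMk_left)).symm
    filter_upwards [ae_lt_top ((measurable_degE measurable_id measurable_const).mul hm0)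
      hint] with S hS
    refine degE_mul_ne_top (S := S) (ne_of_lt hS) fun hd => ?_
    simp [Model.discQ_of_degE_eq_zero hd]
  obtain ⟨π, _, hπ⟩ := h.model.exists_law
  filter_upwards [h.ae_goodConf, ae_palm_forall h.stationary
    (hm0 (measurableSet_singleton ⊤).compl) h0] with S hS hS2 x hx
  have h1 := hS2 x hx
  refine ne_of_eq_of_ne (lintegral_congr fun u => ?_) h1
  have h2 := h.model.discQ_shift hπ hS hx u ⟨x, hx⟩
  rw [← h.model.discQ_eq hπ hS.finite u] at h2
  simpa using h2.symm

theorem Setting.dissipation_eq_zero_iff (h : Setting P Q T idx γ) (t : ℝ) :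
    dissipation P Q T idx γ t = 0 ↔ ∀ᵐ S ∂(palm P), ∀ x ∈ S, discQ Q T idx γ t x S = 0 := by
  have hF := h.model.measurable_degE_mul_discQ
  have hm : Measurable fun S : Conf (Site d) => discQ Q T idx γ t 0 S :=
    h.model.measurable_discQ measurable_id measurable_const measurable_const
  have hm1 : Measurable fun S : Conf (Site d) => degE 0 S * discQ Q T idx γ t 0 S :=
    hF.comp measurable_prodMk_left
  rw [dissipation, lintegral_eq_zero_iff hm1]
  constructor
  · intro h0
    have h1 : ∀ᵐ S ∂(palm P), discQ Q T idx γ t 0 S = 0 := by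
      filter_upwards [h0] with S hS
      rcases mul_eq_zero.1 hS with hd | hd
      · exact Model.discQ_of_degE_eq_zero hd t
      · exact hd
    obtain ⟨π, _, hπ⟩ := h.model.exists_law
    filter_upwards [h.ae_goodConf, ae_palm_forall h.stationary
      (hm (measurableSet_singleton 0)) h1] with S hS hS2 x hx
    have h2 := h.model.discQ_shift hπ hS hx t ⟨x, hx⟩
    rw [← h.model.discQ_eq hπ hS.finite t] at h2
    simp only [sub_self] at h2
    rw [← h2]
    exact hS2 x hx
  · intro h0
    filter_upwards [h0, ae_zero_mem_palm] with S hS hS0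
    rw [hS 0 hS0, mul_zero]
    rfl

end PalmLevel

end Harness

namespace Harness

/-! ### Strict decrease of the energy -/

/-- `E` decreases at rate `2 * R`. A zero of `R` at `t` persists on a short interval to the right,
by a Gronwall argument, and `E` is flat there. A positive value persists on both sides, since `R`
varies by at most `4 * K` times the elapsed time. -/
theorem strictlyDecreasingAt_iff {E R : ℝ → ℝ≥0∞} {K : ℝ≥0∞} (hRm : Measurable R)
    (hE : ∀ a b, 0 ≤ a → a ≤ b → E b + 2 * ∫⁻ u in Ioc a b, R u = E a) (hE0 : E 0 ≠ ⊤)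
    (hRK : ∀ t, 0 ≤ t → R t ≤ K) (hK : K ≠ ⊤)
    (hR : ∀ a b, 0 ≤ a → a ≤ b → R b ≤ R a + 4 * ∫⁻ u in Ioc a b, R u ∧
      R a ≤ R b + 4 * ∫⁻ u in Ioc a b, R u) {t : ℝ} (ht : 0 ≤ t) :
    StrictlyDecreasingAt E t ↔ R t ≠ 0 := by
  have hEfin : ∀ a, 0 ≤ a → E a ≠ ⊤ := fun a ha =>
    ne_top_of_le_ne_top hE0 (by rw [← hE 0 a le_rfl ha]; exact le_self_add)
  have hint : ∀ a b, 0 ≤ a → ∫⁻ u in Ioc a b, R u ≤ K * ENNReal.ofReal (b - a) := by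
    intro a b ha
    refine (setLIntegral_mono' measurableSet_Ioc fun u hu => hRK u (ha.trans hu.1.le)).trans ?_
    rw [setLIntegral_const, Real.volume_Ioc]
  constructor
  · rintro ⟨ε, hε, h⟩ h0
    -- The interval has length at most `1 / 8`, so the Gronwall bound reads `I ≤ 4 * I / 8`, which
    -- forces `I = 0`.
    set b := t + min (ε / 2) (1 / 8) with hb
    have hmin : 0 < min (ε / 2) (1 / 8 : ℝ) := lt_min (by positivity) (by norm_num)
    have htb : t < b := by linarith
    have hbt : b - t ≤ 1 / 8 := by rw [hb]; linarith [min_le_right (ε / 2) (1 / 8 : ℝ)]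
    have hbε : |b - t| < ε := by
      rw [hb, add_sub_cancel_left, abs_of_pos hmin]
      exact (min_le_left _ _).trans_lt (by linarith)
    set I := ∫⁻ u in Ioc t b, R u with hI
    have hIfin : I ≠ ⊤ := ne_top_of_le_ne_top (ENNReal.mul_ne_top hK ENNReal.ofReal_ne_top)
      (hint t b ht)
    have h1 : I ≤ 4 * I * ENNReal.ofReal (1 / 8) := by
      calc I ≤ ∫⁻ _ in Ioc t b, 4 * I := by
            refine setLIntegral_mono' measurableSet_Ioc fun u hu => ?_
            refine (hR t u ht hu.1.le).1.trans ?_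
            rw [h0, zero_add]
            exact mul_le_mul_right (lintegral_mono_set (Ioc_subset_Ioc_right hu.2)) 4
        _ = 4 * I * ENNReal.ofReal (b - t) := by rw [setLIntegral_const, Real.volume_Ioc]
        _ ≤ _ := by gcongr
    have h2 : I = 0 := by
      have h3 := ENNReal.toReal_mono (by finiteness) h1
      rw [ENNReal.toReal_mul, ENNReal.toReal_mul, ENNReal.toReal_ofReal (by norm_num),
        ENNReal.toReal_ofNat] at h3
      have h4 : I.toReal = 0 := by
        have := ENNReal.toReal_nonneg (a := I)
        linarith
      exact ((ENNReal.toReal_eq_zero_iff I).1 h4).resolve_right hIfin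
    have h5 := hE t b ht htb.le
    rw [← hI, h2, mul_zero, add_zero] at h5
    exact ((h b (ht.trans htb.le) hbε).2 htb).ne h5
  · intro h0
    have hRt : R t ≠ ⊤ := ne_top_of_le_ne_top hK (hRK t ht)
    have hr : 0 < (R t).toReal := ENNReal.toReal_pos h0 hRt
    have hκ : 0 ≤ K.toReal := ENNReal.toReal_nonneg
    -- Chosen so that the variation `4 * K * ε` is at most half of `R t`; adding `1` to `K` avoids a
    -- zero denominator.
    set ε := (R t).toReal / (8 * (K.toReal + 1)) with hε
    have hεpos : 0 < ε := by positivity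
    have hsmall : 4 * (K * ENNReal.ofReal ε) < R t := by
      rw [← ENNReal.toReal_lt_toReal (by finiteness) hRt, ENNReal.toReal_mul, ENNReal.toReal_mul,
        ENNReal.toReal_ofReal hεpos.le, ENNReal.toReal_ofNat, hε]
      have h1 : K.toReal * ((R t).toReal / (8 * (K.toReal + 1))) ≤ (R t).toReal / 8 := by
        rw [mul_div_assoc', div_le_div_iff₀ (by positivity) (by norm_num)]
        nlinarith
      linarith
    have hpos : ∀ v, 0 ≤ v → |v - t| < ε → R v ≠ 0 := by
      intro v hv hvt hv0
      rw [abs_lt] at hvt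
      rcases le_total v t with hle | hle
      · have h1 := (hR v t hv hle).1
        rw [hv0, zero_add] at h1
        refine absurd (h1.trans ?_) (not_le.2 hsmall)
        gcongr
        exact (hint v t hv).trans (by gcongr; linarith)
      · have h1 := (hR t v ht hle).2
        rw [hv0, zero_add] at h1
        refine absurd (h1.trans ?_) (not_le.2 hsmall)
        gcongr
        exact (hint t v ht).trans (by gcongr; linarith)
    have hlt : ∀ a b, 0 ≤ a → a < b → (∀ v ∈ Ioc a b, R v ≠ 0) → E b < E a := by
      intro a b ha hab hv
      rw [← hE a b ha hab.le]
      refine ENNReal.lt_add_right (hEfin b (ha.trans hab.le)) (mul_ne_zero two_ne_zero ?_)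
      refine ((setLIntegral_pos_iff hRm).2 ?_).ne'
      have hsub : Function.support R ∩ Ioc a b = Ioc a b :=
        inter_eq_right.2 fun v hv' => hv v hv'
      rw [hsub, Real.volume_Ioc]
      simpa using hab
    refine ⟨ε, hεpos, fun u hu hut => ⟨fun h => ?_, fun h => ?_⟩⟩
    · refine hlt u t hu h fun v hv => hpos v (hu.trans hv.1.le) ?_
      rw [abs_lt] at hut ⊢
      constructor <;> linarith [hv.1, hv.2]
    · refine hlt t u ht h fun v hv => hpos v (ht.trans hv.1.le) ?_
      rw [abs_lt] at hut ⊢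
      constructor <;> linarith [hv.1, hv.2]

/-! ### Almost sure statements for the harness process -/

section Final

variable {d : ℕ} {Ω : Type*} [MeasurableSpace Ω] {P : Measure (Conf (Site d))}
  [IsProbabilityMeasure P] [IsProbabilityMeasure (palm P)] {Q : Measure Ω}
  [IsProbabilityMeasure Q] {T : ℕ → Ω → Conf ℝ} {idx : Site d → Conf (Site d) → ℕ}
  {γ : Site d → Conf (Site d) → ℝ}

theorem measurableSet_forall_mem {C : Type*} [MeasurableSpace C] {S : C → Conf (Site d)}
    (hS : Measurable S) {D : Set (C × Site d)} (hD : MeasurableSet D) :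
    MeasurableSet {c | ∀ s ∈ S c, (c, s) ∈ D} := by
  have hm : Measurable fun c => ∑' s : S c, Dᶜ.indicator (1 : C × Site d → ℝ≥0∞) (c, s) :=
    measurable_tsum_conf (g := fun c s => Dᶜ.indicator (1 : C × Site d → ℝ≥0∞) (c, s)) hS
      (measurable_one.indicator hD.compl)
  convert hm (measurableSet_singleton 0) using 1
  ext c
  simp only [mem_ofPred_eq, mem_preimage, mem_singleton_iff, ENNReal.tsum_eq_zero, Subtype.forall,
    indicator_apply_eq_zero, mem_compl_iff, Pi.one_apply, one_ne_zero, imp_false, not_not]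

theorem exists_rat_epochs_eq (N : Site d → Conf ℝ) (F : Finset (Site d)) (t : ℝ) :
    ∃ q : ℚ, t < q ∧ ∀ x ∈ F, epochs (N x) q = epochs (N x) t :=
  exists_rat_of_eventually_nhdsGT
    ((eventually_all_finset F).2 fun x _ => eventually_epochs_eq (N x) t)

theorem lap_congr {S : Conf (Site d)} {η η' : Site d → ℝ} (h : ∀ x ∈ S, η x = η' x) {s : Site d}
    (hs : s ∈ S) : lap S η s = lap S η' s :=
  tsum_congr fun x => by rw [h x x.2, h s hs]

/-- A Laplacian involves finitely many heights, all of which are constant just after `t`. -/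
theorem FiniteDegrees.exists_rat_lap_eq {S : Conf (Site d)} (hS : FiniteDegrees S) (ω : Ω) (t : ℝ)
    {s : Site d} (hs : s ∈ S) : ∃ q : ℚ, t < q ∧
      lap S (height T idx γ S ω q) s = lap S (height T idx γ S ω t) s := by
  classical
  obtain ⟨q, hq, he⟩ := exists_rat_epochs_eq (fun x => T (idx x S) ω)
    (insert s ((nbS S ⟨s, hs⟩).image (↑))) t
  have hh : ∀ x ∈ insert s ((nbS S ⟨s, hs⟩).image ((↑) : S → Site d)),
      height T idx γ S ω q x = height T idx γ S ω t x := fun x hx =>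
    harness_congr_epochs S (he x hx) _
  refine ⟨q, hq, ?_⟩
  rw [hS.lap_eq _ ⟨s, hs⟩, hS.lap_eq _ ⟨s, hs⟩, disc, disc]
  congr 2
  refine Finset.sum_congr rfl fun x hx => ?_
  rw [hh x (Finset.mem_insert_of_mem (Finset.mem_image_of_mem _ hx)),
    hh s (Finset.mem_insert_self _ _)]

/-- Passing from iterated to joint almost sure statements requires a measurable event; this is why
the events below are expressed through rational times. -/
theorem ae_prod_of_ae_ae {p : Conf (Site d) → Ω → Prop} (hp : MeasurableSet {z : Conf (Site d) × Ω |
    p z.1 z.2}) (h : ∀ᵐ S ∂(palm P), ∀ᵐ ω ∂Q, p S ω) : ∀ᵐ z ∂((palm P).prod Q), p z.1 z.2 :=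
  (Measure.ae_prod_mem_iff_ae_ae_mem hp).2 h

theorem Setting.ae_ae_of_goodPath (h : Setting P Q T idx γ) {p : Conf (Site d) → Ω → Prop}
    (hp : ∀ S, GoodConf γ S → ∀ ω, GoodPath (nbS S) (fun v : S => γ v S)
      (fun v : S => T (idx v S) ω) → p S ω) : ∀ᵐ S ∂(palm P), ∀ᵐ ω ∂Q, p S ω := by
  obtain ⟨π, _, hπ⟩ := h.model.exists_law
  filter_upwards [h.ae_goodConf] with S hS
  have hmp := measurePreserving_clocks h.model.poisson h.model.indep hπ
    (h.model.injective_idx S)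
  filter_upwards [hmp.quasiMeasurePreserving.ae (hS.ae_goodPath h.model hπ)] with ω hω
  exact hp S hS ω hω

theorem summable_of_tsum_ofReal_abs {ι : Type*} {f : ι → ℝ}
    (h : ∑' i, ENNReal.ofReal |f i| ≠ ⊤) : Summable f := by
  have := ENNReal.summable_toReal h
  exact Summable.of_abs (this.congr fun i => ENNReal.toReal_ofReal (abs_nonneg _))

theorem Model.measurable_clock (h : Model Q T idx γ) :
    Measurable fun p : (Conf (Site d) × Ω) × Site d => T (idx p.2 p.1.1) p.1.2 := by
  have hT : Measurable fun p : Ω × ℕ => T p.2 p.1 :=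
    measurable_from_prod_countable_left fun n => (h.poisson n).measurable
  exact hT.comp ((measurable_snd.comp measurable_fst).prodMk
    (h.measurable_idx.comp (measurable_snd.prodMk (measurable_fst.comp measurable_fst))))

theorem Setting.ae_summable (h : Setting P Q T idx γ) :
    ∀ᵐ p ∂((palm P).prod Q), ∀ t : ℝ, 0 ≤ t → ∀ s ∈ p.1, Summable fun s' : p.1 =>
      transProb p.1 (fun x => T (idx x p.1) p.2) t s s' * γ s' p.1 := by
  have hm : MeasurableSet {z : Conf (Site d) × Ω | ∀ s ∈ z.1, ∀ q : ℚ, ∑' s' : z.1,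
      ENNReal.ofReal |transProb z.1 (fun x => T (idx x z.1) z.2) q s s' * γ s' z.1| ≠ ⊤} := by
    refine measurableSet_forall_mem (C := Conf (Site d) × Ω) (D := {y | ∀ q : ℚ, ∑' s' : y.1.1,
      ENNReal.ofReal |transProb y.1.1 (fun x => T (idx x y.1.1) y.1.2) q y.2 s' *
        γ s' y.1.1| ≠ ⊤}) measurable_fst ?_
    rw [Set.ofPred_forall]
    refine MeasurableSet.iInter fun q => ?_
    have h1 : Measurable fun y : (Conf (Site d) × Ω) × Site d => ∑' s' : y.1.1,
        ENNReal.ofReal |transProb y.1.1 (fun x => T (idx x y.1.1) y.1.2) q y.2 s' *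
          γ s' y.1.1| := by
      refine measurable_tsum_conf (C := (Conf (Site d) × Ω) × Site d) (g := fun y s' =>
        ENNReal.ofReal |transProb y.1.1 (fun x => T (idx x y.1.1) y.1.2) q y.2 s' *
          γ s' y.1.1|) (measurable_fst.comp measurable_fst) ?_
      refine (measurable_abs.comp (Measurable.mul ?_ ?_)).ennreal_ofReal
      · exact (measurable_transProb (C := Conf (Site d) × Ω) (S := Prod.fst)
          (N := fun c x => T (idx x c.1) c.2) measurable_fst h.model.measurable_clock).comp
          (by fun_prop : Measurable fun w : ((Conf (Site d) × Ω) × Site d) × Site d =>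
            (w.1.1, w.1.2, (q : ℝ), w.2))
      · exact h.model.measurable_surface.comp (by fun_prop :
          Measurable fun w : ((Conf (Site d) × Ω) × Site d) × Site d => (w.2, w.1.1.1))
    exact h1 (measurableSet_singleton ⊤).compl
  have hae : ∀ᵐ (S : Conf (Site d)) ∂(palm P), ∀ᵐ ω ∂Q, ∀ s ∈ S, ∀ q : ℚ, ∑' s' : S,
      ENNReal.ofReal |transProb S (fun x => T (idx x S) ω) q s s' * γ s' S| ≠ ⊤ :=
    h.ae_ae_of_goodPath fun S hS ω hω s hs q => by
      refine ne_of_eq_of_ne (tsum_congr fun s' => ?_) (hω.finite q ⟨s, hs⟩)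
      rw [hS.finite.transProb_eq _ _ ⟨s, hs⟩ s', abs_mul, abs_of_nonneg ENNReal.toReal_nonneg,
        ENNReal.ofReal_mul ENNReal.toReal_nonneg, ENNReal.ofReal_toReal (graphTrans_ne_top _ _ _)]
  filter_upwards [ae_prod_of_ae_ae (p := fun S ω => ∀ s ∈ S, ∀ q : ℚ, ∑' s' : S,
      ENNReal.ofReal |transProb S (fun x => T (idx x S) ω) q s s' * γ s' S| ≠ ⊤) hm hae]
    with z hz t _ s hs
  obtain ⟨q, -, hq⟩ := exists_rat_epochs_eq (fun x => T (idx x z.1) z.2) {s} t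
  have he := hq s (Finset.mem_singleton_self s)
  simp_rw [← transProb_congr_epochs z.1 (N := fun x => T (idx x z.1) z.2) he]
  exact summable_of_tsum_ofReal_abs (hz s hs q)

theorem Setting.ae_tendsto_lap (h : Setting P Q T idx γ) :
    ∀ᵐ z ∂((palm P).prod Q), ∀ s ∈ z.1,
      Tendsto (fun t => lap z.1 (height T idx γ z.1 z.2 t) s) atTop (𝓝 0) := by
  obtain ⟨π, _, hπ⟩ := h.model.exists_law
  -- Convergence along rational times, written with countable quantifiers.
  have hm : MeasurableSet {z : Conf (Site d) × Ω | ∀ s ∈ z.1, ∀ k : ℕ, ∃ n : ℕ, ∀ q : ℚ,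
      (n : ℝ) ≤ q → |lap z.1 (height T idx γ z.1 z.2 q) s| ≤ 1 / ((k : ℝ) + 1)} := by
    refine measurableSet_forall_mem (C := Conf (Site d) × Ω) (D := {y | ∀ k : ℕ, ∃ n : ℕ, ∀ q : ℚ,
      (n : ℝ) ≤ q → |lap y.1.1 (height T idx γ y.1.1 y.1.2 q) y.2| ≤ 1 / ((k : ℝ) + 1)})
      measurable_fst ?_
    simp only [Set.ofPred_forall, Set.ofPred_exists]
    refine MeasurableSet.iInter fun k => MeasurableSet.iUnion fun n => MeasurableSet.iInter fun q =>
      MeasurableSet.iInter fun _ => ?_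
    exact measurableSet_le (measurable_abs.comp (h.model.measurable_lap_height
      (measurable_fst.comp measurable_fst) (measurable_snd.comp measurable_fst) measurable_const
      measurable_snd)) measurable_const
  have hae : ∀ᵐ S ∂(palm P), ∀ᵐ ω ∂Q, ∀ s ∈ S, ∀ k : ℕ, ∃ n : ℕ, ∀ q : ℚ,
      (n : ℝ) ≤ q → |lap S (height T idx γ S ω q) s| ≤ 1 / ((k : ℝ) + 1) := by
    filter_upwards [h.ae_goodConf, h.ae_lintegral_discQ_ne_top] with S hS hfin
    have h1 : ∀ᵐ N ∂(clockLaw S π), ∀ s : S,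
        Tendsto (fun t => disc (nbS S) (graphHarness (nbS S) N (fun v : S => γ v S) t) s)
          atTop (𝓝 0) := by
      refine ae_all_iff.2 fun s => ae_tendsto_disc (h.model.isPoisson hπ) (notMem_nbS S)
        hS.finite.nbS_symm (hS.ae_goodPath h.model hπ) (fun x => ?_) s
      refine ne_of_eq_of_ne (lintegral_congr fun u => ?_) (hfin x x.2)
      exact (h.model.discQ_eq hπ hS.finite u x).symm
    have hmp := measurePreserving_clocks h.model.poisson h.model.indep hπ
      (h.model.injective_idx S)
    filter_upwards [hmp.quasiMeasurePreserving.ae h1] with ω hω s hs k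
    have h2 := (hω ⟨s, hs⟩).const_mul (deg s S)
    rw [mul_zero] at h2
    have h3 := (Metric.tendsto_nhds.1 h2) (1 / ((k : ℝ) + 1)) (by positivity)
    obtain ⟨a, ha⟩ := eventually_atTop.1 h3
    obtain ⟨n, hn⟩ := exists_nat_ge a
    refine ⟨n, fun q hq => ?_⟩
    have h4 := (ha q (hn.trans hq)).le
    rw [Real.dist_eq, sub_zero] at h4
    rw [hS.finite.lap_eq _ ⟨s, hs⟩, funext fun v : S => hS.finite.height_eq ω q v]
    exact h4
  have hfd : ∀ᵐ z ∂((palm P).prod Q), FiniteDegrees z.1 :=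
    Measure.quasiMeasurePreserving_fst.ae h.ae_finiteDegrees
  filter_upwards [ae_prod_of_ae_ae (p := fun S ω => ∀ s ∈ S, ∀ k : ℕ, ∃ n : ℕ, ∀ q : ℚ,
    (n : ℝ) ≤ q → |lap S (height T idx γ S ω q) s| ≤ 1 / ((k : ℝ) + 1)) hm hae, hfd]
    with z hz hz2 s hs
  refine Metric.tendsto_nhds.2 fun ε hε => ?_
  obtain ⟨k, hk⟩ := exists_nat_one_div_lt hε
  obtain ⟨n, hn⟩ := hz s hs k
  filter_upwards [eventually_ge_atTop (n : ℝ)] with t ht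
  obtain ⟨q, hq, hl⟩ := hz2.exists_rat_lap_eq z.2 t hs
  rw [Real.dist_eq, sub_zero, ← hl]
  exact (hn q (ht.trans hq.le)).trans_lt hk

theorem Setting.ae_harmonic_iff (h : Setting P Q T idx γ) (t : ℝ) :
    (∀ᵐ z ∂((palm P).prod Q), IsHarmonicOn z.1 (height T idx γ z.1 z.2 t)) ↔
      dissipation P Q T idx γ t = 0 := by
  have hm : MeasurableSet {z : Conf (Site d) × Ω |
      IsHarmonicOn z.1 (height T idx γ z.1 z.2 t)} := by
    refine measurableSet_forall_mem (C := Conf (Site d) × Ω)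
      (D := {y | lap y.1.1 (height T idx γ y.1.1 y.1.2 t) y.2 = 0}) measurable_fst ?_
    exact (h.model.measurable_lap_height (measurable_fst.comp measurable_fst)
      (measurable_snd.comp measurable_fst) measurable_const measurable_snd)
      (measurableSet_singleton 0)
  refine (Measure.ae_prod_mem_iff_ae_ae_mem hm).trans ?_
  rw [h.dissipation_eq_zero_iff]
  have key : ∀ S, FiniteDegrees S → ((∀ᵐ ω ∂Q, IsHarmonicOn S (height T idx γ S ω t)) ↔
      ∀ x ∈ S, discQ Q T idx γ t x S = 0) := by
    intro S hS
    have h1 : (∀ᵐ ω ∂Q, IsHarmonicOn S (height T idx γ S ω t)) ↔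
        ∀ x : S, ∀ᵐ ω ∂Q, lap S (height T idx γ S ω t) x = 0 := by
      rw [← ae_all_iff]
      exact eventually_congr (Eventually.of_forall fun ω =>
        ⟨fun h x => h x x.2, fun h x hx => h ⟨x, hx⟩⟩)
    rw [h1, Subtype.forall]
    refine forall_congr' fun x => forall_congr' fun hx => ?_
    have hml : Measurable fun ω => lap S (height T idx γ S ω t) x :=
      h.model.measurable_lap_height measurable_const measurable_id measurable_const measurable_const
    rw [discQ, lintegral_eq_zero_iff ((hml.const_mul _).pow_const 2).ennreal_ofReal]
    refine eventually_congr (Eventually.of_forall fun ω => ?_)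
    simp only [Pi.zero_apply, ENNReal.ofReal_eq_zero]
    constructor
    · intro h0; rw [h0]; simp
    · intro h0
      have h2 : (deg x S)⁻¹ * lap S (height T idx γ S ω t) x = 0 := by
        have := le_antisymm h0 (sq_nonneg _)
        exact pow_eq_zero_iff two_ne_zero |>.1 this
      rw [hS.inv_deg_mul_lap _ ⟨x, hx⟩] at h2
      rw [hS.lap_eq _ ⟨x, hx⟩, h2, mul_zero]
  constructor
  · intro h0
    filter_upwards [h0, h.ae_finiteDegrees] with S hS1 hS2
    exact (key S hS2).1 hS1
  · intro h0
    filter_upwards [h0, h.ae_finiteDegrees] with S hS1 hS2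
    exact (key S hS2).2 hS1

theorem Setting.ae_memLp_and_tendsto (h : Setting P Q T idx γ) : ∀ᵐ S ∂(palm P),
    (∀ t : ℝ, 0 ≤ t →
      MemLp (fun ω => (deg 0 S)⁻¹ * lap S (height T idx γ S ω t) 0) 2 Q) ∧
    Tendsto (fun t => eLpNorm (fun ω => (deg 0 S)⁻¹ * lap S (height T idx γ S ω t) 0) 2 Q)
      atTop (𝓝 0) := by
  obtain ⟨π, _, hπ⟩ := h.model.exists_law
  filter_upwards [h.ae_goodConf, h.ae_lintegral_discQ_ne_top, ae_zero_mem_palm] with S hS hfin h0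
  let o : S := ⟨0, h0⟩
  have hq : ∀ u (x : S), discQ Q T idx γ u x S =
    discMean π (nbS S) (fun v : S => γ v S) u x := fun u x => h.model.discQ_eq hπ hS.finite u x
  have hint : ∀ x : S, ∫⁻ u in Ioi 0, discMean π (nbS S) (fun v : S => γ v S) u x ≠ ⊤ :=
    fun x => ne_of_eq_of_ne (lintegral_congr fun u => (hq u x).symm) (hfin x x.2)
  have hπ' := h.model.isPoisson hπ
  have hgood := hS.ae_goodPath h.model hπ
  -- The `L²` norm is the square root of `discMean`, so `tendsto_discMean` gives the limit.
  have hnorm : ∀ t, eLpNorm (fun ω => (deg 0 S)⁻¹ * lap S (height T idx γ S ω t) 0) 2 Q =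
      (discMean π (nbS S) (fun v : S => γ v S) t o) ^ (1 / 2 : ℝ) := by
    intro t
    rw [← hq, eLpNorm_eq_lintegral_rpow_enorm_toReal two_ne_zero ENNReal.ofNat_ne_top,
      ENNReal.toReal_ofNat]
    congr 1
    refine lintegral_congr fun ω => ?_
    rw [Real.enorm_eq_ofReal_abs, ENNReal.ofReal_rpow_of_nonneg (abs_nonneg _) zero_le_two,
      Real.rpow_two, sq_abs]
  refine ⟨fun t ht => ⟨?_, ?_⟩, ?_⟩
  · exact ((h.model.measurable_lap_height measurable_const measurable_id measurable_const
      measurable_const).const_mul _).aestronglyMeasurable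
  · rw [hnorm]
    refine ENNReal.rpow_lt_top_of_nonneg (by norm_num) ?_
    refine ne_top_of_le_ne_top ?_ (discMean_le hπ' (notMem_nbS S) hS.finite.nbS_symm hgood o
      le_rfl ht).1
    refine ENNReal.add_ne_top.2 ⟨?_, ne_top_of_le_ne_top (lintegral_discMean_nbAvg_ne_top hint o)
      (lintegral_mono_set Ioc_subset_Ioi_self)⟩
    have h1 : ∀ N : S → Conf ℝ, graphHarness (nbS S) N (fun v : S => γ v S) 0 =
        fun v : S => γ v S := fun N =>
      funext fun v => graphHarness_of_eq_empty (epochs_nonpos _ le_rfl)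
    simp [discMean, h1]
  · simp_rw [hnorm]
    have h2 := tendsto_discMean hπ' (notMem_nbS S) hS.finite.nbS_symm hgood hint o
    have h3 := ((ENNReal.continuous_rpow_const (y := (1 / 2 : ℝ))).tendsto 0).comp h2
    rwa [ENNReal.zero_rpow_of_pos (by norm_num)] at h3

theorem Model.measurable_sq_height_sub (h : Model Q T idx γ) (t : ℝ) :
    Measurable fun w : (Conf (Site d) × Ω) × Site d =>
      ENNReal.ofReal ((height T idx γ w.1.1 w.1.2 t w.2 - height T idx γ w.1.1 w.1.2 t 0) ^ 2) := by
  have h1 := fun {s : (Conf (Site d) × Ω) × Site d → Site d} (hs : Measurable s) =>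
    h.measurable_height (measurable_fst.comp measurable_fst)
      (measurable_snd.comp measurable_fst) (measurable_const (a := t)) hs
  exact (((h1 measurable_snd).sub (h1 measurable_const)).pow_const 2).ennreal_ofReal

theorem cond_mul_sq_grad (S : Conf (Site d)) (η : Site d → ℝ) (s s' : Site d) :
    ENNReal.ofReal (cond s s' S) * ENNReal.ofReal (|grad S η s s'| ^ 2) =
      ENNReal.ofReal (cond s s' S) * ENNReal.ofReal ((η s' - η s) ^ 2) := by
  classical
  rw [grad, cond]
  split_ifs
  · rw [one_mul, sq_abs]
  · rw [ENNReal.ofReal_zero, zero_mul, zero_mul]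

theorem Model.lintegral_tsum_sq_height_sub (h : Model Q T idx γ) (t : ℝ) (S : Conf (Site d)) :
    ∫⁻ ω, ∑' s : S, ENNReal.ofReal (cond 0 s S) *
      ENNReal.ofReal ((height T idx γ S ω t s - height T idx γ S ω t 0) ^ 2) ∂Q =
      ∑' s : S, ENNReal.ofReal (cond 0 s S) * edgeQ Q T idx γ t 0 s S := by
  have hm3 : ∀ s : S, Measurable fun ω =>
      ENNReal.ofReal ((height T idx γ S ω t s - height T idx γ S ω t 0) ^ 2) := fun s =>
    have h1 := fun x : Site d => h.measurable_height (C := Ω) (S := fun _ => S) (ω := id)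
      (t := fun _ => t) (s := fun _ => x) measurable_const measurable_id measurable_const
      measurable_const
    (((h1 s).sub (h1 0)).pow_const 2).ennreal_ofReal
  rw [lintegral_tsum fun s => ((hm3 s).const_mul _).aemeasurable]
  refine tsum_congr fun s => ?_
  rw [lintegral_const_mul _ (hm3 s), edgeQ]

theorem Setting.cesaroExt_eq (h : Setting P Q T idx γ) (t : ℝ) :
    cesaroExt ((palm P).prod Q) (fun s s' S ω =>
      ENNReal.ofReal (|grad S (fun x => height T idx γ S ω t x) s s'| ^ 2)) =
      (1 / 2) * energy P Q T idx γ t := by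
  have hm2 : Measurable fun z : Conf (Site d) × Ω => ∑' s : z.1, ENNReal.ofReal (cond 0 s z.1) *
      ENNReal.ofReal ((height T idx γ z.1 z.2 t s - height T idx γ z.1 z.2 t 0) ^ 2) :=
    measurable_tsum_cond_mul (C := Conf (Site d) × Ω) (S := Prod.fst) (q := fun z s =>
      ENNReal.ofReal ((height T idx γ z.1 z.2 t s - height T idx γ z.1 z.2 t 0) ^ 2))
      measurable_fst (h.model.measurable_sq_height_sub t)
  rw [cesaroExt, energy]
  simp_rw [cond_mul_sq_grad]
  rw [lintegral_prod _ hm2.aemeasurable]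
  congr 1
  exact lintegral_congr fun S => h.model.lintegral_tsum_sq_height_sub t S

/-! ### Surfaces and enumerations given on `Xi₁` -/

/-- The extension by a default value of a function on `Xi₁`. -/
noncomputable def extendXi {β : Type*} (b : β) (η : Site d → Conf (Site d) → β) (x : Site d)
    (S : Conf (Site d)) : β :=
  Function.extend Subtype.val (fun p : Xi₁ d => η p.1.1 p.1.2) (fun _ => b) (x, S)

theorem extendXi_of_mem {β : Type*} (b : β) (η : Site d → Conf (Site d) → β) {x : Site d}
    {S : Conf (Site d)} (hx : x ∈ S) : extendXi b η x S = η x S :=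
  Subtype.val_injective.extend_apply (fun p : Xi₁ d => η p.1.1 p.1.2) (fun _ => b) ⟨(x, S), hx⟩

/-- `Xi₁` is a measurable set, so the extension by a constant is measurable on all pairs, as the
compositions in the proofs require. -/
theorem measurable_extendXi {β : Type*} [MeasurableSpace β] (b : β)
    {η : Site d → Conf (Site d) → β} (hη : MeasurableOnXi₁ η) :
    Measurable fun p : Site d × Conf (Site d) => extendXi b η p.1 p.2 :=
  (MeasurableEmbedding.subtype_coe (s := Xi₁ d) (measurableSet_mem_conf measurable_snd
    measurable_fst)).measurable_extend hη measurable_const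

theorem grad_congr {S : Conf (Site d)} {η η' : Site d → ℝ} (h : ∀ x ∈ S, η x = η' x)
    (s s' : Site d) : grad S η s s' = grad S η' s s' := by
  classical
  rw [grad, grad, cond]
  split_ifs with hv
  · rw [h s hv.1, h s' hv.2.1]
  · rw [zero_mul, zero_mul]

theorem ofReal_deg_of_ne_top {s : Site d} {S : Conf (Site d)} (h : degE s S ≠ ⊤) :
    ENNReal.ofReal (deg s S) = degE s S := by
  have h1 : ∀ s' : S, (ENNReal.ofReal (cond s s' S)).toReal = cond s s' S := fun s' =>
    ENNReal.toReal_ofReal (by classical rw [cond]; split_ifs <;> norm_num)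
  rw [deg, ← tsum_congr h1, ← ENNReal.tsum_toReal_eq fun _ => ENNReal.ofReal_ne_top]
  exact ENNReal.ofReal_toReal h

/-- The exponential moment dominates the mean through `β * x ≤ exp (β * x)`. -/
theorem Assumptions.lintegral_degE_ne_top (hP : Assumptions P) :
    ∫⁻ S, degE 0 S ∂(palm P) ≠ ⊤ := by
  obtain ⟨hfin, β, hβ, hexp⟩ := hP.degree_moment
  refine ne_top_of_le_ne_top (ENNReal.mul_ne_top (ENNReal.ofReal_ne_top (r := β⁻¹)) hexp.ne) ?_
  rw [← lintegral_const_mul' _ _ ENNReal.ofReal_ne_top]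
  refine lintegral_mono_ae ?_
  filter_upwards [hfin] with S hS
  rw [← ofReal_deg_of_ne_top (degE_ne_top_of_finite hS), ← ENNReal.ofReal_mul (by positivity)]
  refine ENNReal.ofReal_le_ofReal ?_
  rw [← div_eq_inv_mul, le_div_iff₀ hβ, mul_comm]
  linarith [Real.add_one_le_exp (β * deg 0 S)]

theorem Assumptions.setting (hP : Assumptions P) (hT : ∀ n, IsPoissonProcess (T n) Q)
    (hT_indep : iIndepFun T Q) (hidx : IsEnumeration idx) (hγ : MeasurableOnXi₁ γ)
    (hγ_cov : IsCovariant fun s s' S => grad S (fun x => γ x S) s s') {r : ℝ} (hr : 4 < r)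
    (hγ_moment : cesaro (palm P)
      (fun s s' S => ENNReal.ofReal (|grad S (fun x => γ x S) s s'| ^ r)) < ⊤) :
    Setting P Q T (extendXi 0 idx) (extendXi 0 γ) where
  model :=
    { poisson := hT
      indep := hT_indep
      measurable_idx := measurable_extendXi 0 hidx.measurable
      injOn_idx := fun S x hx y hy hxy => hidx.injOn S hx hy (by
        simp only [extendXi_of_mem 0 idx (show x ∈ S from hx),
          extendXi_of_mem 0 idx (show y ∈ S from hy)] at hxy
        exact hxy)
      measurable_surface := measurable_extendXi 0 hγ
      covariant := fun S s hs s' hs' s'' hs'' => by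
        have h1 := hγ_cov S s hs s' hs' s'' hs''
        simp only at h1 ⊢
        rw [grad_congr (fun x hx => extendXi_of_mem 0 γ hx), h1,
          grad_congr (fun x hx => extendXi_of_mem 0 γ hx)] }
  stationary := hP.stationary
  finite := hP.degree_moment.1
  moment := by
    have h1 : ∫⁻ S, ∑' x : S, ENNReal.ofReal (cond 0 x S) *
        ENNReal.ofReal (|grad S (fun y => γ y S) 0 x| ^ r) ∂(palm P) ≠ ⊤ := by
      intro htop
      rw [cesaro, htop] at hγ_moment
      simp at hγ_moment
    -- The second moment of the gradient is bounded by `g² ≤ 1 + |g| ^ r`; the constant `1` costs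
    -- the mean degree.
    refine ne_top_of_le_ne_top (ENNReal.add_ne_top.2 ⟨hP.lintegral_degE_ne_top, h1⟩) ?_
    have hd : Measurable fun S : Conf (Site d) => degE 0 S :=
      measurable_degE measurable_id measurable_const
    rw [← lintegral_add_left hd]
    refine lintegral_mono fun S => ?_
    rw [degE, ← ENNReal.tsum_add]
    refine ENNReal.tsum_le_tsum fun x => ?_
    rw [grad_congr (fun x hx => extendXi_of_mem 0 γ hx)]
    set g := grad S (fun y => γ y S) 0 x
    calc ENNReal.ofReal (cond 0 x S) * ENNReal.ofReal (g ^ 2)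
        ≤ ENNReal.ofReal (cond 0 x S) * (1 + ENNReal.ofReal (|g| ^ r)) := by
          gcongr
          rw [← ENNReal.ofReal_one, ← ENNReal.ofReal_add zero_le_one (by positivity)]
          refine ENNReal.ofReal_le_ofReal ?_
          rw [← sq_abs]
          rcases le_total |g| 1 with hg | hg
          · have h2 : |g| ^ 2 ≤ 1 := pow_le_one₀ (abs_nonneg _) hg
            have h3 : 0 ≤ |g| ^ r := by positivity
            linarith
          · have h2 : |g| ^ 2 ≤ |g| ^ r := by
              rw [← Real.rpow_natCast]
              exact Real.rpow_le_rpow_of_exponent_le hg (by push_cast; linarith)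
            linarith
      _ = _ := by rw [mul_add, mul_one]

theorem height_extendXi {S : Conf (Site d)} (ω : Ω) (t : ℝ) {s : Site d} (hs : s ∈ S) :
    height T (extendXi 0 idx) (extendXi 0 γ) S ω t s =
      harness S (fun x => T (idx x S) ω) (fun x => γ x S) t s :=
  harness_congr (fun x hx => by rw [extendXi_of_mem 0 idx hx])
    (fun x hx => extendXi_of_mem 0 γ hx) t hs

end Final

end Harness
-- Assembly of the theorem
theorem mainTheorem5 {d : ℕ} (hd : 1 ≤ d)
    -- the law of the point process
    (P : Measure (Conf (Site d))) (hP : Assumptions P)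
    -- the independent Poisson clocks and the enumeration that attaches them to the points
    {Ω : Type*} [MeasurableSpace Ω] (Q : Measure Ω) [IsProbabilityMeasure Q]
    (T : ℕ → Ω → Conf ℝ) (hT : ∀ n, IsPoissonProcess (T n) Q) (hT_indep : iIndepFun T Q)
    (idx : Site d → Conf (Site d) → ℕ) (hidx : IsEnumeration idx)
    -- the initial surface
    (γ : Site d → Conf (Site d) → ℝ) (hγ : MeasurableOnXi₁ γ)
    (hγ_cov : IsCovariant fun s s' S => grad S (fun x => γ x S) s s')
    (r : ℝ) (hr : 4 < r)
    (hγ_moment : cesaro (palm P)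
      (fun s s' S => ENNReal.ofReal (|grad S (fun x => γ x S) s s'| ^ r)) < ⊤)
    -- the harness process, and the function `t ↦ 𝒞(|∇η_t|²)`
    (η : ℝ → Site d → Conf (Site d) → Ω → ℝ)
    (hη : η = fun t s S ω => harness S (fun x => T (idx x S) ω) (fun x => γ x S) t s)
    (D : ℝ → ℝ≥0∞)
    (hD : D = fun t => cesaroExt ((palm P).prod Q)
      (fun s s' S ω => ENNReal.ofReal (|grad S (fun x => η t x S ω) s s'| ^ 2))) :
    -- the series defining the process converge
    (∀ᵐ p ∂((palm P).prod Q), ∀ t : ℝ, 0 ≤ t → ∀ s ∈ p.1,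
      Summable fun s' : p.1 =>
        transProb p.1 (fun x => T (idx x p.1) p.2) t s s' * γ s' p.1) ∧
    -- (a)
    ((∀ t : ℝ, 0 ≤ t → D t < ⊤) ∧ AntitoneOn D (Ici 0)) ∧
    -- (b)
    (∀ t : ℝ, 0 ≤ t → (StrictlyDecreasingAt D t ↔
      ¬ ∀ᵐ p ∂((palm P).prod Q), IsHarmonicOn p.1 fun x => η t x p.1 p.2)) ∧
    -- (c)
    (∀ᵐ p ∂((palm P).prod Q),
      Tendsto (fun t => (deg 0 p.1)⁻¹ * lap p.1 (fun x => η t x p.1 p.2) 0) atTop (𝓝 0)) ∧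
    (∀ᵐ S ∂(palm P),
      (∀ t : ℝ, 0 ≤ t →
        MemLp (fun ω => (deg 0 S)⁻¹ * lap S (fun x => η t x S ω) 0) 2 Q) ∧
      Tendsto (fun t => eLpNorm (fun ω => (deg 0 S)⁻¹ * lap S (fun x => η t x S ω) 0) 2 Q)
        atTop (𝓝 0)) ∧
    -- (d)
    (∀ᵐ p ∂((palm P).prod Q), ∀ s ∈ p.1,
      Tendsto (fun t => lap p.1 (fun x => η t x p.1 p.2) s) atTop (𝓝 0)) := by
  have := hP.prob
  have := hP.isProbabilityMeasure_palm
  have h := hP.setting hT hT_indep hidx hγ hγ_cov hr hγ_moment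
  set i' : Site d → Conf (Site d) → ℕ := extendXi 0 idx with hi'
  set γ' : Site d → Conf (Site d) → ℝ := extendXi 0 γ with hγ'
  have heq : ∀ t S ω, ∀ x ∈ S, η t x S ω = height T i' γ' S ω t x := fun t S ω x hx => by
    rw [hη, height_extendXi ω t hx]
  have hlap : ∀ t S ω, ∀ s ∈ S, lap S (fun x => η t x S ω) s = lap S (height T i' γ' S ω t) s :=
    fun t S ω s hs => lap_congr (heq t S ω) hs
  have hDE : ∀ t, D t = (1 / 2) * energy P Q T i' γ' t := by
    intro t
    rw [← h.cesaroExt_eq, hD]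
    refine congrArg (cesaroExt ((palm P).prod Q)) ?_
    funext s s' S ω
    rw [grad_congr (heq t S ω)]
  have hfst : ∀ᵐ p ∂((palm P).prod Q), (0 : Site d) ∈ p.1 :=
    Measure.quasiMeasurePreserving_fst.ae ae_zero_mem_palm
  have hbal : ∀ a b, 0 ≤ a → a ≤ b → energy P Q T i' γ' b +
      2 * ∫⁻ u in Ioc a b, dissipation P Q T i' γ' u = energy P Q T i' γ' a :=
    fun a b ha hab => h.energy_balance ha hab
  have hanti : ∀ a b, 0 ≤ a → a ≤ b → energy P Q T i' γ' b ≤ energy P Q T i' γ' a :=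
    fun a b ha hab => by rw [← hbal a b ha hab]; exact le_self_add
  have hhalf : (1 / 2 : ℝ≥0∞) ≠ 0 ∧ (1 / 2 : ℝ≥0∞) ≠ ⊤ := by simp
  have htend : ∀ᵐ p ∂((palm P).prod Q), ∀ s ∈ p.1,
      Tendsto (fun t => lap p.1 (fun x => η t x p.1 p.2) s) atTop (𝓝 0) := by
    filter_upwards [h.ae_tendsto_lap] with p hp s hs
    simp_rw [hlap _ p.1 p.2 s hs]
    exact hp s hs
  refine ⟨?_, ⟨fun t ht => ?_, fun a ha b _ hab => ?_⟩, fun t ht => ?_, ?_, ?_, htend⟩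
  · filter_upwards [h.ae_summable] with p hp t ht s hs
    refine (hp t ht s hs).congr fun s' => ?_
    rw [hγ', extendXi_of_mem 0 γ s'.2, transProb, transProb]
    congr 1
    exact tsum_congr fun k => walkProb_congr
      (fun x hx => by rw [hi', extendXi_of_mem 0 idx hx]) k hs t s'
  · rw [hDE]
    exact ENNReal.mul_lt_top hhalf.2.lt_top
      ((hanti 0 t le_rfl ht).trans_lt h.energy_zero_ne_top.lt_top)
  · rw [hDE, hDE]
    gcongr
    exact hanti a b ha hab
  · have h1 : StrictlyDecreasingAt D t ↔ StrictlyDecreasingAt (energy P Q T i' γ') t := by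
      simp only [StrictlyDecreasingAt, hDE, ENNReal.mul_lt_mul_iff_right hhalf.1 hhalf.2]
    have h2 : ∀ p : Conf (Site d) × Ω, IsHarmonicOn p.1 (fun x => η t x p.1 p.2) ↔
        IsHarmonicOn p.1 (height T i' γ' p.1 p.2 t) := fun p =>
      forall₂_congr fun s hs => by rw [hlap t p.1 p.2 s hs]
    simp_rw [h2]
    rw [h1, h.ae_harmonic_iff]
    exact strictlyDecreasingAt_iff h.model.measurable_dissipation hbal h.energy_zero_ne_top
      (fun t ht => h.dissipation_le ht) h.energy_zero_ne_top
      (fun a b ha hab => h.dissipation_le_add ha hab) ht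
  -- The almost sure limit in (c) is (d) at the origin, divided by the degree, which does not depend
  -- on time.
  · filter_upwards [htend, hfst] with p hp h0
    simpa using (hp 0 h0).const_mul (deg 0 p.1)⁻¹
  · filter_upwards [h.ae_memLp_and_tendsto, ae_zero_mem_palm] with S hS h0
    simp_rw [hlap _ S _ 0 h0]
    exact hS
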